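/- Let $(X,Y)$ be a pair of simplicial sets ($Y\subseteq X$, possibly empty; an ordered simplicial complex is regarded as the simplicial set of its weakly increasing vertex strings that span a simplex). Let $C^k(X,Y;A)$ be the group of normalized $A$-valued $k$-cochains on $X$ (zero on degenerate simplices) that vanish on $Y$, with $C^k=0$ for $k<0$, let $d$ be the coboundary and $H^k(X,Y;A)$ the cohomology. For $\mathbb Z/2$-cochains let $\cup_i$ be Steenrod's products ($\cup_i=0$ for $i<0$), and put $Sq^2c=c\cup_{k-2}c+c\cup_{k-1}dc$ for $c$ of degree $k$. Consider two cases: * (Spin) $A=\mathbb R/\mathbb Z$ and $\iota\colon\mathbb Z/2\to A$, $\iota(1)=1/2$; * (Pin) $A=\mathbb Z/2$ and $\iota=\mathrm{id}$. For an integer $n$ let $\mathbf C_n(X,Y)$ be the set of pairs $(w,p)\in C^n(X,Y;A)\times C^{n-1}(X,Y;\mathbb Z/2)$ with $dp=0$ and $dw=\iota Sq^2p$. It is a group under $(w,p)(v,q)=(w+v+\iota(p\cup_{n-2}q),\,p+q)$, the elements $(df+\iota Sq^2c,\,dc)$ with $f\in C^{n-1}(X,Y;A)$, $c\in C^{n-2}(X,Y;\mathbb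 Z/2)$ form a normal subgroup, and the quotient $G_n(X,Y)$ (denoted $G_n^{spin}$, $G_n^{pin}$ in the two cases) is an abelian group. Put $$QH^n=H^n(X,Y;A)/\iota Sq^2H^{n-2}(X,Y;\mathbb Z/2),\qquad SH^{n-1}=\ker\bigl(\iota Sq^2\colon H^{n-1}(X,Y;\mathbb Z/2)\to H^{n+1}(X,Y;A)\bigr).$$ In both cases the following holds. 1. The maps $w\mapsto(w,0)$ and $(w,p)\mapsto p$ induce a short exact sequence $0\to QH^n\to G_n(X,Y)\to SH^{n-1}\to0$. 2. $G_n$ is a contravariant functor on simplicial pairs, and the exact sequence is natural. 3. A map of simplicial pairs that induces isomorphisms on $H^k(\,\cdot\,;\mathbb Z/2)$ and $H^k(\,\cdot\,;\mathbb R/\mathbb Z)$ for all $k$ induces an isomorphism on $G_n$. The same holds for a map of simplicial pairs whose geometric realization is a homotopy equivalence of pairs. 4. Homotopic maps $(T,B)\to(T',B')$ of topological pairs induce the same map $G_n(S(T'),S(B'))\to G_n(S(T),S(B))$, where $S$ is the singular complex. 5. Call a simplicial pair $K$ with a homeomorphism of its realization onto a topological pair $(T,B)$ a simplicial structure on $(T,B)$.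 The canonical simplicial map $K\to S(T,B)$ induces an isomorphism $\Phi_K\colon G_n(S(T),S(B))\to G_n(K)$. If a simplicial map $f\colon K\to L$ between simplicial structures on $(T,B)$ and $(T',B')$ has underlying continuous map $g$, then $f^*\Phi_L=\Phi_K S(g)^*$. If $f_0\colon K_0\to L_0$ and $f_1\colon K_1\to L_1$ are simplicial maps between simplicial structures on $(T,B)$ and on $(T',B')$ whose underlying continuous maps are homotopic as maps of pairs, then $\Phi_{K_0}^{-1}f_0^*\Phi_{L_0}=\Phi_{K_1}^{-1}f_1^*\Phi_{L_1}$. If $L$ is a simplicial structure on $I\times(T,B)$ and $i_0\colon K_0\to L$, $i_1\colon K_1\to L$ are simplicial maps from simplicial structures on $(T,B)$ whose underlying maps are $x\mapsto(0,x)$ and $x\mapsto(1,x)$, then $i_0^*$ and $i_1^*$ are isomorphisms on $G_n$ and $\Phi_{K_0}^{-1}i_0^*=\Phi_{K_1}^{-1}i_1^*$. -/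

import Mathlib

open CategoryTheory Opposite Simplicial

universe u

namespace SpinPin

/-- A simplicial pair: a simplicial set `X` with a simplicial subset `Y`. The absolute case is
`Y = ⊥`. An ordered simplicial complex is regarded as the simplicial set whose `q`-simplices are
the weakly increasing strings of vertices that span a simplex. -/
structure SPair where
  X : SSet.{u}
  Y : X.Subcomplex

/-- A map of simplicial pairs. -/
@[ext]
structure SPair.Hom (P Q : SPair.{u}) where
  map : P.X ⟶ Q.X
  mapsTo : ∀ (k : SimplexCategoryᵒᵖ) (s : P.X.obj k), s ∈ P.Y.obj k → map.app k s ∈ Q.Y.obj k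

instance : Category SPair.{u} where
  Hom := SPair.Hom
  id P := ⟨𝟙 P.X, fun _ _ hs => hs⟩
  comp f g := ⟨f.map ≫ g.map, fun k s hs => g.mapsTo k _ (f.mapsTo k s hs)⟩

/-- Inhomogeneous cochains: a value on every simplex of every dimension. The homogeneous,
normalized, relative cochains of degree `k` are singled out in `C` below. -/
abbrev Cochain (X : SSet.{u}) (A : Type) : Type u := ∀ m : ℕ, X _⦋m⦌ → A

section
variable {X : SSet.{u}} {A : Type} [AddCommGroup A]

/-- The coboundary `(dc)(s) = ∑ (-1)^i c(∂_i s)`. -/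
def coboundaryFun (c : Cochain X A) : Cochain X A := fun m =>
  match m with
  | 0 => fun _ => 0
  | m + 1 => fun s => ∑ i : Fin (m + 2), ((-1 : ℤ) ^ (i : ℕ)) • c m (X.δ i s)

/-- The coboundary as a homomorphism. -/
def d : Cochain X A →+ Cochain X A where
  toFun := coboundaryFun
  map_zero' := by
    funext m s
    cases m <;> simp [coboundaryFun]
  map_add' x y := by
    funext m s
    cases m <;> simp [coboundaryFun, Finset.sum_add_distrib]

/-- The face of an `m`-simplex spanned by the vertices that a strictly increasing map picks. -/
def face {k m : ℕ} (e : Fin (k + 1) ↪o Fin (m + 1)) (s : X _⦋m⦌) : X _⦋k⦌ :=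
  X.map (SimplexCategory.mkHom e.toOrderHom).op s

/-- The value of `c` on the face of the `m`-simplex `s` spanned by a set `S` of vertices of `[m]`;
it is `0` for `S = ∅`. -/
def onFace (c : Cochain X A) {m : ℕ} (s : X _⦋m⦌) (S : Finset (Fin (m + 1))) : A :=
  if h : S.Nonempty then
    c (S.card - 1) (face (S.orderEmbOfFin (by have := h.card_pos; omega)) s)
  else 0

theorem onFace_empty (c : Cochain X A) {m : ℕ} (s : X _⦋m⦌) : onFace c s ∅ = 0 := by
  simp [onFace]

theorem onFace_map (c : Cochain X A) {k m : ℕ} (e : Fin (k + 1) ↪o Fin (m + 1)) (s : X _⦋m⦌) :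
    onFace c s (Finset.univ.map e.toEmbedding) = c k (face e s) := by
  have hc : (Finset.univ.map e.toEmbedding).card = k + 1 := by simp
  have key : ∀ (S : Finset (Fin (m + 1))) (hS : S = Finset.univ.map e.toEmbedding) (l : ℕ)
      (hl : S.card = l + 1), c l (face (S.orderEmbOfFin hl) s) = c k (face e s) := by
    intro S hS l hl
    subst hS
    have : l = k := by omega
    subst this
    rw [← Finset.orderEmbOfFin_unique' hl (f := e) (by intro x; simp)]
  have hne : (Finset.univ.map e.toEmbedding).Nonempty := by
    rw [← Finset.card_pos]; omega
  rw [onFace, dif_pos hne]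
  exact key _ rfl _ _

theorem exists_emb {m : ℕ} {S : Finset (Fin (m + 1))} (h : S.Nonempty) :
    ∃ (k : ℕ) (e : Fin (k + 1) ↪o Fin (m + 1)), S = Finset.univ.map e.toEmbedding := by
  refine ⟨S.card - 1, S.orderEmbOfFin (by have := h.card_pos; omega), ?_⟩
  simp

theorem delta_face {k m : ℕ} (e : Fin (k + 2) ↪o Fin (m + 1)) (s : X _⦋m⦌) (i : Fin (k + 2)) :
    X.δ i (face e s) = face ((Fin.succAboveOrderEmb i).trans e) s := by
  unfold face
  rw [SimplicialObject.δ]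
  rw [← ConcreteCategory.comp_apply, ← X.map_comp]
  rfl

theorem onFace_univ (c : Cochain X A) {m : ℕ} (s : X _⦋m⦌) : onFace c s Finset.univ = c m s := by
  have := onFace_map c (OrderIso.refl (Fin (m+1))).toOrderEmbedding s
  rw [show face (OrderIso.refl (Fin (m+1))).toOrderEmbedding s = s from ?_] at this
  · rw [← this]; congr; ext; simp
  · exact ConcreteCategory.congr_hom (X.map_id _) s

end

theorem onFace_d {X : SSet.{u}} (c : Cochain X (ZMod 2)) {m : ℕ} (s : X _⦋m⦌)
    (S : Finset (Fin (m + 1))) :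
    onFace (d c) s S = ∑ v ∈ S, onFace c s (S.erase v) := by
  rcases S.eq_empty_or_nonempty with rfl | h
  · simp [onFace_empty]
  obtain ⟨k, e, rfl⟩ := exists_emb h
  rw [onFace_map, Finset.sum_map]
  cases k with
  | zero =>
    simp [d, coboundaryFun]
    exact (onFace_empty c s).symm
  | succ k =>
    simp only [d, AddMonoidHom.coe_mk, ZeroHom.coe_mk, coboundaryFun]
    refine Finset.sum_congr rfl fun i _ => ?_
    rw [delta_face, ← onFace_map c]
    have h1 : ∀ (n : ℕ) (a : ZMod 2), ((-1 : ℤ) ^ n) • a = a := by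
      intro n a
      rcases neg_one_pow_eq_or ℤ n with h | h <;> simp [h]
    rw [h1]
    congr 1
    ext x
    simp only [Finset.mem_map, Finset.mem_univ, true_and, Finset.mem_erase]
    constructor
    · rintro ⟨a, rfl⟩
      exact ⟨by simp, i.succAbove a, rfl⟩
    · rintro ⟨hx, a, rfl⟩
      obtain ⟨b, rfl⟩ := Fin.exists_succAbove_eq (x := a) (y := i) (fun h => hx (by rw [h]))
      exact ⟨b, rfl⟩


/-- The number of elements of `J` below `v`. -/
def rk {m : ℕ} (J : Finset (Fin m)) (v : Fin m) : ℕ := (J.filter (fun j => j < v)).card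

/-- For `J = {j_0 < j_1 < ⋯ < j_i}` in `[m]`, the union of the even-numbered intervals among
`[0, j_0], [j_0, j_1], …, [j_i, m]`: a vertex `v ∉ J` lies in the interval whose number is
`#{j ∈ J, j < v}`, and each `v ∈ J` lies in two consecutive intervals. -/
def evenPart {m : ℕ} (J : Finset (Fin m)) : Finset (Fin m) :=
  Finset.univ.filter (fun v => v ∈ J ∨ Even (rk J v))

/-- The union of the odd-numbered intervals among `[0, j_0], [j_0, j_1], …, [j_i, m]`. -/
def oddPart {m : ℕ} (J : Finset (Fin m)) : Finset (Fin m) :=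
  Finset.univ.filter (fun v => v ∈ J ∨ Odd (rk J v))

/-- The Steenrod product `x ∪_i y` of mod 2 cochains: on an `m`-simplex it is the sum over
`0 ≤ j_0 < ⋯ < j_i ≤ m` of `x([0,j_0] ∪ [j_1,j_2] ∪ ⋯) y([j_0,j_1] ∪ [j_2,j_3] ∪ ⋯)`.
For `i < 0` it is zero. -/
def cup {X : SSet.{u}} (i : ℤ) (x y : Cochain X (ZMod 2)) : Cochain X (ZMod 2) := fun m s =>
  ∑ J : Finset (Fin (m + 1)) with (J.card : ℤ) = i + 1,
    onFace x s (evenPart J) * onFace y s (oddPart J)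

section
variable {X : SSet.{u}}

theorem mod_two_add_self {M : Type*} [AddCommGroup M] [Module (ZMod 2) M] (a : M) : a + a = 0 := by
  have := two_smul (ZMod 2) a
  rw [← this, show (2 : ZMod 2) = 0 from rfl, zero_smul]

theorem onFace_add {A : Type} [AddCommGroup A] (x y : Cochain X A) {m : ℕ} (s : X _⦋m⦌) (S : Finset (Fin (m + 1))) :
    onFace (x + y) s S = onFace x s S + onFace y s S := by
  unfold onFace; split_ifs <;> simp

theorem onFace_face {A : Type} [AddCommGroup A] (c : Cochain X A) {k m : ℕ} (e : Fin (k + 1) ↪o Fin (m + 1)) (s : X _⦋m⦌)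
    (T : Finset (Fin (k + 1))) : onFace c (face e s) T = onFace c s (T.map e.toEmbedding) := by
  rcases T.eq_empty_or_nonempty with rfl | h
  · simp [onFace_empty]
  obtain ⟨l, g, rfl⟩ := exists_emb h
  rw [onFace_map, Finset.map_map]
  have := onFace_map c (g.trans e) s
  refine Eq.trans ?_ this.symm
  congr 1
  unfold face
  rw [← ConcreteCategory.comp_apply, ← X.map_comp]
  rfl

theorem rk_map {k m : ℕ} (e : Fin k ↪o Fin m) (J : Finset (Fin k)) (v : Fin k) :
    rk (J.map e.toEmbedding) (e v) = rk J v := by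
  unfold rk
  rw [Finset.filter_map, Finset.card_map]
  congr 1
  ext j; simp

theorem onFace_cup (i : ℤ) (x y : Cochain X (ZMod 2)) {m : ℕ} (s : X _⦋m⦌)
    (S : Finset (Fin (m + 1))) :
    onFace (cup i x y) s S = ∑ J ∈ S.powerset with (J.card : ℤ) = i + 1,
      onFace x s (evenPart J ∩ S) * onFace y s (oddPart J ∩ S) := by
  rcases S.eq_empty_or_nonempty with rfl | h
  · simp [onFace_empty]
  obtain ⟨k, e, rfl⟩ := exists_emb h
  rw [onFace_map]
  unfold cup
  refine Finset.sum_bij (fun J _ => J.map e.toEmbedding) ?_ ?_ ?_ ?_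
  · intro J hJ
    simpa using hJ
  · intro J _ J' _ hh
    exact Finset.map_injective _ hh
  · intro J hJ
    simp only [Finset.mem_filter, Finset.mem_powerset, Finset.subset_map_iff] at hJ
    obtain ⟨⟨u, -, rfl⟩, hc⟩ := hJ
    refine ⟨u, by simpa using hc, rfl⟩
  · intro J hJ
    rw [onFace_face, onFace_face]
    congr 2
    · ext v; simp only [evenPart, Finset.mem_map, Finset.mem_filter, Finset.mem_inter,
        Finset.mem_univ, true_and]
      constructor
      · rintro ⟨a, ha, rfl⟩
        refine ⟨?_, a, rfl⟩
        rcases ha with ha | ha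
        · exact Or.inl ⟨a, ha, rfl⟩
        · exact Or.inr (by have := rk_map e J a; simp at this ⊢; rwa [this])
      · rintro ⟨ha, a, rfl⟩
        refine ⟨a, ?_, rfl⟩
        rcases ha with ⟨b, hb, hab⟩ | ha
        · rw [e.toEmbedding.injective hab] at hb; exact Or.inl hb
        · exact Or.inr (by have := rk_map e J a; simp at this ha; rwa [this] at ha)
    · ext v; simp only [oddPart, Finset.mem_map, Finset.mem_filter, Finset.mem_inter,
        Finset.mem_univ, true_and]
      constructor
      · rintro ⟨a, ha, rfl⟩
        refine ⟨?_, a, rfl⟩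
        rcases ha with ha | ha
        · exact Or.inl ⟨a, ha, rfl⟩
        · exact Or.inr (by have := rk_map e J a; simp at this ⊢; rwa [this])
      · rintro ⟨ha, a, rfl⟩
        refine ⟨a, ?_, rfl⟩
        rcases ha with ⟨b, hb, hab⟩ | ha
        · rw [e.toEmbedding.injective hab] at hb; exact Or.inl hb
        · exact Or.inr (by have := rk_map e J a; simp at this ha; rwa [this] at ha)

/-- Auxiliary: the even or odd rule below the cut `t`, the opposite rule from `t` on. -/
def mixed {m : ℕ} (J : Finset (Fin m)) (b : Bool) (t : ℕ) : Finset (Fin m) :=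
  Finset.univ.filter (fun v => v ∈ J ∨ ((v : ℕ) < t ↔ (Even (rk J v) ↔ b = true)))

theorem rk_insert {m : ℕ} (J : Finset (Fin m)) {v : Fin m} (hv : v ∉ J) (u : Fin m) :
    rk (insert v J) u = rk J u + if v < u then 1 else 0 := by
  unfold rk
  rw [Finset.filter_insert]
  split_ifs with h
  · rw [Finset.card_insert_of_notMem (by simp [hv])]
  · simp

theorem mixed_sum {m : ℕ} (a b : Finset (Fin m) → ZMod 2) (J : Finset (Fin m)) :
    ∑ v ∈ Jᶜ, (a ((evenPart (insert v J)).erase v) * b (oddPart (insert v J)) +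
        a (evenPart (insert v J)) * b ((oddPart (insert v J)).erase v)) =
      a (evenPart J) * b (oddPart J) + b (evenPart J) * a (oddPart J) := by
  set F : ℕ → ZMod 2 := fun t => a (mixed J true t) * b (mixed J false t) with hF
  have h1 : ∀ v ∈ Jᶜ, (a ((evenPart (insert v J)).erase v) * b (oddPart (insert v J)) +
        a (evenPart (insert v J)) * b ((oddPart (insert v J)).erase v)) =
        F ((v : ℕ) + 1) - F v := by
    intro v hv
    rw [Finset.mem_compl] at hv
    rw [sub_eq_add_neg, ZModModule.neg_eq_self]
    have hrk := rk_insert J hv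
    have e0 : ∀ u : Fin m, (u : ℕ) < v ↔ u < v := fun u => Iff.rfl
    have e1 : ∀ u : Fin m, (u : ℕ) < v + 1 ↔ u ≤ v := fun u => Nat.lt_succ_iff
    by_cases hE : Even (rk J v)
    · rw [add_comm]
      congr 1 <;> simp only [hF] <;> congr 2 <;> ext u <;>
        simp only [evenPart, oddPart, mixed, Finset.mem_filter, Finset.mem_univ, true_and,
          Finset.mem_erase, Finset.mem_insert, hrk, e0, e1] <;>
        rcases lt_trichotomy u v with h | rfl | h <;>
        first
          | simp [h, h.ne, h.ne', h.le, h.not_gt, h.not_ge, Nat.even_add_one, Nat.odd_add_one]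
          | simp [hv, hE]
    · congr 1 <;> simp only [hF] <;> congr 2 <;> ext u <;>
        simp only [evenPart, oddPart, mixed, Finset.mem_filter, Finset.mem_univ, true_and,
          Finset.mem_erase, Finset.mem_insert, hrk, e0, e1] <;>
        rcases lt_trichotomy u v with h | rfl | h <;>
        first
          | simp [h, h.ne, h.ne', h.le, h.not_gt, h.not_ge, Nat.even_add_one, Nat.odd_add_one]
          | simp [hv, hE]
  have h2 : ∀ v ∈ J, F ((v : ℕ) + 1) - F v = 0 := by
    intro v hv
    have : ∀ c, mixed J c (v + 1) = mixed J c v := by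
      intro c; ext u
      simp only [mixed, Finset.mem_filter, Finset.mem_univ, true_and]
      by_cases hu : u = v
      · subst hu; simp [hv]
      · have : (u : ℕ) ≠ v := fun h => hu (Fin.ext h)
        have : (u : ℕ) < v + 1 ↔ (u : ℕ) < v := by omega
        rw [this]
    simp [hF, this]
  rw [Finset.sum_congr rfl h1]
  have h3 : ∑ v ∈ Jᶜ, (F ((v : ℕ) + 1) - F v) = ∑ v : Fin m, (F ((v : ℕ) + 1) - F v) := by
    rw [← Finset.sum_add_sum_compl J, Finset.sum_eq_zero h2, zero_add]
  rw [h3, Fin.sum_univ_eq_sum_range (fun v => F (v + 1) - F v), Finset.sum_range_sub,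
    sub_eq_add_neg, ZModModule.neg_eq_self]
  simp only [hF]
  rw [mul_comm (b _)]
  congr 3 <;> ext u <;> simp [mixed, evenPart, oddPart]

theorem d_apply (c : Cochain X (ZMod 2)) {m : ℕ} (s : X _⦋m⦌) :
    d c m s = ∑ v, onFace c s (Finset.univ.erase v) := by
  rw [← onFace_univ (d c) s, onFace_d]

theorem even_split {m : ℕ} (J : Finset (Fin m)) (f : Fin m → ZMod 2) :
    ∑ v ∈ evenPart J, f v = ∑ v ∈ J, f v + ∑ v ∈ Jᶜ with Even (rk J v), f v := by
  rw [← Finset.sum_union]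
  · congr 1; ext v; simp [evenPart]; tauto
  · rw [Finset.disjoint_left]; intro v; simp; tauto

theorem odd_split {m : ℕ} (J : Finset (Fin m)) (f : Fin m → ZMod 2) :
    ∑ v ∈ oddPart J, f v = ∑ v ∈ J, f v + ∑ v ∈ Jᶜ with ¬ Even (rk J v), f v := by
  rw [← Finset.sum_union]
  · congr 1; ext v; simp [oddPart]; tauto
  · rw [Finset.disjoint_left]; intro v; simp; tauto

/-- The Steenrod coboundary formula modulo two. -/
theorem d_cup (i : ℤ) (x y : Cochain X (ZMod 2)) :
    d (cup i x y) = cup i (d x) y + cup i x (d y) + cup (i - 1) x y + cup (i - 1) y x := by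
  funext m s
  set a := onFace x s with ha
  set b := onFace y s with hb
  have L : d (cup i x y) m s = ∑ J : Finset (Fin (m + 1)) with (J.card : ℤ) = i + 1,
      ∑ v ∈ Jᶜ, a ((evenPart J).erase v) * b ((oddPart J).erase v) := by
    rw [d_apply]
    simp only [onFace_cup]
    rw [Finset.sum_comm' (t' := Finset.univ.filter (fun J : Finset (Fin (m + 1)) => (J.card : ℤ) = i + 1))
      (s' := fun J => Jᶜ)]
    · refine Finset.sum_congr rfl fun J _ => Finset.sum_congr rfl fun v _ => ?_
      congr 2 <;> ext u <;> simp <;> tauto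
    · intro v J
      simp [Finset.subset_erase]
  have R : (cup i (d x) y + cup i x (d y)) m s =
      ∑ J : Finset (Fin (m + 1)) with (J.card : ℤ) = i + 1,
        (∑ v ∈ Jᶜ, a ((evenPart J).erase v) * b ((oddPart J).erase v) +
        ∑ v ∈ J, (a ((evenPart J).erase v) * b (oddPart J) +
          a (evenPart J) * b ((oddPart J).erase v))) := by
    simp only [Pi.add_apply, cup, onFace_d]
    rw [← Finset.sum_add_distrib]
    refine Finset.sum_congr rfl fun J _ => ?_
    rw [Finset.sum_mul, Finset.mul_sum, even_split, odd_split, Finset.sum_add_distrib,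
      ← Finset.sum_filter_add_sum_filter_not Jᶜ (fun v => Even (rk J v))
        (fun v => a ((evenPart J).erase v) * b ((oddPart J).erase v))]
    have e1 : ∑ v ∈ Jᶜ with Even (rk J v), a ((evenPart J).erase v) * b ((oddPart J).erase v) =
        ∑ v ∈ Jᶜ with Even (rk J v), a ((evenPart J).erase v) * b (oddPart J) := by
      refine Finset.sum_congr rfl fun v hv => ?_
      rw [Finset.erase_eq_of_notMem (a := v) (s := oddPart J)]
      simp [oddPart] at hv ⊢; exact hv
    have e2 : ∑ v ∈ Jᶜ with ¬ Even (rk J v), a ((evenPart J).erase v) * b ((oddPart J).erase v) =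
        ∑ v ∈ Jᶜ with ¬ Even (rk J v), a (evenPart J) * b ((oddPart J).erase v) := by
      refine Finset.sum_congr rfl fun v hv => ?_
      rw [Finset.erase_eq_of_notMem (a := v) (s := evenPart J)]
      simp [evenPart] at hv ⊢; exact hv
    rw [e1, e2]
    abel
  have M : ∑ J : Finset (Fin (m + 1)) with (J.card : ℤ) = i + 1,
        ∑ v ∈ J, (a ((evenPart J).erase v) * b (oddPart J) +
          a (evenPart J) * b ((oddPart J).erase v)) =
      (cup (i - 1) x y + cup (i - 1) y x) m s := by
    simp only [Pi.add_apply, cup, ← Finset.sum_add_distrib, sub_add_cancel]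
    rw [Finset.sum_congr rfl (fun J _ => (mixed_sum a b J).symm), Finset.sum_sigma',
      Finset.sum_sigma']
    refine Finset.sum_bij' (fun p _ => ⟨p.1.erase p.2, p.2⟩) (fun p _ => ⟨insert p.2 p.1, p.2⟩)
      ?_ ?_ ?_ ?_ ?_
    · rintro ⟨J, v⟩ h
      simp at h ⊢
      rw [Finset.card_erase_of_mem h.2]
      have := Finset.card_pos.2 ⟨v, h.2⟩
      omega
    · rintro ⟨J, v⟩ h
      simp at h ⊢
      rw [Finset.card_insert_of_notMem h.2]
      push_cast; omega
    · rintro ⟨J, v⟩ h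
      simp at h
      simp [Finset.insert_erase h.2]
    · rintro ⟨J, v⟩ h
      simp at h
      simp [h.2]
    · rintro ⟨J, v⟩ h
      simp at h
      simp [Finset.insert_erase h.2]
  rw [add_assoc, Pi.add_apply, Pi.add_apply, R, ← M, L, Finset.sum_add_distrib,
    add_assoc, mod_two_add_self, add_zero]
end

section
variable {X : SSet.{u}}

theorem d_d (c : Cochain X (ZMod 2)) : d (d c) = 0 := by
  funext m s
  rw [d_apply]
  simp only [onFace_d]
  rw [Finset.sum_sigma']
  refine Finset.sum_involution (fun p _ => ⟨p.2, p.1⟩) ?_ ?_ ?_ ?_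
  · rintro ⟨v, w⟩ _
    rw [Finset.erase_right_comm]
    exact mod_two_add_self _
  · rintro ⟨v, w⟩ h _ h'
    simp at h h'
    exact h h'.1
  · rintro ⟨v, w⟩ h
    simp at h ⊢
    exact fun h' => h h'.symm
  · rintro ⟨v, w⟩ _
    rfl

theorem cup_add_left (i : ℤ) (x x' y : Cochain X (ZMod 2)) :
    cup i (x + x') y = cup i x y + cup i x' y := by
  funext m s
  simp [cup, onFace_add, add_mul, Finset.sum_add_distrib]

theorem cup_add_right (i : ℤ) (x y y' : Cochain X (ZMod 2)) :
    cup i x (y + y') = cup i x y + cup i x y' := by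
  funext m s
  simp [cup, onFace_add, mul_add, Finset.sum_add_distrib]

theorem cup_zero_left (i : ℤ) (y : Cochain X (ZMod 2)) : cup i 0 y = 0 := by
  simpa using cup_add_left i 0 0 y

theorem cup_zero_right (i : ℤ) (x : Cochain X (ZMod 2)) : cup i x 0 = 0 := by
  simpa using cup_add_right i x 0 0

/-- The cochain operation `Sq² c = c ∪_{k-2} c + c ∪_{k-1} dc` on mod 2 cochains of degree `k`. -/
def Sq2 (k : ℤ) (c : Cochain X (ZMod 2)) : Cochain X (ZMod 2) :=
  cup (k - 2) c c + cup (k - 1) c (d c)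

theorem Sq2_zero (k : ℤ) : Sq2 k (0 : Cochain X (ZMod 2)) = 0 := by
  simp [Sq2, cup_zero_left]

theorem Sq2_cocycle (k : ℤ) {c : Cochain X (ZMod 2)} (hc : d c = 0) : Sq2 k c = cup (k - 2) c c := by
  simp [Sq2, hc, cup_zero_right]

theorem d_Sq2 (k : ℤ) (c : Cochain X (ZMod 2)) : d (Sq2 k c) = cup (k - 1) (d c) (d c) := by
  rw [Sq2, map_add, d_cup, d_cup, d_d, cup_zero_right, show k - 1 - 1 = k - 2 by ring]
  have h := mod_two_add_self (cup (k - 2 - 1) c c)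
  have h1 := mod_two_add_self (cup (k - 2) (d c) c)
  have h2 := mod_two_add_self (cup (k - 2) c (d c))
  linear_combination (exp := 1) h + h1 + h2

theorem Sq2_add (k : ℤ) (b c : Cochain X (ZMod 2)) :
    Sq2 k (b + c) = Sq2 k b + Sq2 k c + cup k (d b) (d c) +
      d (cup (k - 1) b c + cup k (d b) c) := by
  simp only [Sq2, map_add, d_cup, d_d, cup_zero_left, cup_add_left, cup_add_right,
    show k - 1 - 1 = k - 2 by ring]
  have h1 := mod_two_add_self (cup (k - 1) (d b) c)
  have h2 := mod_two_add_self (cup k (d b) (d c))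
  linear_combination (exp := 1) - h1 - h2 

theorem Sq2_add_cocycle (k : ℤ) {b c : Cochain X (ZMod 2)} (hb : d b = 0) :
    Sq2 k (b + c) = Sq2 k b + Sq2 k c + d (cup (k - 1) b c) := by
  rw [Sq2_add, hb, cup_zero_left, cup_zero_left, add_zero, add_zero]
end

/-- Normalized relative cochains of degree `k` with values in `A`: they live in dimension `k`, and
vanish on degenerate simplices and on `Y`. For `k < 0` this group is zero. -/
def C (P : SPair.{u}) (A : Type) [AddCommGroup A] (k : ℤ) : AddSubgroup (Cochain P.X A) where
  carrier := {c | ∀ (m : ℕ) (s : P.X _⦋m⦌),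
    ((m : ℤ) ≠ k ∨ s ∈ P.X.degenerate m ∨ s ∈ P.Y.obj (op ⦋m⦌)) → c m s = 0}
  zero_mem' _ _ _ := rfl
  add_mem' hx hy m s h := by simp [hx m s h, hy m s h]
  neg_mem' hx m s h := by simp [hx m s h]

section
variable {P : SPair.{u}} {A : Type} [AddCommGroup A]

theorem onFace_of_card {k : ℤ} {c : Cochain P.X A} (hc : c ∈ C P A k) {m : ℕ} (s : P.X _⦋m⦌)
    (S : Finset (Fin (m + 1))) (h : (S.card : ℤ) ≠ k + 1) : onFace c s S = 0 := by
  rcases S.eq_empty_or_nonempty with rfl | hS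
  · exact onFace_empty c s
  obtain ⟨l, e, rfl⟩ := exists_emb hS
  rw [onFace_map]
  refine hc _ _ (Or.inl ?_)
  simp at h
  omega

theorem onFace_of_mem {k : ℤ} {c : Cochain P.X A} (hc : c ∈ C P A k) {m : ℕ} {s : P.X _⦋m⦌}
    (hs : s ∈ P.Y.obj (op ⦋m⦌)) (S : Finset (Fin (m + 1))) : onFace c s S = 0 := by
  rcases S.eq_empty_or_nonempty with rfl | hS
  · exact onFace_empty c s
  obtain ⟨l, e, rfl⟩ := exists_emb hS
  rw [onFace_map]
  exact hc _ _ (Or.inr (Or.inr (P.Y.map _ hs)))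

theorem onFace_of_pair {k : ℤ} {c : Cochain P.X A} (hc : c ∈ C P A k) {m : ℕ} (t : P.X _⦋m⦌)
    (i : Fin (m + 1)) (S : Finset (Fin (m + 2))) (h : i.castSucc ∈ S) (h' : i.succ ∈ S) :
    onFace c (P.X.σ i t) S = 0 := by
  obtain ⟨l, e, rfl⟩ := exists_emb ⟨_, h⟩
  rw [onFace_map]
  refine hc _ _ (Or.inr (Or.inl ?_))
  simp only [Finset.mem_map, Finset.mem_univ, true_and] at h h'
  obtain ⟨a, ha⟩ := h
  obtain ⟨b, hb⟩ := h'
  have hab : a ≠ b := by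
    rintro rfl
    exact (Fin.castSucc_lt_succ (i := i)).ne (ha.symm.trans hb)
  cases l with
  | zero => exact absurd (Fin.ext (by omega)) hab
  | succ l =>
    have hface : face e (P.X.σ i t) =
        P.X.map (SimplexCategory.mkHom e.toOrderHom ≫ SimplexCategory.σ i).op t := by
      rw [op_comp, P.X.map_comp, ConcreteCategory.comp_apply]; rfl
    obtain ⟨j, θ, hθ⟩ := SimplexCategory.eq_σ_comp_of_not_injective
      (SimplexCategory.mkHom e.toOrderHom ≫ SimplexCategory.σ i) (by
        intro hinj
        refine hab (hinj ?_)
        change Fin.predAbove i (e a) = Fin.predAbove i (e b)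
        have ha' : e a = i.castSucc := ha
        have hb' : e b = i.succ := hb
        rw [ha', hb']; simp)
    rw [hface, hθ, op_comp, P.X.map_comp, ConcreteCategory.comp_apply]
    exact P.X.σ_mem_degenerate j _

theorem exists_sigma {m : ℕ} {s : P.X _⦋m + 1⦌} (hs : s ∈ P.X.degenerate (m + 1)) :
    ∃ (i : Fin (m + 1)) (t : P.X _⦋m⦌), P.X.σ i t = s := by
  rw [SSet.degenerate_eq_iUnion_range_σ] at hs
  simpa using hs

theorem d_mem {k l : ℤ} (h : k + 1 = l) {c : Cochain P.X (ZMod 2)} (hc : c ∈ C P (ZMod 2) k) :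
    d c ∈ C P (ZMod 2) l := by
  rintro m s (hm | hs | hs)
  · rw [d_apply]
    refine Finset.sum_eq_zero fun v _ => onFace_of_card hc _ _ ?_
    rw [Finset.card_erase_of_mem (Finset.mem_univ v)]
    simp; omega
  · cases m with
    | zero => simp at hs
    | succ m =>
      obtain ⟨i, t, rfl⟩ := exists_sigma hs
      have hne : i.castSucc ≠ i.succ := (Fin.castSucc_lt_succ (i := i)).ne
      simp only [d, AddMonoidHom.coe_mk, ZeroHom.coe_mk, coboundaryFun]
      have hz : ∀ v : Fin (m + 2), v ≠ i.castSucc → v ≠ i.succ →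
          c m (P.X.δ v (P.X.σ i t)) = 0 := by
        intro v h1 h2
        have := onFace_of_pair hc t i (Finset.univ.erase v) (by simp [h1.symm]) (by simp [h2.symm])
        have e2 := onFace_map c (Fin.succAboveOrderEmb v) (P.X.σ i t)
        rw [← this]
        refine e2.symm.trans ?_
        congr 1
        ext x
        simp only [Finset.mem_map, Finset.mem_univ, true_and, Finset.mem_erase, and_true]
        exact ⟨by rintro ⟨a, rfl⟩; exact Fin.succAbove_ne v a,
          fun hx => Fin.exists_succAbove_eq hx⟩
      rw [← Finset.sum_subset (Finset.subset_univ {i.castSucc, i.succ}),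
        Finset.sum_pair hne]
      · have e1 : P.X.δ i.castSucc (P.X.σ i t) = t :=
          ConcreteCategory.congr_hom (SimplicialObject.δ_comp_σ_self P.X (i := i)) t
        have e2 : P.X.δ i.succ (P.X.σ i t) = t :=
          ConcreteCategory.congr_hom (SimplicialObject.δ_comp_σ_succ P.X (i := i)) t
        rw [e1, e2]
        simp [pow_succ]
        exact mod_two_add_self _
      · intro v _ hv
        simp at hv
        rw [hz v hv.1 hv.2, smul_zero]
  · rw [d_apply]
    exact Finset.sum_eq_zero fun v _ => onFace_of_mem hc hs _

theorem card_parts {m : ℕ} (J : Finset (Fin m)) :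
    (evenPart J).card + (oddPart J).card = m + J.card := by
  rw [← Finset.card_union_add_card_inter]
  congr 1
  · have : evenPart J ∪ oddPart J = Finset.univ := by
      ext v; simp [evenPart, oddPart]
      rcases Nat.even_or_odd (rk J v) with h | h <;> simp [h]
    rw [this]; simp
  · congr 1; ext v; simp [evenPart, oddPart]
    constructor
    · rintro ⟨h | h, h' | h'⟩
      · exact h
      · exact h
      · exact h'
      · exact absurd h (Nat.not_even_iff_odd.2 h')
    · exact fun h => ⟨Or.inl h, Or.inl h⟩

theorem cup_mem {k l i n : ℤ} (h : k + l = n + i) {x y : Cochain P.X (ZMod 2)}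
    (hx : x ∈ C P (ZMod 2) k) (hy : y ∈ C P (ZMod 2) l) : cup i x y ∈ C P (ZMod 2) n := by
  rintro m s (hm | hs | hs)
  · refine Finset.sum_eq_zero fun J hJ => ?_
    simp at hJ
    have hc := card_parts J
    by_cases h1 : ((evenPart J).card : ℤ) = k + 1
    · rw [onFace_of_card hy s (oddPart J), mul_zero]
      omega
    · rw [onFace_of_card hx s _ h1, zero_mul]
  · cases m with
    | zero => simp at hs
    | succ m =>
      obtain ⟨j, t, rfl⟩ := exists_sigma hs
      refine Finset.sum_eq_zero fun J hJ => ?_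
      have hlt : j.castSucc < j.succ := Fin.castSucc_lt_succ
      by_cases h0 : j.castSucc ∈ J
      · have hr : rk J j.succ = rk J j.castSucc + 1 := by
          unfold rk
          rw [← Finset.card_insert_of_notMem (a := j.castSucc) (by simp)]
          congr 1; ext v
          simp only [Finset.mem_filter, Finset.mem_insert, Fin.lt_def, Fin.ext_iff]
          simp
          constructor
          · intro hv; by_cases hv' : (v : ℕ) = j
            · exact Or.inl hv'
            · exact Or.inr ⟨hv.1, by omega⟩
          · rintro (hv | hv)
            · have : v = j.castSucc := Fin.ext hv
              exact ⟨this ▸ h0, by omega⟩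
            · exact ⟨hv.1, by omega⟩
        rcases Nat.even_or_odd (rk J j.succ) with hp | hp
        · rw [onFace_of_pair hx t j _ (by simp [evenPart, h0]) (by simp [evenPart, hp]), zero_mul]
        · rw [onFace_of_pair hy t j _ (by simp [oddPart, h0]) (by simp [oddPart, hp]), mul_zero]
      · have hr : rk J j.succ = rk J j.castSucc := by
          unfold rk
          congr 1; ext v
          simp only [Finset.mem_filter, Fin.lt_def]
          simp
          intro hv
          have : (v : ℕ) ≠ j := fun h => h0 ((Fin.ext h : v = j.castSucc) ▸ hv)
          omega
        rcases Nat.even_or_odd (rk J j.succ) with hp | hp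
        · rw [onFace_of_pair hx t j _ (by simp [evenPart, ← hr, hp]) (by simp [evenPart, hp]),
            zero_mul]
        · rw [onFace_of_pair hy t j _ (by simp [oddPart, ← hr, hp]) (by simp [oddPart, hp]),
            mul_zero]
  · refine Finset.sum_eq_zero fun J hJ => ?_
    rw [onFace_of_mem hx hs, zero_mul]

theorem Sq2_mem {k l : ℤ} (h : k + 2 = l) {c : Cochain P.X (ZMod 2)} (hc : c ∈ C P (ZMod 2) k) :
    Sq2 k c ∈ C P (ZMod 2) l :=
  add_mem (cup_mem (by omega) hc hc) (cup_mem (by omega) hc (d_mem rfl hc))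

end

section Coefficients
variable {X : SSet.{u}} {A : Type} [AddCommGroup A]

/-- The coefficient morphism `ι` applied to cochains. -/
def push (ι : ZMod 2 →+ A) : Cochain X (ZMod 2) →+ Cochain X A where
  toFun c := fun m s => ι (c m s)
  map_zero' := by funext m s; simp
  map_add' x y := by funext m s; simp

theorem d_push (ι : ZMod 2 →+ A) (c : Cochain X (ZMod 2)) : d (push ι c) = push ι (d c) := by
  funext m s
  cases m with
  | zero => simp [d, push, coboundaryFun]
  | succ m =>
    simp only [d, push, coboundaryFun, AddMonoidHom.coe_mk, ZeroHom.coe_mk, map_sum, map_zsmul]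

theorem push_add_self (ι : ZMod 2 →+ A) (c : Cochain X (ZMod 2)) : push ι c + push ι c = 0 := by
  rw [← map_add, mod_two_add_self, map_zero]

theorem neg_push (ι : ZMod 2 →+ A) (c : Cochain X (ZMod 2)) : -push ι c = push ι c :=
  neg_eq_of_add_eq_zero_left (push_add_self ι c)

theorem push_mem {P : SPair.{u}} (ι : ZMod 2 →+ A) {k : ℤ} {c : Cochain P.X (ZMod 2)}
    (hc : c ∈ C P (ZMod 2) k) : push ι c ∈ C P A k := fun m s h => by
  simp [push, hc m s h]

end Coefficients

/-- Cocycles of degree `k`. -/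
def Z (P : SPair.{u}) (A : Type) [AddCommGroup A] (k : ℤ) : AddSubgroup (Cochain P.X A) :=
  C P A k ⊓ d.ker

theorem mem_Z {P : SPair.{u}} {A : Type} [AddCommGroup A] {k : ℤ} {c : Cochain P.X A} :
    c ∈ Z P A k ↔ c ∈ C P A k ∧ d c = 0 := Iff.rfl

/-- Coboundaries of degree `k`. -/
def B (P : SPair.{u}) (A : Type) [AddCommGroup A] (k : ℤ) : AddSubgroup (Cochain P.X A) :=
  (C P A (k - 1)).map d

/-- The cohomology group `H^k(X, Y; A)`. -/
abbrev H (P : SPair.{u}) (A : Type) [AddCommGroup A] (k : ℤ) : Type u :=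
  Z P A k ⧸ (B P A k).addSubgroupOf (Z P A k)

section Groups
variable {A : Type} [AddCommGroup A] (ι : ZMod 2 →+ A)

/-- The cocycle `ι Sq² c` of a mod 2 cocycle `c`. -/
def sqCocycle (P : SPair.{u}) {k l : ℤ} (h : k + 2 = l) (c : Z P (ZMod 2) k) : Z P A l :=
  ⟨push ι (Sq2 k c), mem_Z.2 ⟨push_mem ι (Sq2_mem h (mem_Z.1 c.2).1), by
    rw [d_push, d_Sq2, (mem_Z.1 c.2).2, cup_zero_left, map_zero]⟩⟩

/-- The homomorphism `ι Sq² : H^k(X, Y; ℤ/2) → H^{k+2}(X, Y; A)`. -/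
def sqH (P : SPair.{u}) {k l : ℤ} (h : k + 2 = l) : H P (ZMod 2) k →+ H P A l :=
  QuotientAddGroup.lift _
    (AddMonoidHom.mk' (fun c : Z P (ZMod 2) k => (QuotientAddGroup.mk (sqCocycle ι P h c) : H P A l))
      (by
        intro b c
        rw [← QuotientAddGroup.mk_add, eq_comm, QuotientAddGroup.eq]
        refine ⟨push ι (cup (k - 1) b c), push_mem ι (cup_mem (by omega) (mem_Z.1 b.2).1 (mem_Z.1 c.2).1), ?_⟩
        have hb : d (b : Cochain P.X (ZMod 2)) = 0 := (mem_Z.1 b.2).2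
        simp only [sqCocycle, AddSubgroup.coe_add, AddSubgroup.coe_neg, AddSubgroup.coe_subtype,
          Sq2_add_cocycle k hb, map_add, d_push]
        abel))
    (by
      rintro ⟨c, hc⟩ ⟨b, hb, rfl⟩
      rw [AddMonoidHom.mem_ker, AddMonoidHom.mk'_apply, QuotientAddGroup.eq_zero_iff]
      refine ⟨push ι (Sq2 (k - 1) b), push_mem ι (Sq2_mem (by omega) hb), ?_⟩
      simp only [sqCocycle, AddSubgroup.coe_subtype, d_push, d_Sq2]
      rw [Sq2_cocycle k (d_d b), show k - 1 - 1 = k - 2 by ring])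

/-- `QH^n = H^n(X, Y; A) / ι Sq² H^{n-2}(X, Y; ℤ/2)`. -/
abbrev QH (n : ℤ) (P : SPair.{u}) : Type u :=
  H P A n ⧸ (sqH ι P (show n - 2 + 2 = n by ring)).range

/-- `SH^{n-1}`, the kernel of `ι Sq² : H^{n-1}(X, Y; ℤ/2) → H^{n+1}(X, Y; A)`. -/
abbrev SH (n : ℤ) (P : SPair.{u}) : AddSubgroup (H P (ZMod 2) (n - 1)) :=
  (sqH ι P (show n - 1 + 2 = n + 1 by ring)).ker

/-- Pairs `(w, p)` in `C^n(A) × C^{n-1}(ℤ/2)` with `dp = 0` and `dw = ι Sq² p`. They form a group,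
written additively although it is not commutative, under
`(w, p)(v, q) = (w + v + ι(p ∪_{n-2} q), p + q)`. -/
@[ext]
structure CPair (n : ℤ) (P : SPair.{u}) where
  w : Cochain P.X A
  p : Cochain P.X (ZMod 2)
  w_mem : w ∈ C P A n
  p_mem : p ∈ C P (ZMod 2) (n - 1)
  dp : d p = 0
  dw : d w = push ι (Sq2 (n - 1) p)

namespace CPair
variable {ι} {n : ℤ} {P : SPair.{u}}

instance : Zero (CPair ι n P) :=
  ⟨⟨0, 0, zero_mem _, zero_mem _, map_zero _, by simp [Sq2_zero]⟩⟩

instance : Add (CPair ι n P) where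
  add x y := ⟨x.w + y.w + push ι (cup (n - 2) x.p y.p), x.p + y.p,
    add_mem (add_mem x.w_mem y.w_mem) (push_mem ι (cup_mem (by omega) x.p_mem y.p_mem)),
    add_mem x.p_mem y.p_mem, by rw [map_add, x.dp, y.dp, add_zero], by
      rw [map_add, map_add, x.dw, y.dw, d_push, Sq2_add_cocycle _ x.dp, map_add, map_add,
        show n - 1 - 1 = n - 2 by ring]⟩

instance : Neg (CPair ι n P) where
  neg x := ⟨-x.w + push ι (cup (n - 2) x.p x.p), x.p,
    add_mem (neg_mem x.w_mem) (push_mem ι (cup_mem (by omega) x.p_mem x.p_mem)), x.p_mem, x.dp, by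
      rw [map_add, map_neg, x.dw, d_push, d_cup, x.dp, cup_zero_left, cup_zero_right, zero_add,
        zero_add, mod_two_add_self, map_zero, add_zero, neg_push]⟩

theorem add_w (x y : CPair ι n P) : (x + y).w = x.w + y.w + push ι (cup (n - 2) x.p y.p) := rfl
theorem add_p (x y : CPair ι n P) : (x + y).p = x.p + y.p := rfl
theorem zero_w : (0 : CPair ι n P).w = 0 := rfl
theorem zero_p : (0 : CPair ι n P).p = 0 := rfl
theorem neg_w (x : CPair ι n P) : (-x).w = -x.w + push ι (cup (n - 2) x.p x.p) := rfl
theorem neg_p (x : CPair ι n P) : (-x).p = x.p := rfl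

instance : AddGroup (CPair ι n P) :=
  AddGroup.ofLeftAxioms
    (by
      intro x y z
      ext1
      · simp only [add_w, add_p, cup_add_left, cup_add_right, map_add]
        abel
      · simp only [add_p, add_assoc])
    (by
      intro x
      ext1
      · simp [add_w, zero_w, zero_p, cup_zero_left]
      · simp [add_p, zero_p])
    (by
      intro x
      ext1
      · simp only [add_w, neg_w, neg_p, zero_w]
        have := push_add_self ι (cup (n - 2) x.p x.p)
        linear_combination (norm := abel) this
      · exact mod_two_add_self _)

end CPair
end Groups
section Groups
variable {A : Type} [AddCommGroup A] (ι : ZMod 2 →+ A)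

/-- The subgroup of the pairs `(df + ι Sq² c, dc)`. -/
def relations (n : ℤ) (P : SPair.{u}) : AddSubgroup (CPair ι n P) where
  carrier := {x | ∃ f ∈ C P A (n - 1), ∃ c ∈ C P (ZMod 2) (n - 2),
    x.w = d f + push ι (Sq2 (n - 2) c) ∧ x.p = d c}
  zero_mem' := ⟨0, zero_mem _, 0, zero_mem _, by simp [CPair.zero_w, Sq2_zero],
    by simp [CPair.zero_p]⟩
  add_mem' := by
    rintro x y ⟨f, hf, b, hb, hx, hxp⟩ ⟨g, hg, c, hc, hy, hyp⟩
    have hdb := d_mem (l := n - 1) (by omega) hb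
    refine ⟨f + g + push ι (cup (n - 3) b c + cup (n - 2) (d b) c), add_mem (add_mem hf hg)
      (push_mem ι (add_mem (cup_mem (by omega) hb hc) (cup_mem (by omega) hdb hc))),
      b + c, add_mem hb hc, ?_, ?_⟩
    · rw [CPair.add_w, hx, hy, hxp, hyp, Sq2_add, show n - 2 - 1 = n - 3 by ring]
      simp only [map_add, d_push]
      have h1 := push_add_self ι (d (cup (n - 3) b c))
      have h2 := push_add_self ι (d (cup (n - 2) (d b) c))
      linear_combination (norm := abel) - h1 - h2
    · rw [CPair.add_p, hxp, hyp, map_add]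
  neg_mem' := by
    rintro x ⟨f, hf, c, hc, hx, hxp⟩
    have hdc := d_mem (l := n - 1) (by omega) hc
    refine ⟨-f + push ι (cup (n - 3) c c + cup (n - 2) (d c) c), add_mem (neg_mem hf)
      (push_mem ι (add_mem (cup_mem (by omega) hc hc) (cup_mem (by omega) hdc hc))), c, hc, ?_, ?_⟩
    · have h := congrArg (push ι) (Sq2_add (n - 2) c c)
      rw [mod_two_add_self, Sq2_zero, mod_two_add_self, zero_add,
        show n - 2 - 1 = n - 3 by ring] at h
      rw [CPair.neg_w, hx, hxp, map_add, d_push, map_neg, neg_add, neg_push]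
      simp only [map_add, map_zero] at h ⊢
      have h3 := push_add_self ι (cup (n - 2) (d c) (d c))
      linear_combination (norm := abel) h3 + h
    · rw [CPair.neg_p, hxp]

theorem relations_normal_aux {n : ℤ} {P : SPair.{u}} (x y : CPair ι n P) :
    x + y - (y + x) ∈ relations ι n P := by
  have hz : push ι (d (cup (n - 1) x.p y.p)) =
      push ι (cup (n - 2) x.p y.p) + push ι (cup (n - 2) y.p x.p) := by
    rw [d_cup, x.dp, y.dp, cup_zero_left, cup_zero_right, zero_add, zero_add, map_add,
      show n - 1 - 1 = n - 2 by ring]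
  have hm : push ι (cup (n - 1) x.p y.p) ∈ C P A (n - 1) :=
    push_mem ι (cup_mem (by omega) x.p_mem y.p_mem)
  let z : CPair ι n P := ⟨push ι (d (cup (n - 1) x.p y.p)), 0,
    push_mem ι (d_mem (by omega) (cup_mem (n := n - 1) (by omega) x.p_mem y.p_mem)),
    zero_mem _, map_zero _, by rw [d_push, d_d, Sq2_zero]⟩
  have h : x + y = z + (y + x) := by
    ext1
    · simp only [CPair.add_w, CPair.add_p, z, cup_zero_left, map_zero, hz]
      have := push_add_self ι (cup (n - 2) y.p x.p)
      linear_combination (norm := abel) - this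
    · simp only [CPair.add_p, z, zero_add, add_comm x.p]
  rw [h, add_sub_cancel_right]
  exact ⟨_, hm, 0, zero_mem _, by simp [z, Sq2_zero, d_push], by simp [z]⟩

instance (n : ℤ) (P : SPair.{u}) : (relations ι n P).Normal where
  conj_mem x hx g := by
    have h := add_mem (relations_normal_aux ι g x) hx
    rwa [sub_eq_add_neg, neg_add_rev, add_assoc, add_assoc, add_assoc, neg_add_cancel, add_zero,
      ← add_assoc] at h

/-- The group `G_n(X, Y)` attached to `ι : ℤ/2 → A`: pairs `(w, p)` modulo `(df + ι Sq² c, dc)`. -/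
abbrev G (n : ℤ) (P : SPair.{u}) : Type u := CPair ι n P ⧸ relations ι n P

/-- The quotient is an abelian group. -/
instance (n : ℤ) (P : SPair.{u}) : AddCommGroup (G ι n P) where
  add_comm := by
    intro x y
    induction x using QuotientAddGroup.induction_on with | H x => ?_
    induction y using QuotientAddGroup.induction_on with | H y => ?_
    rw [← QuotientAddGroup.mk_add, ← QuotientAddGroup.mk_add, eq_comm, QuotientAddGroup.eq]
    have h := (inferInstance : (relations ι n P).Normal).conj_mem _
      (relations_normal_aux ι x y) (-(y + x))
    simpa [sub_eq_add_neg, add_assoc] using h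

/-- The pair `(w, 0)` of a cocycle `w`. -/
def ofCocycle (n : ℤ) (P : SPair.{u}) (w : Z P A n) : CPair ι n P :=
  ⟨w, 0, (mem_Z.1 w.2).1, zero_mem _, map_zero _, by rw [Sq2_zero, map_zero, (mem_Z.1 w.2).2]⟩

/-- The map `H^n → G_n` induced by `w ↦ (w, 0)`. -/
def ofH (n : ℤ) (P : SPair.{u}) : H P A n →+ G ι n P :=
  QuotientAddGroup.lift _
    (AddMonoidHom.mk' (fun w : Z P A n => (QuotientAddGroup.mk (ofCocycle ι n P w) : G ι n P)) (by
      intro w v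
      rw [← QuotientAddGroup.mk_add]
      congr 1
      ext1 <;> simp [ofCocycle, CPair.add_w, CPair.add_p, cup_zero_left]))
    (by
      rintro ⟨w, hw⟩ ⟨f, hf, rfl⟩
      rw [AddMonoidHom.mem_ker, AddMonoidHom.mk'_apply, QuotientAddGroup.eq_zero_iff]
      exact ⟨f, hf, 0, zero_mem _, by simp [ofCocycle, Sq2_zero], by simp [ofCocycle]⟩)

/-- The map `QH^n → G_n` induced by `w ↦ (w, 0)`. -/
def ofQH (n : ℤ) (P : SPair.{u}) : QH ι n P →+ G ι n P :=
  QuotientAddGroup.lift _ (ofH ι n P) (by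
    rintro _ ⟨c, rfl⟩
    induction c using QuotientAddGroup.induction_on with | H c => ?_
    change (QuotientAddGroup.mk (ofCocycle ι n P (sqCocycle ι P _ c)) : G ι n P) = 0
    rw [QuotientAddGroup.eq_zero_iff]
    exact ⟨0, zero_mem _, c, (mem_Z.1 c.2).1, by simp [ofCocycle, sqCocycle],
      (mem_Z.1 c.2).2.symm⟩)

/-- The map `G_n → H^{n-1}` induced by `(w, p) ↦ p`. -/
def toH (n : ℤ) (P : SPair.{u}) : G ι n P →+ H P (ZMod 2) (n - 1) :=
  QuotientAddGroup.lift _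
    (AddMonoidHom.mk' (fun x : CPair ι n P =>
      (QuotientAddGroup.mk ⟨x.p, mem_Z.2 ⟨x.p_mem, x.dp⟩⟩ : H P (ZMod 2) (n - 1))) (fun _ _ => rfl))
    (by
      rintro x ⟨f, hf, c, hc, -, hx⟩
      change (QuotientAddGroup.mk _ : H P (ZMod 2) (n - 1)) = 0
      rw [QuotientAddGroup.eq_zero_iff]
      exact ⟨c, by rwa [show n - 1 - 1 = n - 2 by ring], hx.symm⟩)

/-- The map `G_n → SH^{n-1}` induced by `(w, p) ↦ p`. -/
def toSH (n : ℤ) (P : SPair.{u}) : G ι n P →+ SH ι n P :=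
  (toH ι n P).codRestrict (SH ι n P) (by
    intro x
    induction x using QuotientAddGroup.induction_on with | H x => ?_
    change (QuotientAddGroup.mk (sqCocycle ι P _ ⟨x.p, mem_Z.2 ⟨x.p_mem, x.dp⟩⟩) : H P A (n + 1)) = 0
    rw [QuotientAddGroup.eq_zero_iff]
    exact ⟨x.w, by rw [show n + 1 - 1 = n by ring]; exact x.w_mem, x.dw⟩)

end Groups

section Functoriality
variable {A : Type} [AddCommGroup A] {P Q : SPair.{u}}

/-- Pull-back of cochains along a simplicial map. -/
def pull (A : Type) [AddCommGroup A] (f : P ⟶ Q) : Cochain Q.X A →+ Cochain P.X A where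
  toFun c := fun m s => c m (f.map.app (op ⦋m⦌) s)
  map_zero' := rfl
  map_add' _ _ := rfl

theorem pull_mem (f : P ⟶ Q) {k : ℤ} {c : Cochain Q.X A} (hc : c ∈ C Q A k) :
    pull A f c ∈ C P A k := by
  rintro m s (h | h | h)
  · exact hc _ _ (Or.inl h)
  · exact hc _ _ (Or.inr (Or.inl (SSet.degenerate_app_apply h f.map)))
  · exact hc _ _ (Or.inr (Or.inr (f.mapsTo _ _ h)))

theorem d_pull (f : P ⟶ Q) (c : Cochain Q.X A) : d (pull A f c) = pull A f (d c) := by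
  funext m s
  cases m with
  | zero => rfl
  | succ m =>
    simp only [d, pull, coboundaryFun, AddMonoidHom.coe_mk, ZeroHom.coe_mk]
    refine Finset.sum_congr rfl fun i _ => ?_
    congr 2
    exact ConcreteCategory.congr_hom (f.map.naturality (SimplexCategory.δ i).op) s

theorem onFace_pull (f : P ⟶ Q) (c : Cochain Q.X A) {m : ℕ} (s : P.X _⦋m⦌)
    (S : Finset (Fin (m + 1))) :
    onFace (pull A f c) s S = onFace c (f.map.app (op ⦋m⦌) s) S := by
  rcases S.eq_empty_or_nonempty with rfl | hS
  · simp [onFace_empty]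
  obtain ⟨l, e, rfl⟩ := exists_emb hS
  rw [onFace_map, onFace_map]
  simp only [pull, AddMonoidHom.coe_mk, ZeroHom.coe_mk]
  congr 1
  exact ConcreteCategory.congr_hom
    (f.map.naturality (SimplexCategory.mkHom e.toOrderHom).op) s

theorem cup_pull (f : P ⟶ Q) (i : ℤ) (x y : Cochain Q.X (ZMod 2)) :
    cup i (pull _ f x) (pull _ f y) = pull _ f (cup i x y) := by
  funext m s
  simp only [cup, onFace_pull]
  rfl

theorem Sq2_pull (f : P ⟶ Q) (k : ℤ) (c : Cochain Q.X (ZMod 2)) :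
    Sq2 k (pull _ f c) = pull _ f (Sq2 k c) := by
  simp only [Sq2, d_pull, cup_pull, map_add]

theorem push_pull (ι : ZMod 2 →+ A) (f : P ⟶ Q) (c : Cochain Q.X (ZMod 2)) :
    push ι (pull _ f c) = pull A f (push ι c) := rfl

/-- The map induced on cocycles. -/
def Z.map (A : Type) [AddCommGroup A] (k : ℤ) (f : P ⟶ Q) : Z Q A k →+ Z P A k :=
  ((pull A f).comp (Z Q A k).subtype).codRestrict (Z P A k) (fun c => mem_Z.2
    ⟨pull_mem f (mem_Z.1 c.2).1, by
      change d (pull A f c) = 0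
      rw [d_pull, (mem_Z.1 c.2).2, map_zero]⟩)

/-- The map induced on cohomology. -/
def H.map (A : Type) [AddCommGroup A] (k : ℤ) (f : P ⟶ Q) : H Q A k →+ H P A k :=
  QuotientAddGroup.map _ _ (Z.map A k f) (by
    rintro ⟨c, hc⟩ ⟨b, hb, rfl⟩
    exact ⟨pull A f b, pull_mem f hb, d_pull f b⟩)

variable (ι : ZMod 2 →+ A)

theorem sqH_naturality (f : P ⟶ Q) {k l : ℤ} (h : k + 2 = l) (c : H Q (ZMod 2) k) :
    H.map A l f (sqH ι Q h c) = sqH ι P h (H.map (ZMod 2) k f c) := by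
  induction c using QuotientAddGroup.induction_on with | H c => ?_
  change (QuotientAddGroup.mk _ : H P A l) = QuotientAddGroup.mk _
  congr 1
  apply Subtype.ext
  change pull A f (push ι (Sq2 k c)) = push ι (Sq2 k (pull _ f c))
  rw [Sq2_pull, push_pull]

/-- The map induced on `QH^n`. -/
def QH.map (n : ℤ) (f : P ⟶ Q) : QH ι n Q →+ QH ι n P :=
  QuotientAddGroup.map _ _ (H.map A n f) (by
    rintro _ ⟨c, rfl⟩
    exact ⟨H.map (ZMod 2) (n - 2) f c, (sqH_naturality ι f _ c).symm⟩)

/-- The map induced on `SH^{n-1}`. -/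
def SH.map (n : ℤ) (f : P ⟶ Q) : SH ι n Q →+ SH ι n P :=
  ((H.map (ZMod 2) (n - 1) f).comp (SH ι n Q).subtype).codRestrict (SH ι n P) (by
    rintro ⟨c, hc⟩
    have hc' : sqH ι Q _ c = 0 := hc
    change sqH ι P _ (H.map (ZMod 2) (n - 1) f c) = 0
    rw [← sqH_naturality, hc', map_zero])

/-- The map `(w, p) ↦ (f^* w, f^* p)`. -/
def CPair.map (n : ℤ) (f : P ⟶ Q) : CPair ι n Q →+ CPair ι n P :=
  AddMonoidHom.mk' (fun x => ⟨pull A f x.w, pull _ f x.p, pull_mem f x.w_mem, pull_mem f x.p_mem,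
      by rw [d_pull, x.dp, map_zero], by rw [d_pull, x.dw, Sq2_pull, push_pull]⟩) (by
    intro x y
    ext1
    · simp only [CPair.add_w, map_add, cup_pull, push_pull]
    · simp only [CPair.add_p, map_add])

/-- The map induced on `G_n`. -/
def G.map (n : ℤ) (f : P ⟶ Q) : G ι n Q →+ G ι n P :=
  QuotientAddGroup.map _ _ (CPair.map ι n f) (by
    rintro x ⟨g, hg, c, hc, hx, hxp⟩
    refine ⟨pull A f g, pull_mem f hg, pull _ f c, pull_mem f hc, ?_, ?_⟩
    · change pull A f x.w = _
      rw [hx, map_add, d_pull, Sq2_pull, push_pull]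
    · change pull _ f x.p = _
      rw [hxp, d_pull])

end Functoriality

/-- The two versions of the construction: `spin` has `A = ℝ/ℤ` and `ι = 1/2`, and `pin` has
`A = ℤ/2` and `ι = id`. -/
inductive Flavor where
  | spin
  | pin

namespace Flavor

/-- The coefficient group. -/
def Coeff (v : Flavor) : Type :=
  match v with
  | spin => UnitAddCircle
  | pin => ZMod 2

instance (v : Flavor) : AddCommGroup v.Coeff :=
  match v with
  | spin => inferInstanceAs (AddCommGroup UnitAddCircle)
  | pin => inferInstanceAs (AddCommGroup (ZMod 2))

end Flavor

/-- The coefficient morphism `1/2 : ℤ/2 → ℝ/ℤ`. -/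
noncomputable def half : ZMod 2 →+ UnitAddCircle :=
  ZMod.lift 2 ⟨zmultiplesHom UnitAddCircle ((1 / 2 : ℝ) : UnitAddCircle), by
    simp only [zmultiplesHom_apply]
    rw [← AddCircle.coe_zsmul]
    norm_num⟩

/-- The coefficient morphism `ℤ/2 → A` of each version. -/
noncomputable def Flavor.incl (v : Flavor) : ZMod 2 →+ v.Coeff :=
  match v with
  | spin => half
  | pin => AddMonoidHom.id (ZMod 2)

noncomputable section Topology

/-- The singular complex of a topological pair. -/
def singPair (T : TopPair.{u}) : SPair.{u} where
  X := TopCat.toSSet.obj T.right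
  Y := SSet.Subcomplex.range (TopCat.toSSet.map T.hom)

/-- The map of singular complexes induced by a map of topological pairs. -/
def singMap {T U : TopPair.{u}} (g : T ⟶ U) : singPair T ⟶ singPair U where
  map := TopCat.toSSet.map g.hom.right
  mapsTo := by
    rintro k _ ⟨t, rfl⟩
    refine ⟨(TopCat.toSSet.map g.hom.left).app k t, ?_⟩
    have h : TopCat.toSSet.map g.hom.left ≫ TopCat.toSSet.map U.hom =
        TopCat.toSSet.map T.hom ≫ TopCat.toSSet.map g.hom.right := by
      rw [← Functor.map_comp, ← Functor.map_comp]
      exact congrArg _ g.hom.w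
    exact ConcreteCategory.congr_hom (NatTrans.congr_app h k) t

/-- The geometric realization of a simplicial pair: `|X|` with the image of `|Y|`. -/
def realPair (P : SPair.{u}) : TopPair.{u} :=
  TopPair.ofSubset (X := SSet.toTop.obj P.X) (Set.range (SSet.toTop.map P.Y.ι))

/-- The restriction of a map of pairs to the simplicial subsets. -/
def SPair.Hom.restrict {P Q : SPair.{u}} (f : P ⟶ Q) : (P.Y : SSet.{u}) ⟶ (Q.Y : SSet.{u}) :=
  SSet.Subcomplex.lift (P.Y.ι ≫ f.map) (by
    rintro k _ ⟨s, rfl⟩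
    exact f.mapsTo k _ s.2)

theorem realMap_aux {P Q : SPair.{u}} (f : P ⟶ Q) (y : Set.range (SSet.toTop.map P.Y.ι)) :
    SSet.toTop.map f.map y.1 ∈ Set.range (SSet.toTop.map Q.Y.ι) := by
  obtain ⟨_, z, rfl⟩ := y
  refine ⟨SSet.toTop.map (SPair.Hom.restrict f) z, ?_⟩
  have h : SSet.toTop.map (SPair.Hom.restrict f) ≫ SSet.toTop.map Q.Y.ι =
      SSet.toTop.map P.Y.ι ≫ SSet.toTop.map f.map := by
    rw [← Functor.map_comp, ← Functor.map_comp]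
    rfl
  exact ConcreteCategory.congr_hom h z

/-- The geometric realization of a map of simplicial pairs. -/
def realMap {P Q : SPair.{u}} (f : P ⟶ Q) : realPair P ⟶ realPair Q :=
  TopPair.ofHom (X := realPair P) (Y := realPair Q) (SSet.toTop.map f.map)
    (TopCat.ofHom ⟨fun y => ⟨SSet.toTop.map f.map y.1, realMap_aux f y⟩, by fun_prop⟩) (by
      ext y; rfl)

theorem mem_range_of_comp {X V W : SSet.{u}} (Y : X.Subcomplex) (q : X ⟶ W) (g : (Y : SSet.{u}) ⟶ V)
    (f : V ⟶ W) (h : g ≫ f = Y.ι ≫ q) (k : SimplexCategoryᵒᵖ) (s : X.obj k) (hs : s ∈ Y.obj k) :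
    q.app k s ∈ (SSet.Subcomplex.range f).obj k :=
  ⟨g.app k ⟨s, hs⟩, ConcreteCategory.congr_hom (NatTrans.congr_app h k) ⟨s, hs⟩⟩

theorem unitPair_aux {X : SSet.{u}} (Y : X.Subcomplex) {A : TopCat.{u}}
    (e : A ⟶ SSet.toTop.obj X) (r : SSet.toTop.obj (Y : SSet.{u}) ⟶ A)
    (hr : r ≫ e = SSet.toTop.map Y.ι) (k : SimplexCategoryᵒᵖ) (s : X.obj k) (hs : s ∈ Y.obj k) :
    (sSetTopAdj.unit.app X).app k s ∈ (SSet.Subcomplex.range (TopCat.toSSet.map e)).obj k := by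
  have h : (sSetTopAdj.unit.app (Y : SSet.{u}) ≫ TopCat.toSSet.map r) ≫ TopCat.toSSet.map e =
      Y.ι ≫ sSetTopAdj.unit.app X := by
    rw [Category.assoc, ← Functor.map_comp, hr]
    exact (sSetTopAdj.unit.naturality Y.ι).symm
  exact mem_range_of_comp Y _ _ _ h k s hs

/-- The canonical simplicial map from a simplicial pair to the singular complex of its
realization. -/
def unitPair (P : SPair.{u}) : P ⟶ singPair (realPair P) where
  map := sSetTopAdj.unit.app P.X
  mapsTo := unitPair_aux P.Y (A := TopCat.of (Set.range (SSet.toTop.map P.Y.ι)))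
    (TopCat.ofHom { toFun := Subtype.val })
    (TopCat.ofHom ⟨fun y => ⟨SSet.toTop.map P.Y.ι y, y, rfl⟩, by fun_prop⟩) (by ext y; rfl)

/-- A simplicial structure on a topological pair: a simplicial pair with a homeomorphism of its
realization onto the topological pair. -/
structure SimplicialStructure (T : TopPair.{u}) where
  K : SPair.{u}
  iso : realPair K ≅ T

namespace SimplicialStructure
variable {T U : TopPair.{u}}

/-- The canonical simplicial map from a simplicial structure to the singular complex. -/
def toSing (K : SimplicialStructure T) : K.K ⟶ singPair T :=
  unitPair K.K ≫ singMap K.iso.hom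

/-- The continuous map `T → U` underlying a simplicial map between simplicial structures. -/
def underlying (K : SimplicialStructure T) (L : SimplicialStructure U) (f : K.K ⟶ L.K) : T ⟶ U :=
  K.iso.inv ≫ realMap f ≫ L.iso.hom

end SimplicialStructure

/-- A homotopy equivalence of topological pairs. -/
def IsHomotopyEquiv {T U : TopPair.{u}} (g : T ⟶ U) : Prop :=
  ∃ h : U ⟶ T, TopPair.Homotopic (g ≫ h) (𝟙 T) ∧ TopPair.Homotopic (h ≫ g) (𝟙 U)

/-- The product of a topological pair with the unit interval. -/
def cylinder (T : TopPair.{u}) : TopPair.{u} :=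
  TopPair.of (A := TopCat.of (unitInterval × T.left)) (X := TopCat.of (unitInterval × T.right))
    (TopCat.ofHom ⟨Prod.map id T.hom, by fun_prop⟩)
    (Topology.IsEmbedding.id.prodMap T.prop)

/-- The inclusion `x ↦ (t, x)` of a topological pair in its product with the unit interval. -/
def cylinderIncl (T : TopPair.{u}) (t : unitInterval) : T ⟶ cylinder T :=
  TopPair.ofHom (X := T) (Y := cylinder T)
    (TopCat.ofHom ⟨fun x => (t, x), by fun_prop⟩) (TopCat.ofHom ⟨fun x => (t, x), by fun_prop⟩)
    (by ext y; rfl)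

end Topology

end SpinPin

open SpinPin

open SpinPin

namespace SpinPin

/-! ### The exact sequence, its naturality, and the short five lemma. -/

section ExactSequence
variable {A : Type} [AddCommGroup A] (ι : ZMod 2 →+ A)

/-! The group `G` is made from cochains by quadratic formulas, so it is not a functor of the chain
complex, and a chain homotopy says nothing about it directly. It is controlled by the exact
sequence. Exactness is read off cochains: `(w, 0)` is a relation exactly when `w` is a coboundary
plus `ι Sq²` of a cocycle; a pair with `p = dc` becomes some `(w', 0)` after subtracting the
relation `(ι Sq² c, dc)`; and a cocycle `p` occurs in a pair exactly when `ι Sq² p` bounds.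
Pull-back commutes strictly with all the operations involved, so the sequence is natural and the
short five lemma (`G.map_bijective`) reduces bijectivity on `G` to bijectivity on cohomology with
coefficients `ℤ/2` and `A`.

What remains is that the geometric maps are cohomology isomorphisms. The working notion is `IsQI`,
an isomorphism on integral relative homology, phrased with elements of the total chain group modulo
the chains of the subcomplex. It has the two-out-of-three property and passes between absolute and
relative chains by five-lemma arguments (`QI.relative`, `QI.absolute`). It implies an isomorphism on
cohomology with arbitrary coefficients (`IsQI.bijective`): the mapping cone is free, bounded below
and acyclic, hence contractible (`exists_contraction`), and the contraction cobounds every cocycle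
of the cone. The Dold-Kan projector `PInfty` makes the resulting cochains normalized.

Homotopy equivalences of topological pairs are quasi-isomorphisms by the prism operator. The main
point is that the unit from a simplicial pair to the singular complex of its realization is one too
(`isQI_unitPair`). Standard simplices are contractible on both sides. When one nondegenerate simplex
is attached to `Y`, the pair `(X, Y)` is compared with the standard simplex modulo its boundary:
simplicially by a bijection of complements, topologically by pushing a collar into the boundary and
excising (`IsCell.isQI`). Induction on dimension and number of cells gives finite simplicial sets,
and compactness of singular simplices gives all of them (`good`). Excision rests on barycentric
subdivision, done on formal tuples of points and transported to singular simplices. The realization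
is accessed only through its adjunction with the singular complex; the required point-set facts come
from the unique presentation of a point by an interior point of a nondegenerate simplex
(`IsNF.unique`).

Homotopy invariance of `G` follows since the two ends of a cylinder are sections of one projection,
which induces an isomorphism. The statements on simplicial structures then follow from naturality of
the unit. -/

theorem H.mk_eq_zero_iff {P : SPair.{u}} {k : ℤ} (c : Z P A k) :
    (QuotientAddGroup.mk c : H P A k) = 0 ↔ ∃ b ∈ C P A (k - 1), d b = c.1 := by
  rw [QuotientAddGroup.eq_zero_iff]
  rfl

theorem ofQH_mk_mk (n : ℤ) (P : SPair.{u}) (w : Z P A n) :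
    ofQH ι n P (QuotientAddGroup.mk (QuotientAddGroup.mk w)) =
      QuotientAddGroup.mk (ofCocycle ι n P w) := rfl

theorem toSH_mk (n : ℤ) (P : SPair.{u}) (x : CPair ι n P) :
    (toSH ι n P (QuotientAddGroup.mk x) : H P (ZMod 2) (n - 1)) =
      QuotientAddGroup.mk ⟨x.p, mem_Z.2 ⟨x.p_mem, x.dp⟩⟩ := rfl

/-- If `(w, 0) = (df + ι Sq² c, dc)`, the second coordinate says that `c` is a cocycle, so `w` is
cohomologous to a value of `ι Sq²` on a cohomology class. -/
theorem ofQH_injective (n : ℤ) (P : SPair.{u}) : Function.Injective (ofQH ι n P) := by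
  rw [injective_iff_map_eq_zero]
  intro a ha
  induction a using QuotientAddGroup.induction_on with | H a => ?_
  induction a using QuotientAddGroup.induction_on with | H w => ?_
  rw [ofQH_mk_mk, QuotientAddGroup.eq_zero_iff] at ha
  obtain ⟨f, hf, c, hc, hw, hp⟩ := ha
  rw [QuotientAddGroup.eq_zero_iff]
  refine ⟨QuotientAddGroup.mk ⟨c, mem_Z.2 ⟨hc, hp.symm⟩⟩, ?_⟩
  refine (sub_eq_zero.1 ?_).symm
  change (QuotientAddGroup.mk (w - sqCocycle ι P _ ⟨c, _⟩) : H P A n) = 0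
  rw [H.mk_eq_zero_iff]
  refine ⟨f, hf, ?_⟩
  have hw' : (w : Cochain P.X A) = d f + push ι (Sq2 (n - 2) c) := hw
  change d f = (w : Cochain P.X A) - push ι (Sq2 (n - 2) c)
  rw [hw', add_sub_cancel_right]

/-- The pair `(ι Sq² c, dc)`. -/
def sqPair (n : ℤ) (P : SPair.{u}) (c : Cochain P.X (ZMod 2)) (hc : c ∈ C P (ZMod 2) (n - 2)) :
    CPair ι n P :=
  ⟨push ι (Sq2 (n - 2) c), d c, push_mem ι (Sq2_mem (by omega) hc), d_mem (by omega) hc, d_d c, by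
    rw [d_push, d_Sq2, Sq2_cocycle _ (d_d c), show n - 1 - 2 = n - 2 - 1 by ring]⟩

theorem sqPair_mem (n : ℤ) (P : SPair.{u}) (c : Cochain P.X (ZMod 2))
    (hc : c ∈ C P (ZMod 2) (n - 2)) : sqPair ι n P c hc ∈ relations ι n P :=
  ⟨0, zero_mem _, c, hc, by simp [sqPair], rfl⟩

theorem exact_ofQH_toSH (n : ℤ) (P : SPair.{u}) :
    Function.Exact (ofQH ι n P) (toSH ι n P) := by
  intro x
  induction x using QuotientAddGroup.induction_on with | H x => ?_
  constructor
  · intro hx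
    have h0 := congrArg Subtype.val hx
    rw [toSH_mk] at h0
    obtain ⟨c, hc, hcx⟩ := (H.mk_eq_zero_iff _).1 h0
    have hcx' : d c = x.p := hcx
    rw [show n - 1 - 1 = n - 2 by ring] at hc
    -- Negation in the group leaves the second coordinate unchanged, so the difference has second
    -- coordinate `p + dc`, which is `p + p`.
    have hp : (x - sqPair ι n P c hc).p = 0 := by
      rw [sub_eq_add_neg, CPair.add_p, CPair.neg_p, ← hcx']
      exact mod_two_add_self _
    refine ⟨QuotientAddGroup.mk (QuotientAddGroup.mk ⟨(x - sqPair ι n P c hc).w,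
      mem_Z.2 ⟨CPair.w_mem _, ?_⟩⟩), ?_⟩
    · rw [CPair.dw, hp, Sq2_zero, map_zero]
    · rw [ofQH_mk_mk]
      have h1 : ofCocycle ι n P ⟨(x - sqPair ι n P c hc).w,
          mem_Z.2 ⟨CPair.w_mem _, by rw [CPair.dw, hp, Sq2_zero, map_zero]⟩⟩ =
          x - sqPair ι n P c hc := by
        ext1
        · rfl
        · exact hp.symm
      rw [h1, sub_eq_add_neg, QuotientAddGroup.mk_add, QuotientAddGroup.mk_neg,
        (QuotientAddGroup.eq_zero_iff _).2 (sqPair_mem ι n P c hc), neg_zero, add_zero]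
  · rintro ⟨a, ha⟩
    induction a using QuotientAddGroup.induction_on with | H a => ?_
    induction a using QuotientAddGroup.induction_on with | H w => ?_
    rw [← ha, ofQH_mk_mk]
    apply Subtype.ext
    rw [toSH_mk]
    exact (H.mk_eq_zero_iff _).2 ⟨0, zero_mem _, map_zero _⟩

/-- A cochain witnessing that `ι Sq² p` is a coboundary is precisely a first coordinate completing
`p` to a pair. -/
theorem toSH_surjective (n : ℤ) (P : SPair.{u}) : Function.Surjective (toSH ι n P) := by
  rintro ⟨a, ha⟩
  induction a using QuotientAddGroup.induction_on with | H p => ?_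
  obtain ⟨w, hw, hwp⟩ := (H.mk_eq_zero_iff (sqCocycle ι P _ p)).1 ha
  rw [show n + 1 - 1 = n by ring] at hw
  exact ⟨QuotientAddGroup.mk ⟨w, p, hw, (mem_Z.1 p.2).1, (mem_Z.1 p.2).2, hwp⟩, rfl⟩

theorem G.map_id (n : ℤ) (P : SPair.{u}) : G.map ι n (𝟙 P) = AddMonoidHom.id (G ι n P) := by
  ext x
  rfl

theorem G.map_comp (n : ℤ) {P Q R : SPair.{u}} (f : P ⟶ Q) (g : Q ⟶ R) :
    G.map ι n (f ≫ g) = (G.map ι n f).comp (G.map ι n g) := by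
  ext x
  rfl

theorem G.map_comp_ofQH (n : ℤ) {P Q : SPair.{u}} (f : P ⟶ Q) :
    (G.map ι n f).comp (ofQH ι n Q) = (ofQH ι n P).comp (QH.map ι n f) := by
  ext x
  change (QuotientAddGroup.mk _ : G ι n P) = QuotientAddGroup.mk _
  congr 1

theorem toSH_comp_map (n : ℤ) {P Q : SPair.{u}} (f : P ⟶ Q) :
    (toSH ι n P).comp (G.map ι n f) = (SH.map ι n f).comp (toSH ι n Q) := by
  ext x
  rfl

/-- Injectivity modulo the image of `ι Sq²` needs the class in degree `n - 2` on the source side to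
be pulled back from the target; this is why surjectivity on mod 2 cohomology enters. -/
theorem QH.map_bijective {n : ℤ} {P Q : SPair.{u}} (f : P ⟶ Q)
    (h₁ : Function.Bijective (H.map A n f))
    (h₂ : Function.Surjective (H.map (ZMod 2) (n - 2) f)) :
    Function.Bijective (QH.map ι n f) := by
  constructor
  · rw [injective_iff_map_eq_zero]
    intro a ha
    induction a using QuotientAddGroup.induction_on with | H a => ?_
    have ha' : (QuotientAddGroup.mk (H.map A n f a) : QH ι n P) = 0 := ha
    rw [QuotientAddGroup.eq_zero_iff] at ha' ⊢
    obtain ⟨c, hc⟩ := ha'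
    obtain ⟨c, rfl⟩ := h₂ c
    refine ⟨c, h₁.1 ?_⟩
    rw [sqH_naturality, hc]
  · intro a
    induction a using QuotientAddGroup.induction_on with | H a => ?_
    obtain ⟨b, rfl⟩ := h₁.2 a
    exact ⟨QuotientAddGroup.mk b, rfl⟩

/-- A preimage of a class in the kernel of `ι Sq²` lies in the kernel again because nothing in
degree `n + 1` is lost under pull-back. -/
theorem SH.map_bijective {n : ℤ} {P Q : SPair.{u}} (f : P ⟶ Q)
    (h₁ : Function.Bijective (H.map (ZMod 2) (n - 1) f))
    (h₂ : Function.Injective (H.map A (n + 1) f)) :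
    Function.Bijective (SH.map ι n f) := by
  constructor
  · rintro ⟨a, ha⟩ ⟨b, hb⟩ hab
    exact Subtype.ext (h₁.1 (congrArg Subtype.val hab))
  · rintro ⟨a, ha⟩
    obtain ⟨b, rfl⟩ := h₁.2 a
    refine ⟨⟨b, ?_⟩, rfl⟩
    have ha' : sqH ι P (show n - 1 + 2 = n + 1 by ring) (H.map (ZMod 2) (n - 1) f b) = 0 := ha
    change sqH ι Q _ b = 0
    apply h₂
    rw [sqH_naturality, ha', map_zero]

/-- A map of simplicial pairs that induces isomorphisms on cohomology induces an isomorphism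
on `G_n`. -/
theorem G.map_bijective {n : ℤ} {P Q : SPair.{u}} (f : P ⟶ Q)
    (h₁ : ∀ k, Function.Bijective (H.map (ZMod 2) k f))
    (h₂ : ∀ k, Function.Bijective (H.map A k f)) :
    Function.Bijective (G.map ι n f) := by
  have hQ := QH.map_bijective ι f (h₂ n) (h₁ (n - 2)).2
  have hS := SH.map_bijective ι f (h₁ (n - 1)) (h₂ (n + 1)).1
  have nQ : ∀ a, G.map ι n f (ofQH ι n Q a) = ofQH ι n P (QH.map ι n f a) :=
    fun a => DFunLike.congr_fun (G.map_comp_ofQH ι n f) a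
  have nS : ∀ x, toSH ι n P (G.map ι n f x) = SH.map ι n f (toSH ι n Q x) :=
    fun x => DFunLike.congr_fun (toSH_comp_map ι n f) x
  -- The short five lemma, by the usual chase with the two bijections `hQ` and `hS` on the outer
  -- terms.
  constructor
  · rw [injective_iff_map_eq_zero]
    intro x hx
    have h0 : toSH ι n Q x = 0 := by
      apply hS.1
      rw [← nS, hx, map_zero, map_zero]
    obtain ⟨a, rfl⟩ := (exact_ofQH_toSH ι n Q x).1 h0
    rw [nQ] at hx
    have h1 : QH.map ι n f a = 0 := ofQH_injective ι n P (by rw [hx, map_zero])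
    rw [hQ.1 (h1.trans (map_zero _).symm), map_zero]
  · intro y
    obtain ⟨b, hb⟩ := hS.2 (toSH ι n P y)
    obtain ⟨x, rfl⟩ := toSH_surjective ι n Q b
    have h0 : toSH ι n P (y - G.map ι n f x) = 0 := by rw [map_sub, nS, hb, sub_self]
    obtain ⟨a, ha⟩ := (exact_ofQH_toSH ι n P _).1 h0
    obtain ⟨c, rfl⟩ := hQ.2 a
    refine ⟨ofQH ι n Q c + x, ?_⟩
    rw [map_add, nQ, ha, sub_add_cancel]

end ExactSequence

end SpinPin

namespace SpinPin

/-! ### Differential modules -/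

section Differential
variable {M M' M'' L L' : Type*} [AddCommGroup M] [AddCommGroup M'] [AddCommGroup M'']
  [AddCommGroup L] [AddCommGroup L']

/-- A map of differential groups, taken modulo subgroups `N` and `N'`, that induces an isomorphism
on homology. -/
structure QI (δ : M →ₗ[ℤ] M) (δ' : M' →ₗ[ℤ] M') (N : Submodule ℤ M) (N' : Submodule ℤ M')
    (f : M →ₗ[ℤ] M') : Prop where
  inj : ∀ x x', δ x ∈ N → f x - δ' x' ∈ N' → ∃ y, x - δ y ∈ N
  surj : ∀ x', δ' x' ∈ N' → ∃ x y', δ x ∈ N ∧ x' - f x - δ' y' ∈ N'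

variable {δ : M →ₗ[ℤ] M} {δ' : M' →ₗ[ℤ] M'} {δ'' : M'' →ₗ[ℤ] M''}
  {N : Submodule ℤ M} {N' : Submodule ℤ M'} {N'' : Submodule ℤ M''}
  {f : M →ₗ[ℤ] M'} {g : M' →ₗ[ℤ] M''}

/-- With the next two lemmas this is the two-out-of-three property. Working with explicit elements
modulo `N` avoids forming homology groups. -/
theorem QI.comp (hf : QI δ δ' N N' f) (hg : QI δ' δ'' N' N'' g)
    (cf : ∀ x, f (δ x) = δ' (f x)) (cg : ∀ x, g (δ' x) = δ'' (g x))
    (nf : ∀ x ∈ N, f x ∈ N') (ng : ∀ x ∈ N', g x ∈ N'') :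
    QI δ δ'' N N'' (g ∘ₗ f) where
  inj x x'' hx hx'' := by
    obtain ⟨y', hy'⟩ := hg.inj (f x) x'' (by rw [← cf]; exact nf _ hx) hx''
    exact hf.inj x y' hx hy'
  surj x'' hx'' := by
    obtain ⟨x', y'', hx', hy''⟩ := hg.surj x'' hx''
    obtain ⟨x, y', hx, hy'⟩ := hf.surj x' hx'
    refine ⟨x, y'' + g y', hx, ?_⟩
    have h := add_mem hy'' (ng _ hy')
    simp only [map_sub, map_add, LinearMap.comp_apply, cg] at h ⊢
    convert h using 1
    abel

theorem QI.of_comp_left (hf : QI δ δ' N N' f) (hgf : QI δ δ'' N N'' (g ∘ₗ f))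
    (cf : ∀ x, f (δ x) = δ' (f x)) (cg : ∀ x, g (δ' x) = δ'' (g x))
    (nf : ∀ x ∈ N, f x ∈ N') (ng : ∀ x ∈ N', g x ∈ N'') :
    QI δ' δ'' N' N'' g where
  inj x' x'' hx' hx'' := by
    obtain ⟨x, y', hx, hy'⟩ := hf.surj x' hx'
    obtain ⟨y, hy⟩ := hgf.inj x (x'' - g y') hx (by
      have h := sub_mem hx'' (ng _ hy')
      simp only [map_sub, LinearMap.comp_apply, cg] at h ⊢
      convert h using 1
      abel)
    refine ⟨y' + f y, ?_⟩
    have h := add_mem hy' (nf _ hy)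
    simp only [map_sub, map_add, cf] at h ⊢
    convert h using 1
    abel
  surj x'' hx'' := by
    obtain ⟨x, y'', hx, hy''⟩ := hgf.surj x'' hx''
    exact ⟨f x, y'', by rw [← cf]; exact nf _ hx, hy''⟩

theorem QI.of_comp_right (hg : QI δ' δ'' N' N'' g) (hgf : QI δ δ'' N N'' (g ∘ₗ f))
    (cf : ∀ x, f (δ x) = δ' (f x)) (cg : ∀ x, g (δ' x) = δ'' (g x))
    (nf : ∀ x ∈ N, f x ∈ N') (ng : ∀ x ∈ N', g x ∈ N'') :
    QI δ δ' N N' f where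
  inj x x' hx hx' := by
    refine hgf.inj x (g x') hx ?_
    have h := ng _ hx'
    simpa only [map_sub, cg, LinearMap.comp_apply] using h
  surj x' hx' := by
    obtain ⟨x, y'', hx, hy''⟩ := hgf.surj (g x') (by rw [← cg]; exact ng _ hx')
    obtain ⟨y', hy'⟩ := hg.inj (x' - f x) y'' (by
      rw [map_sub, ← cf]; exact sub_mem hx' (nf _ hx)) (by simpa only [map_sub, LinearMap.comp_apply] using hy'')
    exact ⟨x, y', hx, hy'⟩

/-- For a relative cycle `x` with `f x` equal to `δ' x'` modulo `N'`, the identity `x - δ (h x + k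
x') = k (f x - δ' x') + h (δ x)` exhibits a primitive, since the right side lies in `N`. -/
theorem QI.of_homotopy {k : M' →ₗ[ℤ] M} {h : M →ₗ[ℤ] M} {h' : M' →ₗ[ℤ] M'}
    (ck : ∀ x, k (δ' x) = δ (k x))
    (nk : ∀ x ∈ N', k x ∈ N) (nh : ∀ x ∈ N, h x ∈ N) (nh' : ∀ x ∈ N', h' x ∈ N')
    (hh : ∀ x, x - k (f x) = δ (h x) + h (δ x))
    (hh' : ∀ x, x - f (k x) = δ' (h' x) + h' (δ' x)) : QI δ δ' N N' f where
  inj x x' hx hx' := by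
    refine ⟨h x + k x', ?_⟩
    have e := add_mem (nk _ hx') (nh _ hx)
    rw [map_add, ← ck]
    convert e using 1
    have := hh x
    rw [map_sub, ← sub_eq_zero]
    rw [← sub_eq_zero] at this
    rw [← this]; abel
  surj x' hx' := by
    refine ⟨k x', h' x', by rw [← ck]; exact nk _ hx', ?_⟩
    rw [hh', add_sub_cancel_left]
    exact nh' _ hx'

/-! ### Five lemmas between absolute and relative homology. -/

section Five
variable {ε : L →ₗ[ℤ] L} {ε' : L' →ₗ[ℤ] L'} {g : L →ₗ[ℤ] L'} {i : L →ₗ[ℤ] M} {i' : L' →ₗ[ℤ] M'}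

/-- The five lemma on elements. A relative cycle `x` has boundary `i b`; injectivity on the
subcomplex makes `b = ε e`, and surjectivity there supplies a cycle `c` such that the absolute cycle
`x - i e - i c` maps to a boundary. Surjectivity is dual: the boundary of `x'` is corrected within
the subcomplex until it comes from the source. -/
theorem QI.relative (hg : QI ε ε' ⊥ ⊥ g) (hf : QI δ δ' ⊥ ⊥ f)
    (dd : ∀ x, δ (δ x) = 0) (dd' : ∀ x, δ' (δ' x) = 0)
    (cf : ∀ x, f (δ x) = δ' (f x)) (cg : ∀ x, g (ε x) = ε' (g x))
    (ci : ∀ x, i (ε x) = δ (i x)) (ci' : ∀ x, i' (ε' x) = δ' (i' x))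
    (hi : Function.Injective i) (hi' : Function.Injective i')
    (w : ∀ x, f (i x) = i' (g x)) :
    QI δ δ' (LinearMap.range i) (LinearMap.range i') f := by
  have inj0 : ∀ x x', δ x = 0 → f x = δ' x' → ∃ y, x = δ y := fun x x' h h' => by
    obtain ⟨y, hy⟩ := hf.inj x x' h (by simp [h'])
    exact ⟨y, by simpa [sub_eq_zero] using hy⟩
  have surj0 : ∀ x', δ' x' = 0 → ∃ x y', δ x = 0 ∧ x' = f x + δ' y' := fun x' h => by
    obtain ⟨x, y', h1, h2⟩ := hf.surj x' h
    exact ⟨x, y', h1, by simpa [sub_sub, sub_eq_zero] using h2⟩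
  have inj1 : ∀ x x', ε x = 0 → g x = ε' x' → ∃ y, x = ε y := fun x x' h h' => by
    obtain ⟨y, hy⟩ := hg.inj x x' h (by simp [h'])
    exact ⟨y, by simpa [sub_eq_zero] using hy⟩
  have surj1 : ∀ x', ε' x' = 0 → ∃ x y', ε x = 0 ∧ x' = g x + ε' y' := fun x' h => by
    obtain ⟨x, y', h1, h2⟩ := hg.surj x' h
    exact ⟨x, y', h1, by simpa [sub_sub, sub_eq_zero] using h2⟩
  have ee : ∀ x, ε (ε x) = 0 := fun x => hi (by rw [ci, ci, dd, map_zero])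
  have ee' : ∀ x, ε' (ε' x) = 0 := fun x => hi' (by rw [ci', ci', dd', map_zero])
  constructor
  · rintro x x' ⟨b, hb⟩ ⟨a', ha'⟩
    have hb0 : ε b = 0 := hi (by rw [ci, hb, dd, map_zero])
    have hgb : g b = ε' a' := hi' (by rw [← w, hb, ci', ha', map_sub, dd', cf, sub_zero])
    obtain ⟨e, rfl⟩ := inj1 b a' hb0 hgb
    obtain ⟨c, g', hc, hcg⟩ := surj1 (a' - g e) (by rw [map_sub, ← cg, hgb, sub_self])
    obtain ⟨y, hy⟩ := inj0 (x - i e - i c) (x' + i' g') (by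
      rw [map_sub, map_sub, ← hb, ci, ← ci c, hc, map_zero, sub_self, sub_zero]) (by
      have h1 := congrArg i' hcg
      rw [map_sub, ha', map_add, ci', ← w, ← w] at h1
      rw [map_sub, map_sub, map_add]
      linear_combination (norm := abel) h1)
    exact ⟨y, e + c, by rw [map_add, ← hy]; abel⟩
  · rintro x' ⟨b', hb'⟩
    obtain ⟨b, e', hb, rfl⟩ := surj1 b' (hi' (by rw [ci', hb', dd', map_zero]))
    obtain ⟨y, hy⟩ := inj0 (i b) (x' - i' e') (by rw [← ci, hb, map_zero]) (by
      rw [map_sub, ← hb', map_add, w, ci', add_sub_cancel_right])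
    obtain ⟨x, z', hx, hz⟩ := surj0 (x' - i' e' - f y) (by
      rw [map_sub, map_sub, ← cf, ← hy, ← hb', map_add, w, ci', add_sub_cancel_right, sub_self])
    refine ⟨x + y, z', ⟨b, by rw [map_add, hx, zero_add, hy]⟩, e', ?_⟩
    rw [map_add]
    linear_combination (norm := abel) -hz

/-- Relative injectivity writes a cycle as `δ y + i a`, where `a` may still be nontrivial in the
subcomplex. Relative surjectivity applied to `x' - f y` provides `z` with `δ z = i b` such that `a -
b` becomes a boundary after `g`, hence is one; then `y + z + i e` is a primitive. -/
theorem QI.absolute (hg : QI ε ε' ⊥ ⊥ g)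
    (hf : QI δ δ' (LinearMap.range i) (LinearMap.range i') f)
    (dd : ∀ x, δ (δ x) = 0) (dd' : ∀ x, δ' (δ' x) = 0)
    (cf : ∀ x, f (δ x) = δ' (f x)) (cg : ∀ x, g (ε x) = ε' (g x))
    (ci : ∀ x, i (ε x) = δ (i x)) (ci' : ∀ x, i' (ε' x) = δ' (i' x))
    (hi : Function.Injective i) (hi' : Function.Injective i')
    (w : ∀ x, f (i x) = i' (g x)) :
    QI δ δ' ⊥ ⊥ f := by
  have inj1 : ∀ x x', ε x = 0 → g x = ε' x' → ∃ y, x = ε y := fun x x' h h' => by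
    obtain ⟨y, hy⟩ := hg.inj x x' h (by simp [h'])
    exact ⟨y, by simpa [sub_eq_zero] using hy⟩
  have surj1 : ∀ x', ε' x' = 0 → ∃ x y', ε x = 0 ∧ x' = g x + ε' y' := fun x' h => by
    obtain ⟨x, y', h1, h2⟩ := hg.surj x' h
    exact ⟨x, y', h1, by simpa [sub_sub, sub_eq_zero] using h2⟩
  constructor
  · intro x x' hx hxx
    rw [Submodule.mem_bot] at hx hxx
    have hxx' : f x = δ' x' := by rwa [sub_eq_zero] at hxx
    obtain ⟨y, a, ha⟩ := hf.inj x x' (by rw [hx]; exact zero_mem _) (by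
      rw [hxx]; exact zero_mem _)
    have ha0 : ε a = 0 := hi (by rw [ci, ha, map_sub, hx, dd, map_zero, sub_zero])
    obtain ⟨z, w', ⟨b, hb⟩, a', ha'⟩ := hf.surj (x' - f y) ⟨g a, by
      rw [← w, ha, map_sub, map_sub, hxx', cf]⟩
    have hb0 : ε b = 0 := hi (by rw [ci, hb, dd, map_zero])
    obtain ⟨e, he⟩ := inj1 (a - b) a' (by rw [map_sub, ha0, hb0, sub_zero]) (hi' (by
      rw [ci', ha', ← w, map_sub, hb, ha, map_sub, map_sub, map_sub, map_sub, dd', map_sub, cf, cf, hxx', sub_zero]))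
    refine ⟨y + z + i e, ?_⟩
    rw [Submodule.mem_bot]
    have h1 := congrArg i he
    rw [map_sub, ha, hb, ci] at h1
    rw [map_add, map_add]
    linear_combination (norm := abel) h1
  · intro x' hx'
    rw [Submodule.mem_bot] at hx'
    obtain ⟨x, y', ⟨b, hb⟩, a', ha'⟩ := hf.surj x' (by rw [hx']; exact zero_mem _)
    have hb0 : ε b = 0 := hi (by rw [ci, hb, dd, map_zero])
    have h2 : g b = ε' (-a') := hi' (by
      rw [← w, hb, ci', map_neg, map_neg, ha', map_sub, map_sub, hx', dd', cf]; abel)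
    obtain ⟨e, rfl⟩ := inj1 b (-a') hb0 h2
    obtain ⟨c, g', hc, hcg⟩ := surj1 (a' + g e) (by
      rw [map_add, ← cg, h2, map_neg, add_neg_cancel])
    refine ⟨x - i e + i c, y' + i' g', ?_, ?_⟩
    · rw [Submodule.mem_bot, map_add, map_sub, ← ci, ← ci, hb, hc, map_zero, sub_self, zero_add]
    · rw [Submodule.mem_bot]
      have h1 := congrArg i' hcg
      rw [map_add, ha', map_add, ci', ← w, ← w] at h1
      rw [map_add, map_add, map_sub]
      linear_combination (norm := abel) h1

end Five

end Differential

/-! ### Contractions of free graded differential modules -/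

section Contraction
variable {E : Type*} (deg : E → ℕ) (δ : (E →₀ ℤ) →ₗ[ℤ] (E →₀ ℤ)) (S : Set E)

/-- A free differential module, graded in nonnegative degrees, which is acyclic modulo a
set of generators, has a contraction modulo this set. -/
theorem exists_contraction (hdeg : ∀ e, δ (Finsupp.single e 1) ∈
      Finsupp.supported ℤ ℤ {e' | deg e' + 1 = deg e})
    (dd : ∀ x, δ (δ x) = 0)
    (hS : ∀ x ∈ Finsupp.supported ℤ ℤ S, δ x ∈ Finsupp.supported ℤ ℤ S)
    (acyclic : ∀ x, δ x ∈ Finsupp.supported ℤ ℤ S → ∃ y, x - δ y ∈ Finsupp.supported ℤ ℤ S) :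
    ∃ s : (E →₀ ℤ) →ₗ[ℤ] (E →₀ ℤ), (∀ e ∈ S, s (Finsupp.single e 1) = 0) ∧
      ∀ x, x - δ (s x) - s (δ x) ∈ Finsupp.supported ℤ ℤ S := by
  classical
  let N := Finsupp.supported ℤ ℤ S
  have hlow : ∀ n, ∀ x ∈ Finsupp.supported ℤ ℤ {e | deg e < n + 1},
      δ x ∈ Finsupp.supported ℤ ℤ {e | deg e < n} := by
    intro n x hx
    rw [Finsupp.supported_eq_span_single] at hx
    induction hx using Submodule.span_induction with
    | mem x hx =>
      obtain ⟨e, he, rfl⟩ := hx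
      refine Finsupp.supported_mono ?_ (hdeg e)
      intro e' he'
      simp only [Set.mem_ofPred_eq] at he he' ⊢
      omega
    | zero => simp
    | add x y _ _ hx hy => rw [map_add]; exact add_mem hx hy
    | smul a x _ hx => rw [map_smul]; exact Submodule.smul_mem _ _ hx
  choose F hF using acyclic
  -- The value at `e` is a chosen primitive, modulo `N`, of `e - s (δ e)`. That this is a relative
  -- cycle is only known inductively, so the definition falls back on `0`; generators in `S` are
  -- sent to `0` deliberately.
  let ch : ((E →₀ ℤ) →ₗ[ℤ] (E →₀ ℤ)) → E → (E →₀ ℤ) := fun s e =>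
    if h : e ∉ S ∧ δ (Finsupp.single e 1 - s (δ (Finsupp.single e 1))) ∈ N then F _ h.2 else 0
  let s : ℕ → ((E →₀ ℤ) →ₗ[ℤ] (E →₀ ℤ)) := fun n => Nat.rec 0
    (fun n s => Finsupp.linearCombination ℤ
      (fun e => if deg e = n then ch s e else s (Finsupp.single e 1))) n
  have s_succ : ∀ n e, s (n + 1) (Finsupp.single e 1) =
      if deg e = n then ch (s n) e else s n (Finsupp.single e 1) := by
    intro n e
    simp [s]
  have s_eq : ∀ e n, deg e < n → s n (Finsupp.single e 1) = s (deg e + 1) (Finsupp.single e 1) := by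
    intro e n hn
    induction n with
    | zero => omega
    | succ n ih =>
      rcases Nat.lt_succ_iff_lt_or_eq.1 hn with h | h
      · rw [s_succ, if_neg h.ne, ih h]
      · rw [h]
  -- The stages `s n` stabilize: the value on a generator of degree `k` is fixed from stage `k + 1`
  -- on, and `t` collects these values.
  let t : (E →₀ ℤ) →ₗ[ℤ] (E →₀ ℤ) :=
    Finsupp.linearCombination ℤ (fun e => s (deg e + 1) (Finsupp.single e 1))
  have t_single : ∀ e, t (Finsupp.single e 1) = s (deg e + 1) (Finsupp.single e 1) := by
    intro e; simp [t]
  have t_eq : ∀ n, ∀ x ∈ Finsupp.supported ℤ ℤ {e | deg e < n}, t x = s n x := by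
    intro n x hx
    rw [Finsupp.supported_eq_span_single] at hx
    induction hx using Submodule.span_induction with
    | mem x hx =>
      obtain ⟨e, he, rfl⟩ := hx
      exact (t_single e).trans (s_eq e n he).symm
    | zero => simp
    | add x y _ _ hx hy => rw [map_add, map_add, hx, hy]
    | smul a x _ hx => rw [map_smul, map_smul, hx]
  have tS : ∀ e ∈ S, t (Finsupp.single e 1) = 0 := by
    intro e he
    rw [t_single, s_succ, if_pos rfl]
    simp [ch, he]
  have tN : ∀ x ∈ N, t x = 0 := by
    intro x hx
    simp only [N] at hx
    rw [Finsupp.supported_eq_span_single] at hx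
    induction hx using Submodule.span_induction with
    | mem x hx =>
      obtain ⟨e, he, rfl⟩ := hx
      exact tS e he
    | zero => simp
    | add x y _ _ hx hy => rw [map_add, hx, hy, add_zero]
    | smul a x _ hx => rw [map_smul, hx, smul_zero]
  refine ⟨t, tS, ?_⟩
  have key : ∀ n, ∀ x ∈ Finsupp.supported ℤ ℤ {e | deg e < n}, x - δ (t x) - t (δ x) ∈ N := by
    intro n
    induction n with
    | zero =>
      intro x hx
      have : x = 0 := by simpa using hx
      subst this
      simp
    | succ n ih =>
      intro x hx
      have hx' := hx
      rw [Finsupp.supported_eq_span_single] at hx'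
      clear hx
      induction hx' using Submodule.span_induction with
      | mem x hx =>
        obtain ⟨e, he, rfl⟩ := hx
        dsimp only
        by_cases heS : e ∈ S
        · have h1 : Finsupp.single e (1 : ℤ) ∈ N := Finsupp.single_mem_supported ℤ _ heS
          rw [tS e heS, map_zero, sub_zero, tN _ (hS _ h1), sub_zero]
          exact h1
        · have hd : δ (Finsupp.single e 1) ∈ Finsupp.supported ℤ ℤ {e' | deg e' < deg e} :=
            hlow _ _ (Finsupp.single_mem_supported ℤ _ (by simp))
          have hd' : δ (Finsupp.single e 1) ∈ Finsupp.supported ℤ ℤ {e' | deg e' < n} :=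
            Finsupp.supported_mono (fun e' (h : deg e' < deg e) => by
              have : deg e < n + 1 := he
              simp only [Set.mem_ofPred_eq]; omega) hd
          -- The induction hypothesis for `δ e`, together with `δ δ = 0`, says that `e - s (δ e)` is
          -- a relative cycle, so the fallback value is not used.
          have h2 := ih _ hd'
          rw [dd, map_zero, sub_zero, t_eq _ _ hd] at h2
          have h3 : δ (Finsupp.single e 1 - s (deg e) (δ (Finsupp.single e 1))) ∈ N := by
            rwa [map_sub]
          have h4 : t (Finsupp.single e 1) = F _ h3 := by
            rw [t_single, s_succ, if_pos rfl]
            simp only [ch]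
            rw [dif_pos ⟨heS, h3⟩]
          have h5 := hF _ h3
          rw [h4, t_eq _ _ hd]
          convert h5 using 1
          abel
      | zero => simp
      | add x y _ _ hx hy =>
        have := add_mem hx hy
        simp only [map_add] at this ⊢
        convert this using 1
        abel
      | smul a x _ hx =>
        have := Submodule.smul_mem _ a hx
        simpa only [map_smul, smul_sub] using this
  intro x
  refine key (x.support.sup deg + 1) x ?_
  rw [Finsupp.mem_supported]
  intro e he
  exact Nat.lt_succ_of_le (Finset.le_sup (f := deg) he)

end Contraction

end SpinPin

namespace SpinPin

/-! ### Chains of simplicial sets -/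

/-- All simplices of a simplicial set. -/
abbrev Simp (X : SSet.{u}) : Type u := Σ m : ℕ, X _⦋m⦌

/-- Integral chains of a simplicial set, in all degrees together. -/
abbrev Ch (X : SSet.{u}) : Type u := Simp X →₀ ℤ

/-- The free abelian group functor. -/
noncomputable def freeZ : Type u ⥤ ModuleCat.{u} ℤ where
  obj S := ModuleCat.of ℤ (S →₀ ℤ)
  map f := ModuleCat.ofHom (Finsupp.lmapDomain ℤ ℤ f)
  map_id S := by
    ext x
    simp
  map_comp f g := by
    ext x
    simp

/-- The free simplicial abelian group on a simplicial set. -/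
noncomputable abbrev freeS (X : SSet.{u}) : SimplicialObject (ModuleCat.{u} ℤ) :=
  ((SimplicialObject.whiskering _ _).obj freeZ).obj X

section Chains
variable {X Y W : SSet.{u}}

/-- The boundary of a simplex. -/
noncomputable def bdSimp (s : Simp X) : Ch X :=
  match s with
  | ⟨0, _⟩ => 0
  | ⟨m + 1, s⟩ => ∑ i : Fin (m + 2), ((-1 : ℤ) ^ (i : ℕ)) • Finsupp.single ⟨m, X.δ i s⟩ 1

/-- The boundary operator. -/
noncomputable def bd : Ch X →ₗ[ℤ] Ch X := Finsupp.linearCombination ℤ bdSimp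

theorem bd_single (s : Simp X) : bd (Finsupp.single s 1) = bdSimp s := by simp [bd]

theorem bd_zero_simp (x : X _⦋0⦌) : bd (Finsupp.single (⟨0, x⟩ : Simp X) 1) = 0 := bd_single _

theorem bd_succ_simp {m : ℕ} (s : X _⦋m + 1⦌) : bd (Finsupp.single (⟨m + 1, s⟩ : Simp X) 1) =
    ∑ i : Fin (m + 2), ((-1 : ℤ) ^ (i : ℕ)) • Finsupp.single (⟨m, X.δ i s⟩ : Simp X) (1 : ℤ) :=
  bd_single _

theorem Ch.hom_ext {M : Type*} [AddCommGroup M] {f g : Ch X →ₗ[ℤ] M}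
    (h : ∀ m (x : X _⦋m⦌), f (Finsupp.single ⟨m, x⟩ 1) = g (Finsupp.single ⟨m, x⟩ 1)) :
    f = g := by
  apply Finsupp.lhom_ext'
  rintro ⟨m, x⟩
  ext
  exact h m x

/-- The inclusion of the chains of degree `m`. -/
noncomputable def chIncl (X : SSet.{u}) (m : ℕ) : (X _⦋m⦌ →₀ ℤ) →ₗ[ℤ] Ch X :=
  Finsupp.lmapDomain ℤ ℤ (fun x => (⟨m, x⟩ : Simp X))

theorem chIncl_single {m : ℕ} (x : X _⦋m⦌) (a : ℤ) :
    chIncl X m (Finsupp.single x a) = Finsupp.single ⟨m, x⟩ a := by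
  simp [chIncl]

/-- The alternating sum of the faces on the chains of a given degree. -/
noncomputable def altFace (X : SSet.{u}) (m : ℕ) : (X _⦋m + 1⦌ →₀ ℤ) →ₗ[ℤ] (X _⦋m⦌ →₀ ℤ) :=
  (AlgebraicTopology.AlternatingFaceMapComplex.objD (freeS X) m).hom

theorem altFace_single {m : ℕ} (x : X _⦋m + 1⦌) : altFace X m (Finsupp.single x 1) =
    ∑ i : Fin (m + 2), ((-1 : ℤ) ^ (i : ℕ)) • Finsupp.single (X.δ i x) (1 : ℤ) := by
  let z : ((freeS X).obj (op ⦋m + 1⦌)) := (Finsupp.single x 1 : X _⦋m + 1⦌ →₀ ℤ)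
  change ModuleCat.Hom.hom (AlgebraicTopology.AlternatingFaceMapComplex.objD (freeS X) m) z = _
  rw [AlgebraicTopology.AlternatingFaceMapComplex.objD, ModuleCat.hom_sum, LinearMap.sum_apply]
  refine Finset.sum_congr rfl fun i _ => ?_
  rw [ModuleCat.hom_zsmul]
  exact congrArg (fun y : X _⦋m⦌ →₀ ℤ => ((-1 : ℤ) ^ (i : ℕ)) • y)
    (Finsupp.mapDomain_single (f := X.δ i) (a := x) (b := (1 : ℤ)))

theorem altFace_altFace {m : ℕ} (z : X _⦋m + 2⦌ →₀ ℤ) : altFace X m (altFace X (m + 1) z) = 0 :=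
  ConcreteCategory.congr_hom
    (AlgebraicTopology.AlternatingFaceMapComplex.d_squared (freeS X) m) z

/-- This links the total chain group with the alternating face map complex of `freeS X`, from which
`d² = 0`, the prism formula and the normalization projector are taken. -/
theorem bd_chIncl {m : ℕ} (z : X _⦋m + 1⦌ →₀ ℤ) :
    bd (chIncl X (m + 1) z) = chIncl X m (altFace X m z) := by
  have : bd ∘ₗ chIncl X (m + 1) = chIncl X m ∘ₗ altFace X m := by
    apply Finsupp.lhom_ext'
    intro x
    refine LinearMap.ext_ring ?_
    change bd (chIncl X (m + 1) (Finsupp.single x 1)) = chIncl X m (altFace X m (Finsupp.single x 1))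
    rw [chIncl_single, bd_succ_simp, altFace_single, map_sum]
    refine Finset.sum_congr rfl fun i _ => ?_
    rw [map_zsmul, chIncl_single]
  exact LinearMap.congr_fun this z

theorem bd_bd (x : Ch X) : bd (bd x) = 0 := by
  have : (bd ∘ₗ bd : Ch X →ₗ[ℤ] Ch X) = 0 := by
    refine Ch.hom_ext fun m x => ?_
    change bd (bd _) = 0
    match m with
    | 0 => rw [bd_zero_simp, map_zero]
    | 1 =>
      rw [bd_succ_simp, map_sum]
      exact Finset.sum_eq_zero fun i _ => by rw [map_zsmul, bd_zero_simp, smul_zero]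
    | m + 2 =>
      rw [← chIncl_single, bd_chIncl, bd_chIncl, altFace_altFace, map_zero]
  exact LinearMap.congr_fun this x

/-- The map induced on simplices. -/
def simpMap (f : X ⟶ Y) (s : Simp X) : Simp Y := ⟨s.1, f.app _ s.2⟩

/-- The map induced on chains. -/
noncomputable def chMap (f : X ⟶ Y) : Ch X →ₗ[ℤ] Ch Y := Finsupp.lmapDomain ℤ ℤ (simpMap f)

@[simp]
theorem chMap_single (f : X ⟶ Y) {m : ℕ} (x : X _⦋m⦌) (a : ℤ) :
    chMap f (Finsupp.single ⟨m, x⟩ a) = Finsupp.single ⟨m, f.app _ x⟩ a := by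
  simp [chMap, simpMap]

theorem chMap_bd (f : X ⟶ Y) (x : Ch X) : chMap f (bd x) = bd (chMap f x) := by
  have : chMap f ∘ₗ bd = bd ∘ₗ chMap f := by
    refine Ch.hom_ext fun m x => ?_
    rw [LinearMap.comp_apply, LinearMap.comp_apply, chMap_single]
    cases m with
    | zero => rw [bd_zero_simp, bd_zero_simp, map_zero]
    | succ m =>
      rw [bd_succ_simp, bd_succ_simp, map_sum]
      refine Finset.sum_congr rfl fun i _ => ?_
      rw [map_zsmul, chMap_single]
      congr 3
      exact ConcreteCategory.congr_hom (f.naturality (SimplexCategory.δ i).op) x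
  exact LinearMap.congr_fun this x

theorem chMap_comp (f : X ⟶ Y) (g : Y ⟶ W) : chMap (f ≫ g) = chMap g ∘ₗ chMap f := by
  refine Ch.hom_ext fun m x => ?_
  rw [LinearMap.comp_apply, chMap_single, chMap_single, chMap_single]
  rfl

theorem chMap_id : chMap (𝟙 X) = LinearMap.id := by
  refine Ch.hom_ext fun m x => ?_
  rw [chMap_single]
  rfl

/-- The sum of the coefficients of the vertices. -/
noncomputable def aug : Ch X →ₗ[ℤ] ℤ :=
  Finsupp.linearCombination ℤ (fun s => if s.1 = 0 then 1 else 0)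

theorem aug_single {m : ℕ} (x : X _⦋m⦌) :
    aug (Finsupp.single (⟨m, x⟩ : Simp X) 1) = if m = 0 then 1 else 0 := by simp [aug]

theorem aug_bd (x : Ch X) : aug (bd x) = 0 := by
  have : aug ∘ₗ bd = (0 : Ch X →ₗ[ℤ] ℤ) := by
    refine Ch.hom_ext fun m x => ?_
    rw [LinearMap.comp_apply]
    match m with
    | 0 => rw [bd_zero_simp, map_zero]; rfl
    | 1 =>
      rw [bd_succ_simp, Fin.sum_univ_two, map_add, map_zsmul, map_zsmul, aug_single, aug_single]
      simp
    | m + 2 =>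
      rw [bd_succ_simp, map_sum]
      exact Finset.sum_eq_zero fun i _ => by rw [map_zsmul, aug_single]; simp
  exact LinearMap.congr_fun this x

theorem aug_chMap (f : X ⟶ Y) (x : Ch X) : aug (chMap f x) = aug x := by
  have : aug ∘ₗ chMap f = aug := by
    refine Ch.hom_ext fun m x => ?_
    rw [LinearMap.comp_apply, chMap_single, aug_single, aug_single]
  exact LinearMap.congr_fun this x

/-- The simplices of a subcomplex. -/
def simpSet (A : X.Subcomplex) : Set (Simp X) := {s | s.2 ∈ A.obj (op ⦋s.1⦌)}

/-- The chains of a subcomplex. -/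
noncomputable def subCh (A : X.Subcomplex) : Submodule ℤ (Ch X) :=
  Finsupp.supported ℤ ℤ (simpSet A)

theorem single_mem_subCh {A : X.Subcomplex} {m : ℕ} {x : X _⦋m⦌} (hx : x ∈ A.obj _) (a : ℤ) :
    Finsupp.single ⟨m, x⟩ a ∈ subCh A :=
  Finsupp.single_mem_supported ℤ _ hx

theorem subCh_induction {A : X.Subcomplex} {M : Type*} [AddCommGroup M] (N : Submodule ℤ M)
    (f : Ch X →ₗ[ℤ] M)
    (h : ∀ m (x : X _⦋m⦌), x ∈ A.obj _ → f (Finsupp.single ⟨m, x⟩ 1) ∈ N) :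
    ∀ z ∈ subCh A, f z ∈ N := by
  intro z hz
  have : subCh A ≤ N.comap f := by
    rw [subCh, Finsupp.supported_eq_span_single, Submodule.span_le]
    rintro _ ⟨⟨m, x⟩, hx, rfl⟩
    exact h m x hx
  exact this hz

theorem bd_mem_subCh (A : X.Subcomplex) : ∀ z ∈ subCh A, bd z ∈ subCh A := by
  refine subCh_induction _ _ fun m x hx => ?_
  cases m with
  | zero => rw [bd_zero_simp]; exact zero_mem _
  | succ m =>
    rw [bd_succ_simp]
    exact sum_mem fun i _ => Submodule.smul_mem _ _ (single_mem_subCh (A.map _ hx) 1)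

theorem subCh_bot : subCh (⊥ : X.Subcomplex) = ⊥ := by
  rw [subCh, show simpSet (⊥ : X.Subcomplex) = ∅ from ?_, Finsupp.supported_empty]
  ext s
  exact Iff.rfl

/-- Chains of an image are images of chains. This puts relative chains in the form `LinearMap.range
i` required by `QI.relative` and `QI.absolute`. -/
theorem subCh_range (f : X ⟶ Y) : subCh (SSet.Subcomplex.range f) = LinearMap.range (chMap f) := by
  apply le_antisymm
  · refine subCh_induction (LinearMap.range (chMap f)) LinearMap.id ?_
    rintro m _ ⟨x, rfl⟩
    exact ⟨Finsupp.single ⟨m, x⟩ 1, chMap_single _ _ _⟩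
  · rintro _ ⟨z, rfl⟩
    have : (⊤ : Submodule ℤ (Ch X)) ≤ (subCh (SSet.Subcomplex.range f)).comap (chMap f) := by
      rw [← Finsupp.supported_univ (R := ℤ), Finsupp.supported_eq_span_single, Submodule.span_le]
      rintro _ ⟨⟨m, x⟩, -, rfl⟩
      change chMap f (Finsupp.single _ _) ∈ subCh _
      rw [chMap_single]
      exact single_mem_subCh (A := SSet.Subcomplex.range f) ⟨x, rfl⟩ 1
    exact this trivial

theorem chMap_injective (f : X ⟶ Y) (hf : ∀ m, Function.Injective (f.app (op ⦋m⦌))) :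
    Function.Injective (chMap f) := by
  apply Finsupp.mapDomain_injective
  rintro ⟨m, x⟩ ⟨k, y⟩ h
  have h1 : m = k := congrArg Sigma.fst h
  subst h1
  exact congrArg (Sigma.mk m) (hf m (eq_of_heq (Sigma.mk.inj h).2))

end Chains

/-! ### Quasi-isomorphisms of simplicial pairs -/

/-- A map of simplicial pairs that induces an isomorphism on integral relative homology. -/
def IsQI {P Q : SPair.{u}} (f : P ⟶ Q) : Prop := QI bd bd (subCh P.Y) (subCh Q.Y) (chMap f.map)

section
variable {P Q R : SPair.{u}}

theorem chMap_mem (f : P ⟶ Q) : ∀ z ∈ subCh P.Y, chMap f.map z ∈ subCh Q.Y := by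
  refine subCh_induction _ _ fun m x hx => ?_
  rw [chMap_single]
  exact single_mem_subCh (f.mapsTo _ _ hx) 1

theorem IsQI.comp {f : P ⟶ Q} {g : Q ⟶ R} (hf : IsQI f) (hg : IsQI g) : IsQI (f ≫ g) := by
  have := QI.comp hf hg (chMap_bd _) (chMap_bd _) (chMap_mem f) (chMap_mem g)
  rwa [← chMap_comp] at this

theorem IsQI.of_comp_left {f : P ⟶ Q} {g : Q ⟶ R} (hf : IsQI f) (h : IsQI (f ≫ g)) :
    IsQI g := by
  refine QI.of_comp_left hf ?_ (chMap_bd _) (chMap_bd _) (chMap_mem f) (chMap_mem g)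
  rw [← chMap_comp]
  exact h

theorem IsQI.of_comp_right {f : P ⟶ Q} {g : Q ⟶ R} (hg : IsQI g) (h : IsQI (f ≫ g)) :
    IsQI f := by
  refine QI.of_comp_right hg ?_ (chMap_bd _) (chMap_bd _) (chMap_mem f) (chMap_mem g)
  rw [← chMap_comp]
  exact h

/-- A map of pairs that is bijective on the complements is a quasi-isomorphism. -/
theorem IsQI.of_bijective_compl (f : P ⟶ Q)
    (h₀ : ∀ m (x : P.X _⦋m⦌), f.map.app _ x ∈ Q.Y.obj _ → x ∈ P.Y.obj _)
    (h₁ : ∀ m (x y : P.X _⦋m⦌), x ∉ P.Y.obj _ → y ∉ P.Y.obj _ →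
      f.map.app _ x = f.map.app _ y → x = y)
    (h₂ : ∀ m (z : Q.X _⦋m⦌), z ∉ Q.Y.obj _ → ∃ x, f.map.app _ x = z) : IsQI f := by
  classical
  -- a linear inverse modulo the subcomplexes
  have hr : ∀ s : Simp Q.X, ∃ z : Ch P.X, (s ∉ simpSet Q.Y → chMap f.map z = Finsupp.single s 1) ∧
      (s ∈ simpSet Q.Y → z = 0) ∧ (s ∉ simpSet Q.Y →
        ∃ x : P.X _⦋s.1⦌, f.map.app _ x = s.2 ∧ z = Finsupp.single ⟨s.1, x⟩ 1) := by
    rintro ⟨m, s⟩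
    by_cases hs : s ∈ Q.Y.obj (op ⦋m⦌)
    · exact ⟨0, fun h => (h hs).elim, fun _ => rfl, fun h => (h hs).elim⟩
    · obtain ⟨x, hx⟩ := h₂ m s hs
      refine ⟨Finsupp.single ⟨m, x⟩ 1, fun _ => ?_, fun h => (hs h).elim, fun _ => ⟨x, hx, rfl⟩⟩
      rw [chMap_single, hx]
  choose r hr₁ hr₂ hr₃ using hr
  let ρ : Ch Q.X →ₗ[ℤ] Ch P.X := Finsupp.linearCombination ℤ r
  have ρ_single : ∀ s, ρ (Finsupp.single s 1) = r s := fun s => by simp [ρ]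
  have e1 : ∀ z, chMap f.map (ρ z) - z ∈ subCh Q.Y := by
    intro z
    induction z using Finsupp.induction_linear with
    | zero => simp
    | add x y hx hy =>
      have := add_mem hx hy
      rw [map_add, map_add]
      convert this using 1
      abel
    | single s a =>
      rw [← mul_one a, ← smul_eq_mul, ← Finsupp.smul_single, map_smul, map_smul, ← smul_sub]
      refine Submodule.smul_mem _ _ ?_
      rw [ρ_single]
      by_cases hs : s ∈ simpSet Q.Y
      · rw [hr₂ s hs, map_zero, zero_sub, neg_mem_iff]
        exact single_mem_subCh hs 1
      · rw [hr₁ s hs, sub_self]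
        exact zero_mem _
  have e2 : ∀ z, ρ (chMap f.map z) - z ∈ subCh P.Y := by
    intro z
    induction z using Finsupp.induction_linear with
    | zero => simp
    | add x y hx hy =>
      have := add_mem hx hy
      rw [map_add, map_add]
      convert this using 1
      abel
    | single s a =>
      obtain ⟨m, x⟩ := s
      rw [← mul_one a, ← smul_eq_mul, ← Finsupp.smul_single, map_smul, map_smul, ← smul_sub]
      refine Submodule.smul_mem _ _ ?_
      rw [chMap_single, ρ_single]
      by_cases hs : (⟨m, f.map.app _ x⟩ : Simp Q.X) ∈ simpSet Q.Y
      · rw [hr₂ _ hs, zero_sub, neg_mem_iff]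
        exact single_mem_subCh (h₀ m x hs) 1
      · obtain ⟨y, hy, hy'⟩ := hr₃ _ hs
        rw [hy', h₁ m y x (fun h => hs (by
          have := f.mapsTo _ _ h
          rw [hy] at this
          exact this)) (fun h => hs (f.mapsTo _ _ h)) hy, sub_self]
        exact zero_mem _
  have e3 : ∀ z ∈ subCh Q.Y, ρ z = 0 := by
    intro z hz
    have := subCh_induction (A := Q.Y) ⊥ ρ (fun m x hx => by
      rw [ρ_single, hr₂ _ hx]; exact zero_mem _) z hz
    exact this
  have e4 : ∀ z, chMap f.map z ∈ subCh Q.Y → z ∈ subCh P.Y := by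
    intro z hz
    have := e2 z
    rw [e3 _ hz, zero_sub, neg_mem_iff] at this
    exact this
  -- `ρ` need not commute with the boundary. It inverts `chMap f.map` modulo the subcomplexes, and
  -- `chMap f.map` commutes with the boundary and reflects membership in them (`e4`); this suffices
  -- for both conditions, with zero as primitive in the second.
  constructor
  · intro x x' hx hx'
    refine ⟨ρ x', e4 _ ?_⟩
    have h := bd_mem_subCh _ _ (e1 x')
    rw [map_sub] at h ⊢
    rw [chMap_bd]
    have := sub_mem hx' h
    convert this using 1
    abel
  · intro x' hx'
    refine ⟨ρ x', 0, e4 _ ?_, ?_⟩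
    · have h := bd_mem_subCh _ _ (e1 x')
      rw [map_sub] at h
      rw [chMap_bd]
      have := add_mem hx' h
      convert this using 1
      abel
    · rw [map_zero, sub_zero, ← neg_mem_iff, neg_sub]
      exact e1 x'

/-- A simplicial set as a pair with the empty subcomplex. -/
def absPair (X : SSet.{u}) : SPair.{u} := ⟨X, ⊥⟩

/-- A simplicial map as a map of absolute pairs. -/
def absMap {X Y : SSet.{u}} (f : X ⟶ Y) : absPair X ⟶ absPair Y :=
  SPair.Hom.mk f (fun _ _ h => h.elim)

theorem subCh_absPair (X : SSet.{u}) : subCh (absPair X).Y = ⊥ := subCh_bot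

theorem isQI_absMap_iff {X Y : SSet.{u}} (f : X ⟶ Y) :
    IsQI (absMap f) ↔ QI bd bd ⊥ ⊥ (chMap f) := by
  unfold IsQI
  rw [subCh_absPair, subCh_absPair]
  exact Iff.rfl

/-- The chains of a subcomplex are the image of the chains of its underlying simplicial set. -/
theorem subCh_eq_range (A : P.X.Subcomplex) : subCh A = LinearMap.range (chMap A.ι) := by
  rw [← subCh_range]
  congr 1
  simp

theorem chMap_ι_injective {X : SSet.{u}} (A : X.Subcomplex) : Function.Injective (chMap A.ι) :=
  chMap_injective _ fun _ => Subtype.val_injective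

/-- The five lemma, from the absolute to the relative case. -/
theorem IsQI.of_abs (f : P ⟶ Q) (h₁ : IsQI (absMap (SPair.Hom.restrict f)))
    (h₂ : IsQI (absMap f.map)) : IsQI f := by
  rw [isQI_absMap_iff] at h₁ h₂
  unfold IsQI
  rw [subCh_eq_range, subCh_eq_range]
  refine QI.relative h₁ h₂ bd_bd bd_bd (chMap_bd _) (chMap_bd _) (chMap_bd _) (chMap_bd _)
    (chMap_ι_injective _) (chMap_ι_injective _) fun x => ?_
  rw [← LinearMap.comp_apply, ← LinearMap.comp_apply, ← chMap_comp, ← chMap_comp]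
  rfl

/-- The five lemma, from the relative to the absolute case. -/
theorem IsQI.abs (f : P ⟶ Q) (h₁ : IsQI (absMap (SPair.Hom.restrict f)))
    (h₂ : IsQI f) : IsQI (absMap f.map) := by
  unfold IsQI at h₂
  rw [subCh_eq_range, subCh_eq_range] at h₂
  rw [isQI_absMap_iff] at h₁ ⊢
  refine QI.absolute h₁ h₂ bd_bd bd_bd (chMap_bd _) (chMap_bd _) (chMap_bd _) (chMap_bd _)
    (chMap_ι_injective _) (chMap_ι_injective _) fun x => ?_
  rw [← LinearMap.comp_apply, ← LinearMap.comp_apply, ← chMap_comp, ← chMap_comp]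
  rfl

end

end SpinPin

namespace SpinPin

/-! ### From chains to cochains -/

section Evaluation
variable {X Y : SSet.{u}} {A : Type} [AddCommGroup A]

/-- The evaluation of a cochain on chains. -/
noncomputable def ev (c : Cochain X A) : Ch X →ₗ[ℤ] A :=
  Finsupp.linearCombination ℤ (fun s => c s.1 s.2)

@[simp]
theorem ev_single (c : Cochain X A) {m : ℕ} (s : X _⦋m⦌) :
    ev c (Finsupp.single ⟨m, s⟩ 1) = c m s := by simp [ev]

theorem ev_d (c : Cochain X A) (z : Ch X) : ev (d c) z = ev c (bd z) := by
  have : ev (d c) = ev c ∘ₗ bd := by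
    refine Ch.hom_ext fun m s => ?_
    rw [LinearMap.comp_apply, ev_single]
    cases m with
    | zero => rw [bd_zero_simp, map_zero]; rfl
    | succ m =>
      rw [bd_succ_simp, map_sum]
      change (∑ i : Fin (m + 2), ((-1 : ℤ) ^ (i : ℕ)) • c m (X.δ i s)) = _
      refine Finset.sum_congr rfl fun i _ => ?_
      rw [map_zsmul, ev_single]
  rw [this]; rfl

theorem ev_zero (z : Ch X) : ev (0 : Cochain X A) z = 0 :=
  LinearMap.congr_fun (Finsupp.linearCombination_zero (R := ℤ) (α := Simp X) (M := A)) z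

/-- The component of degree `k` of a cochain. -/
noncomputable def trunc (k : ℤ) (c : Cochain X A) : Cochain X A :=
  fun m s => if (m : ℤ) = k then c m s else 0

/-- Contractions are not asked to be homogeneous, so cochains obtained from them may have components
in several degrees. Taking one component is harmless because `d` raises degree by one. -/
theorem d_trunc {k l : ℤ} (h : l + 1 = k) (c : Cochain X A) :
    d (trunc l c) = trunc k (d c) := by
  funext m s
  cases m with
  | zero => simp [d, coboundaryFun, trunc]
  | succ m =>
    simp only [d, coboundaryFun, trunc, AddMonoidHom.coe_mk, ZeroHom.coe_mk]
    by_cases hm : (m : ℤ) = l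
    · rw [if_pos (by push_cast; omega)]
      simp [hm]
    · rw [if_neg (by push_cast; omega)]
      simp [hm]

/-- Relative cochains of degree `k`, not necessarily normalized. -/
def IsRel (P : SPair.{u}) (k : ℤ) (c : Cochain P.X A) : Prop :=
  ∀ (m : ℕ) (s : P.X _⦋m⦌), ((m : ℤ) ≠ k ∨ s ∈ P.Y.obj (op ⦋m⦌)) → c m s = 0

theorem isRel_of_mem {P : SPair.{u}} {k : ℤ} {c : Cochain P.X A} (hc : c ∈ C P A k) :
    IsRel P k c := fun m s h => hc m s (h.elim Or.inl fun h => Or.inr (Or.inr h))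

theorem IsRel.trunc_eq {P : SPair.{u}} {k : ℤ} {c : Cochain P.X A} (hc : IsRel P k c) :
    trunc k c = c := by
  funext m s
  simp only [trunc]
  split_ifs with h
  · rfl
  · exact (hc m s (Or.inl h)).symm

theorem isRel_trunc {P : SPair.{u}} {k : ℤ} {c : Cochain P.X A}
    (hc : ∀ (m : ℕ) (s : P.X _⦋m⦌), s ∈ P.Y.obj (op ⦋m⦌) → c m s = 0) : IsRel P k (trunc k c) := by
  rintro m s (h | h)
  · simp [trunc, h]
  · simp [trunc, hc m s h]

end Evaluation

/-! ### The mapping cone of a map of simplicial pairs. -/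

section Cone
variable {P Q : SPair.{u}} (f : P ⟶ Q)

/-- The differential of the mapping cone. -/
noncomputable def coneBd : (Simp P.X ⊕ Simp Q.X →₀ ℤ) →ₗ[ℤ] (Simp P.X ⊕ Simp Q.X →₀ ℤ) :=
  Finsupp.linearCombination ℤ (Sum.elim
    (fun p => -Finsupp.lmapDomain ℤ ℤ Sum.inl (bd (Finsupp.single p 1)) +
      Finsupp.lmapDomain ℤ ℤ Sum.inr (chMap f.map (Finsupp.single p 1)))
    (fun q => Finsupp.lmapDomain ℤ ℤ Sum.inr (bd (Finsupp.single q 1))))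

theorem coneBd_inl (a : Ch P.X) : coneBd f (Finsupp.lmapDomain ℤ ℤ Sum.inl a) =
    -Finsupp.lmapDomain ℤ ℤ Sum.inl (bd a) + Finsupp.lmapDomain ℤ ℤ Sum.inr (chMap f.map a) := by
  have : coneBd f ∘ₗ Finsupp.lmapDomain ℤ ℤ Sum.inl =
      -(Finsupp.lmapDomain ℤ ℤ Sum.inl ∘ₗ bd) +
        Finsupp.lmapDomain ℤ ℤ Sum.inr ∘ₗ chMap f.map := by
    refine Ch.hom_ext fun m s => ?_
    simp [coneBd]
  exact LinearMap.congr_fun this a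

theorem coneBd_inr (b : Ch Q.X) : coneBd f (Finsupp.lmapDomain ℤ ℤ Sum.inr b) =
    Finsupp.lmapDomain ℤ ℤ Sum.inr (bd b) := by
  have : coneBd f ∘ₗ Finsupp.lmapDomain ℤ ℤ Sum.inr = Finsupp.lmapDomain ℤ ℤ Sum.inr ∘ₗ bd := by
    refine Ch.hom_ext fun m s => ?_
    simp [coneBd]
  exact LinearMap.congr_fun this b

theorem exists_cone_eq (x : Simp P.X ⊕ Simp Q.X →₀ ℤ) : ∃ (a : Ch P.X) (b : Ch Q.X),
    x = Finsupp.lmapDomain ℤ ℤ Sum.inl a + Finsupp.lmapDomain ℤ ℤ Sum.inr b := by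
  induction x using Finsupp.induction_linear with
  | zero => exact ⟨0, 0, by simp⟩
  | add x y hx hy =>
    obtain ⟨a, b, rfl⟩ := hx
    obtain ⟨a', b', rfl⟩ := hy
    exact ⟨a + a', b + b', by rw [map_add, map_add]; abel⟩
  | single e n =>
    rcases e with p | q
    · exact ⟨Finsupp.single p n, 0, by simp⟩
    · exact ⟨0, Finsupp.single q n, by simp⟩

/-- The generators of the mapping cone that lie over given sets of simplices. -/
def coneSet (S : Set (Simp P.X)) (T : Set (Simp Q.X)) : Set (Simp P.X ⊕ Simp Q.X) :=
  Sum.inl '' S ∪ Sum.inr '' T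

theorem inl_mem_coneSet {S : Set (Simp P.X)} {T : Set (Simp Q.X)} {p : Simp P.X} :
    Sum.inl p ∈ coneSet S T ↔ p ∈ S := by simp [coneSet]

theorem inr_mem_coneSet {S : Set (Simp P.X)} {T : Set (Simp Q.X)} {q : Simp Q.X} :
    Sum.inr q ∈ coneSet S T ↔ q ∈ T := by simp [coneSet]

theorem mem_cone_iff {S : Set (Simp P.X)} {T : Set (Simp Q.X)} (a : Ch P.X) (b : Ch Q.X) :
    Finsupp.lmapDomain ℤ ℤ Sum.inl a + Finsupp.lmapDomain ℤ ℤ Sum.inr b ∈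
      Finsupp.supported ℤ ℤ (coneSet S T) ↔
    a ∈ Finsupp.supported ℤ ℤ S ∧ b ∈ Finsupp.supported ℤ ℤ T := by
  have h1 : ∀ p, (Finsupp.lmapDomain ℤ ℤ Sum.inl a + Finsupp.lmapDomain ℤ ℤ Sum.inr b :
      Simp P.X ⊕ Simp Q.X →₀ ℤ) (Sum.inl p) = a p := by
    intro p
    rw [Finsupp.add_apply, Finsupp.lmapDomain_apply, Finsupp.lmapDomain_apply,
      Finsupp.mapDomain_apply Sum.inl_injective, Finsupp.mapDomain_of_notMem_range, add_zero]
    simp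
  have h2 : ∀ q, (Finsupp.lmapDomain ℤ ℤ Sum.inl a + Finsupp.lmapDomain ℤ ℤ Sum.inr b :
      Simp P.X ⊕ Simp Q.X →₀ ℤ) (Sum.inr q) = b q := by
    intro q
    rw [Finsupp.add_apply, Finsupp.lmapDomain_apply, Finsupp.lmapDomain_apply,
      Finsupp.mapDomain_apply Sum.inr_injective, Finsupp.mapDomain_of_notMem_range, zero_add]
    simp
  simp only [Finsupp.mem_supported']
  constructor
  · intro h
    refine ⟨fun p hp => ?_, fun q hq => ?_⟩
    · rw [← h1 p]; exact h (Sum.inl p) (mt inl_mem_coneSet.1 hp)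
    · rw [← h2 q]; exact h (Sum.inr q) (mt inr_mem_coneSet.1 hq)
  · rintro ⟨ha, hb⟩ (p | q) he
    · rw [h1]; exact ha p (mt inl_mem_coneSet.2 he)
    · rw [h2]; exact hb q (mt inr_mem_coneSet.2 he)

variable {f}

theorem bd_single_mem {X : SSet.{u}} {m : ℕ} (s : X _⦋m⦌) :
    bd (Finsupp.single (⟨m, s⟩ : Simp X) 1) ∈ Finsupp.supported ℤ ℤ {t | t.1 + 1 = m} := by
  cases m with
  | zero => rw [bd_zero_simp]; exact zero_mem _
  | succ m =>
    rw [bd_succ_simp]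
    exact sum_mem fun i _ => Submodule.smul_mem _ _ (Finsupp.single_mem_supported ℤ _ (by rfl))

theorem lmapDomain_mem {α β : Type*} (g : α → β) {S : Set α} {T : Set β} (h : ∀ a ∈ S, g a ∈ T)
    {z : α →₀ ℤ} (hz : z ∈ Finsupp.supported ℤ ℤ S) :
    Finsupp.lmapDomain ℤ ℤ g z ∈ Finsupp.supported ℤ ℤ T := by
  classical
  rw [Finsupp.mem_supported] at hz ⊢
  refine (Finset.coe_subset.2 Finsupp.mapDomain_support).trans ?_
  intro y hy
  rw [Finset.mem_coe, Finset.mem_image] at hy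
  obtain ⟨x, hx, rfl⟩ := hy
  exact h x (hz hx)

/-- The mapping cone of a quasi-isomorphism has no cohomology. -/
theorem IsQI.exists_cobounding (hf : IsQI f) {A : Type} [AddCommGroup A] {k : ℤ}
    {b : Cochain P.X A} {c : Cochain Q.X A} (hb : IsRel P (k - 1) b) (hc : IsRel Q k c)
    (hdc : d c = 0) (hbc : pull A f c = d b) :
    ∃ (b' : Cochain P.X A) (c' : Cochain Q.X A), IsRel P (k - 2) b' ∧ IsRel Q (k - 1) c' ∧
      c = d c' ∧ b = pull A f c' - d b' := by
  let S : Set (Simp P.X ⊕ Simp Q.X) := coneSet (simpSet P.Y) (simpSet Q.Y)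
  obtain ⟨s, hs₁, hs₂⟩ := exists_contraction (E := Simp P.X ⊕ Simp Q.X)
    -- Generators from the source are shifted up by one degree, so that the cone differential lowers
    -- degree by one.
    (Sum.elim (fun p => p.1 + 1) (fun q => q.1)) (coneBd f) S (by
      rintro (⟨m, p⟩ | ⟨m, q⟩)
      · have : Finsupp.single (Sum.inl ⟨m, p⟩ : Simp P.X ⊕ Simp Q.X) (1 : ℤ) =
          Finsupp.lmapDomain ℤ ℤ Sum.inl (Finsupp.single ⟨m, p⟩ 1) := by simp
        rw [this, coneBd_inl, chMap_single]
        refine add_mem (neg_mem (lmapDomain_mem _ ?_ (bd_single_mem p)))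
          (lmapDomain_mem (S := {t | t.1 = m}) _ ?_ (Finsupp.single_mem_supported ℤ _ (by rfl)))
        · rintro t (ht : _ = _)
          simpa using ht
        · rintro t (ht : _ = _)
          simpa using ht
      · have : Finsupp.single (Sum.inr ⟨m, q⟩ : Simp P.X ⊕ Simp Q.X) (1 : ℤ) =
          Finsupp.lmapDomain ℤ ℤ Sum.inr (Finsupp.single ⟨m, q⟩ 1) := by simp
        rw [this, coneBd_inr]
        refine lmapDomain_mem _ ?_ (bd_single_mem q)
        rintro t (ht : _ = _)
        simpa using ht) (by
      intro x
      obtain ⟨a, b, rfl⟩ := exists_cone_eq x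
      rw [map_add, map_add, coneBd_inl, coneBd_inr, map_add, map_neg, coneBd_inl, coneBd_inr,
        coneBd_inr, bd_bd, bd_bd, chMap_bd]
      simp) (by
      intro x hx
      obtain ⟨a, b, rfl⟩ := exists_cone_eq x
      rw [mem_cone_iff] at hx
      rw [map_add, coneBd_inl, coneBd_inr, ← map_neg, add_assoc, ← map_add, mem_cone_iff]
      exact ⟨neg_mem (bd_mem_subCh _ _ hx.1),
        add_mem (chMap_mem f _ hx.1) (bd_mem_subCh _ _ hx.2)⟩) (by
      intro x hx
      obtain ⟨a, b, rfl⟩ := exists_cone_eq x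
      rw [map_add, coneBd_inl, coneBd_inr, ← map_neg, add_assoc, ← map_add, mem_cone_iff] at hx
      -- Acyclicity: a relative cycle `(a, b)` has `a` a relative cycle and `f a = -∂b` modulo
      -- `Q.Y`. Injectivity gives `a = ∂y` modulo `P.Y`, so `b + f y` is a relative cycle, and
      -- surjectivity gives `z` and `y'`; the primitive is `(z - y, y')`.
      obtain ⟨y, hy⟩ := hf.inj a (-b) (neg_mem_iff.1 hx.1) (by
        rw [map_neg, sub_neg_eq_add]; exact hx.2)
      obtain ⟨z, y', hz, hy'⟩ := hf.surj (b + chMap f.map y) (by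
        rw [map_add, ← chMap_bd]
        have h := sub_mem hx.2 (chMap_mem f _ hy)
        have e : bd b + chMap f.map (bd y) = chMap f.map a + bd b - chMap f.map (a - bd y) := by
          rw [map_sub]; abel
        rw [e]
        exact h)
      refine ⟨Finsupp.lmapDomain ℤ ℤ Sum.inl (z - y) + Finsupp.lmapDomain ℤ ℤ Sum.inr y', ?_⟩
      rw [map_add, coneBd_inl, coneBd_inr]
      have : Finsupp.lmapDomain ℤ ℤ Sum.inl a + Finsupp.lmapDomain ℤ ℤ Sum.inr b -
          (-Finsupp.lmapDomain ℤ ℤ Sum.inl (bd (z - y)) +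
            Finsupp.lmapDomain ℤ ℤ Sum.inr (chMap f.map (z - y)) +
            Finsupp.lmapDomain ℤ ℤ Sum.inr (bd y')) =
          Finsupp.lmapDomain ℤ ℤ (Sum.inl : Simp P.X → Simp P.X ⊕ Simp Q.X) (a - bd y + bd z) +
          Finsupp.lmapDomain ℤ ℤ Sum.inr (b + chMap f.map y - chMap f.map z - bd y') := by
        simp only [map_add, map_sub]
        abel
      rw [this, mem_cone_iff]
      exact ⟨add_mem hy hz, hy'⟩)
  -- The pair `(b, c)` becomes one functional on the cone. The equations `dc = 0` and `f^* c = db`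
  -- say that it kills all boundaries.
  let φ : (Simp P.X ⊕ Simp Q.X →₀ ℤ) →ₗ[ℤ] A := Finsupp.linearCombination ℤ
    (Sum.elim (fun p => b p.1 p.2) (fun q => c q.1 q.2))
  have φ_inl : ∀ a, φ (Finsupp.lmapDomain ℤ ℤ Sum.inl a) = ev b a := by
    intro a
    have : φ ∘ₗ Finsupp.lmapDomain ℤ ℤ Sum.inl = ev b := by
      refine Ch.hom_ext fun m s => ?_
      simp [φ]
    exact LinearMap.congr_fun this a
  have φ_inr : ∀ a, φ (Finsupp.lmapDomain ℤ ℤ Sum.inr a) = ev c a := by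
    intro a
    have : φ ∘ₗ Finsupp.lmapDomain ℤ ℤ Sum.inr = ev c := by
      refine Ch.hom_ext fun m s => ?_
      simp [φ]
    exact LinearMap.congr_fun this a
  have ev_pull : ∀ a, ev c (chMap f.map a) = ev (pull A f c) a := by
    intro a
    have : ev c ∘ₗ chMap f.map = ev (pull A f c) := by
      refine Ch.hom_ext fun m s => ?_
      rw [LinearMap.comp_apply, chMap_single, ev_single, ev_single]
      rfl
    exact LinearMap.congr_fun this a
  have φδ : ∀ x, φ (coneBd f x) = 0 := by
    intro x
    obtain ⟨u, v, rfl⟩ := exists_cone_eq x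
    rw [map_add, coneBd_inl, coneBd_inr, map_add, map_add, map_neg, φ_inl, φ_inr, φ_inr,
      ← ev_d, ← ev_d, hdc, ev_pull, hbc, neg_add_cancel, zero_add]
    exact ev_zero _
  have φN : ∀ x ∈ Finsupp.supported ℤ ℤ S, φ x = 0 := by
    intro x hx
    rw [Finsupp.supported_eq_span_single] at hx
    have : Submodule.span ℤ ((fun i => Finsupp.single i (1 : ℤ)) '' S) ≤ LinearMap.ker φ := by
      rw [Submodule.span_le]
      rintro _ ⟨p | q, he, rfl⟩
      · simp only [φ, SetLike.mem_coe, LinearMap.mem_ker, Finsupp.linearCombination_single]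
        simp [hb _ _ (Or.inr (inl_mem_coneSet.1 he))]
      · simp only [φ, SetLike.mem_coe, LinearMap.mem_ker, Finsupp.linearCombination_single]
        simp [hc _ _ (Or.inr (inr_mem_coneSet.1 he))]
    exact this hx
  -- The contraction identity under `φ` loses both the boundary term and the term in the subcomplex,
  -- so `φ` is the coboundary of `φ ∘ s`. The components of `φ ∘ s` are `b₁` and `c₁`.
  have key : ∀ x, φ x = φ (s (coneBd f x)) := by
    intro x
    have := φN _ (hs₂ x)
    rw [map_sub, map_sub, φδ, sub_zero, sub_eq_zero] at this
    exact this
  let b₁ : Cochain P.X A := fun m x => φ (s (Finsupp.single (Sum.inl ⟨m, x⟩) 1))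
  let c₁ : Cochain Q.X A := fun m x => φ (s (Finsupp.single (Sum.inr ⟨m, x⟩) 1))
  have ψ_inl : ∀ a, φ (s (Finsupp.lmapDomain ℤ ℤ Sum.inl a)) = ev b₁ a := by
    intro a
    have : φ ∘ₗ s ∘ₗ Finsupp.lmapDomain ℤ ℤ Sum.inl = ev b₁ := by
      refine Ch.hom_ext fun m s => ?_
      simp [b₁]
    exact LinearMap.congr_fun this a
  have ψ_inr : ∀ a, φ (s (Finsupp.lmapDomain ℤ ℤ Sum.inr a)) = ev c₁ a := by
    intro a
    have : φ ∘ₗ s ∘ₗ Finsupp.lmapDomain ℤ ℤ Sum.inr = ev c₁ := by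
      refine Ch.hom_ext fun m s => ?_
      simp [c₁]
    exact LinearMap.congr_fun this a
  have hc₁ : c = d c₁ := by
    funext m x
    have := key (Finsupp.lmapDomain ℤ ℤ Sum.inr (Finsupp.single ⟨m, x⟩ 1))
    rwa [φ_inr, coneBd_inr, ψ_inr, ← ev_d, ev_single, ev_single] at this
  have hb₁ : b = pull A f c₁ - d b₁ := by
    funext m x
    have := key (Finsupp.lmapDomain ℤ ℤ Sum.inl (Finsupp.single ⟨m, x⟩ 1))
    rw [φ_inl, coneBd_inl, map_add, map_add, map_neg, map_neg, ψ_inl, ψ_inr, ← ev_d, ev_single,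
      ev_single, chMap_single, ev_single] at this
    rw [this, neg_add_eq_sub]
    rfl
  -- Both components vanish on the subcomplexes because `s` is zero on the generators in `S`;
  -- truncation restores homogeneity.
  refine ⟨trunc (k - 2) b₁, trunc (k - 1) c₁, isRel_trunc ?_, isRel_trunc ?_, ?_, ?_⟩
  · intro m x hx
    change φ (s _) = 0
    rw [hs₁ _ (inl_mem_coneSet.2 hx), map_zero]
  · intro m x hx
    change φ (s _) = 0
    rw [hs₁ _ (inr_mem_coneSet.2 hx), map_zero]
  · rw [d_trunc (k := k) (by ring), ← hc₁, hc.trunc_eq]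
  · rw [d_trunc (k := k - 1) (by ring), ← hb.trunc_eq, hb₁]
    funext m x
    simp only [trunc, pull, Pi.sub_apply, AddMonoidHom.coe_mk, ZeroHom.coe_mk]
    split_ifs <;> simp

end Cone

/-! ### Normalization -/

section Normalization
open AlgebraicTopology.DoldKan
variable {X Y : SSet.{u}} {A : Type} [AddCommGroup A]

/-- The projection of the chains of degree `m` onto a complement of the degenerate chains. -/
noncomputable def pInf (X : SSet.{u}) (m : ℕ) : (X _⦋m⦌ →₀ ℤ) →ₗ[ℤ] (X _⦋m⦌ →₀ ℤ) :=
  ((PInfty (X := freeS X)).f m).hom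

theorem pInf_naturality (f : X ⟶ Y) (m : ℕ) (z : X _⦋m⦌ →₀ ℤ) :
    pInf Y m (Finsupp.lmapDomain ℤ ℤ (f.app (op ⦋m⦌)) z) =
      Finsupp.lmapDomain ℤ ℤ (f.app (op ⦋m⦌)) (pInf X m z) :=
  ConcreteCategory.congr_hom (PInfty_f_naturality m
    (((SimplicialObject.whiskering _ _).obj freeZ).map f)) z

theorem pInf_degenerate {m : ℕ} {s : X _⦋m⦌} (hs : s ∈ X.degenerate m) :
    pInf X m (Finsupp.single s 1) = 0 := by
  cases m with
  | zero => simp at hs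
  | succ m =>
    obtain ⟨i, t, rfl⟩ := exists_sigma (P := absPair X) hs
    have h : pInf X (m + 1) ∘ₗ Finsupp.lmapDomain ℤ ℤ (X.σ i) = 0 :=
      congrArg ModuleCat.Hom.hom (σ_comp_PInfty (freeS X) i)
    have e : Finsupp.lmapDomain ℤ ℤ (X.σ i) (Finsupp.single t 1) = Finsupp.single (X.σ i t) 1 :=
      Finsupp.mapDomain_single
    exact (congrArg (pInf X (m + 1)) e).symm.trans (LinearMap.congr_fun h (Finsupp.single t 1))

theorem altFace_pInf (m : ℕ) (z : X _⦋m + 1⦌ →₀ ℤ) :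
    altFace X m (pInf X (m + 1) z) = pInf X m (altFace X m z) := by
  have h := (PInfty (X := freeS X)).comm (m + 1) m
  rw [AlgebraicTopology.AlternatingFaceMapComplex.obj_d_eq] at h
  have h' : altFace X m ∘ₗ pInf X (m + 1) = pInf X m ∘ₗ altFace X m := congrArg ModuleCat.Hom.hom h
  exact LinearMap.congr_fun h' z

/-- A functional that vanishes on degenerate simplices vanishes on the image of the complementary
projector `QInfty`, and `PInfty + QInfty = 1`. -/
theorem linearCombination_pInf {m : ℕ} (c : X _⦋m⦌ → A) (hc : ∀ s ∈ X.degenerate m, c s = 0)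
    (s : X _⦋m⦌) : Finsupp.linearCombination ℤ c (pInf X m (Finsupp.single s 1)) = c s := by
  -- The lift to universe `u` makes `A` an object of the category in which `freeS X` lives.
  let g : (freeS X) _⦋m⦌ ⟶ ModuleCat.of ℤ (ULift.{u} A) :=
    ModuleCat.ofHom (Finsupp.linearCombination ℤ (fun s : X _⦋m⦌ => ULift.up.{u} (c s)))
  have hg : DegeneraciesVanish g := by
    cases m with
    | zero => simp
    | succ m =>
      intro i
      have h : Finsupp.linearCombination ℤ (fun s : X _⦋m + 1⦌ => ULift.up.{u} (c s)) ∘ₗ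
          Finsupp.lmapDomain ℤ ℤ (X.σ i) = 0 := by
        apply Finsupp.lhom_ext'
        intro t
        refine LinearMap.ext_ring ?_
        simp [hc _ (X.σ_mem_degenerate i t)]
        rfl
      exact ModuleCat.hom_ext h
  rw [degeneraciesVanish_iff_QInfty_f_comp] at hg
  have h1 : g = ((PInfty (X := freeS X)).f m : (freeS X) _⦋m⦌ ⟶ (freeS X) _⦋m⦌) ≫ g := by
    have h0 := congrArg (fun φ : (freeS X) _⦋m⦌ ⟶ (freeS X) _⦋m⦌ => φ ≫ g)
      (PInfty_f_add_QInfty_f (X := freeS X) m)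
    have h0' := Preadditive.add_comp _ _ _
      ((PInfty (X := freeS X)).f m : (freeS X) _⦋m⦌ ⟶ (freeS X) _⦋m⦌)
      ((QInfty (X := freeS X)).f m : (freeS X) _⦋m⦌ ⟶ (freeS X) _⦋m⦌) g
    rw [hg, add_zero] at h0'
    exact ((h0'.symm.trans h0).trans (Category.id_comp g)).symm
  have h2 : ∀ z : X _⦋m⦌ →₀ ℤ, Finsupp.linearCombination ℤ c z = (g.hom z : ULift.{u} A).down := by
    intro z
    change _ = (Finsupp.linearCombination ℤ (fun s : X _⦋m⦌ => ULift.up.{u} (c s)) z).down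
    induction z using Finsupp.induction_linear with
    | zero => simp
    | add x y hx hy => simp [hx, hy]
    | single s a => simp
  have h3 : (g.hom (Finsupp.single s 1 : X _⦋m⦌ →₀ ℤ) : ULift.{u} A) =
    g.hom (pInf X m (Finsupp.single s 1)) := ConcreteCategory.congr_hom h1 (Finsupp.single s 1 : X _⦋m⦌ →₀ ℤ)
  rw [h2]
  refine (congrArg ULift.down h3).symm.trans ?_
  rw [← h2]
  simp

/-- The normalization of a cochain. -/
noncomputable def normalize : Cochain X A →+ Cochain X A where
  toFun c := fun m s => Finsupp.linearCombination ℤ (c m) (pInf X m (Finsupp.single s 1))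
  map_zero' := by
    funext m s
    exact LinearMap.congr_fun (Finsupp.linearCombination_zero (R := ℤ) (α := X _⦋m⦌) (M := A)) _
  map_add' c c' := by
    funext m s
    have : Finsupp.linearCombination ℤ ((c + c') m) =
        Finsupp.linearCombination ℤ (c m) + Finsupp.linearCombination ℤ (c' m) := by
      ext
      simp
    rw [this]; rfl

theorem normalize_apply (c : Cochain X A) (m : ℕ) (s : X _⦋m⦌) :
    normalize c m s = Finsupp.linearCombination ℤ (c m) (pInf X m (Finsupp.single s 1)) := rfl

theorem linearCombination_altFace (c : Cochain X A) (m : ℕ) (z : X _⦋m + 1⦌ →₀ ℤ) :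
    Finsupp.linearCombination ℤ (d c (m + 1)) z =
      Finsupp.linearCombination ℤ (c m) (altFace X m z) := by
  have : Finsupp.linearCombination ℤ (d c (m + 1)) =
      Finsupp.linearCombination ℤ (c m) ∘ₗ altFace X m := by
    apply Finsupp.lhom_ext'
    intro x
    refine LinearMap.ext_ring ?_
    change Finsupp.linearCombination ℤ (d c (m + 1)) (Finsupp.single x 1) =
      Finsupp.linearCombination ℤ (c m) (altFace X m (Finsupp.single x 1))
    rw [altFace_single, map_sum, Finsupp.linearCombination_single, one_smul]
    change (∑ i : Fin (m + 2), ((-1 : ℤ) ^ (i : ℕ)) • c m (X.δ i x)) = _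
    refine Finset.sum_congr rfl fun i _ => ?_
    rw [map_zsmul, Finsupp.linearCombination_single, one_smul]
  exact LinearMap.congr_fun this z

/-- `PInfty` is a chain map, so precomposition with it commutes with the coboundary. -/
theorem d_normalize (c : Cochain X A) : d (normalize c) = normalize (d c) := by
  funext m s
  cases m with
  | zero =>
    rw [normalize_apply, show d c 0 = 0 from rfl]
    exact (LinearMap.congr_fun
      (Finsupp.linearCombination_zero (R := ℤ) (α := X _⦋0⦌) (M := A)) _).symm
  | succ m =>
    rw [normalize_apply, linearCombination_altFace, altFace_pInf, altFace_single, map_sum, map_sum]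
    change (∑ i : Fin (m + 2), ((-1 : ℤ) ^ (i : ℕ)) • normalize c m (X.δ i s)) = _
    refine Finset.sum_congr rfl fun i _ => ?_
    rw [map_zsmul, map_zsmul]
    rfl

theorem normalize_pull {P Q : SPair.{u}} (f : P ⟶ Q) (c : Cochain Q.X A) :
    normalize (pull A f c) = pull A f (normalize c) := by
  funext m s
  change _ = normalize c m (f.map.app _ s)
  rw [normalize_apply, normalize_apply, ← Finsupp.mapDomain_single,
    ← Finsupp.lmapDomain_apply ℤ ℤ, pInf_naturality, Finsupp.lmapDomain_apply,
    Finsupp.linearCombination_mapDomain]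
  rfl

/-- Vanishing on degenerate simplices comes from `PInfty` killing them. Vanishing on `Y` survives
because `PInfty` is natural for the inclusion of `Y`: the projection of a simplex of `Y` is a chain
of `Y`. -/
theorem normalize_mem {P : SPair.{u}} {k : ℤ} {c : Cochain P.X A} (hc : IsRel P k c) :
    normalize c ∈ C P A k := by
  rintro m s (h | h | h)
  · rw [normalize_apply, show c m = 0 from funext fun t => hc m t (Or.inl h)]
    exact LinearMap.congr_fun (Finsupp.linearCombination_zero (R := ℤ) (α := P.X _⦋m⦌) (M := A)) _
  · rw [normalize_apply, pInf_degenerate h, map_zero]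
  · have h0 := pInf_naturality P.Y.ι m (Finsupp.single (⟨s, h⟩ : (P.Y : SSet) _⦋m⦌) 1)
    have e : Finsupp.lmapDomain ℤ ℤ (P.Y.ι.app (op ⦋m⦌)) (Finsupp.single (⟨s, h⟩ : (P.Y : SSet) _⦋m⦌) 1) =
        Finsupp.single s 1 := Finsupp.mapDomain_single
    have h1 : pInf P.X m (Finsupp.single s 1) = _ := (congrArg (pInf P.X m) e).symm.trans h0
    rw [normalize_apply, h1, Finsupp.lmapDomain_apply, Finsupp.linearCombination_mapDomain,
      show c m ∘ (P.Y.ι.app (op ⦋m⦌)) = 0 from funext fun t => hc m _ (Or.inr t.2)]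
    exact LinearMap.congr_fun (Finsupp.linearCombination_zero (R := ℤ)
      (α := (P.Y : SSet) _⦋m⦌) (M := A)) _

theorem normalize_eq {P : SPair.{u}} {k : ℤ} {c : Cochain P.X A} (hc : c ∈ C P A k) :
    normalize c = c := by
  funext m s
  exact linearCombination_pInf (c m) (fun t ht => hc m t (Or.inr (Or.inl ht))) s

end Normalization

/-- A quasi-isomorphism of simplicial pairs induces isomorphisms on cohomology with any
coefficients. -/
theorem IsQI.bijective {P Q : SPair.{u}} {f : P ⟶ Q} (hf : IsQI f) (A : Type) [AddCommGroup A]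
    (k : ℤ) : Function.Bijective (H.map A k f) := by
  constructor
  · rw [injective_iff_map_eq_zero]
    intro a ha
    induction a using QuotientAddGroup.induction_on with | H c => ?_
    obtain ⟨b, hb, hbc⟩ := (H.mk_eq_zero_iff (Z.map A k f c)).1 ha
    have hbc' : d b = pull A f c := hbc
    obtain ⟨hc₁, hc₂⟩ := mem_Z.1 c.2
    -- For injectivity, `(b, c)` with `f^* c = db` is a cocycle of the cone, so `c` bounds. The
    -- primitive need not be normalized; `normalize` repairs it without changing `c`.
    obtain ⟨b', c', -, hc', h, -⟩ := hf.exists_cobounding (isRel_of_mem hb) (isRel_of_mem hc₁)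
      hc₂ hbc'.symm
    refine (H.mk_eq_zero_iff c).2 ⟨normalize c', normalize_mem hc', ?_⟩
    rw [d_normalize, ← h, normalize_eq hc₁]
  · intro a
    induction a using QuotientAddGroup.induction_on with | H b => ?_
    obtain ⟨hb₁, hb₂⟩ := mem_Z.1 b.2
    -- For surjectivity, a cocycle `b` on the source gives the cone cocycle `(b, 0)` in the next
    -- degree. Cobounding it shows that `b` is `f^* c' - d b'` with `c'` a cocycle.
    obtain ⟨b', c', hb', hc', h, h'⟩ := hf.exists_cobounding (k := k + 1) (c := 0)
      (A := A) (b := (b : Cochain P.X A)) (by rw [add_sub_cancel_right]; exact isRel_of_mem hb₁) (fun _ _ _ => rfl) (map_zero _)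
      (by rw [map_zero, hb₂])
    rw [add_sub_cancel_right] at hc'
    rw [show k + 1 - 2 = k - 1 by ring] at hb'
    refine ⟨QuotientAddGroup.mk ⟨normalize c', mem_Z.2 ⟨normalize_mem hc', by
      rw [d_normalize, ← h, map_zero]⟩⟩, ?_⟩
    refine sub_eq_zero.1 ?_
    change (QuotientAddGroup.mk (Z.map A k f ⟨normalize c', _⟩ - b) : H P A k) = 0
    refine (H.mk_eq_zero_iff _).2 ⟨normalize b', normalize_mem hb', ?_⟩
    change _ = pull A f (normalize c') - (b : Cochain P.X A)
    rw [d_normalize, ← normalize_pull, ← normalize_eq hb₁]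
    conv_rhs => rw [h', ← map_sub]
    congr 1
    abel

end SpinPin

namespace SpinPin

/-! ### Homotopy invariance -/

section Prism
open MonoidalCategory Functor.LaxMonoidal
variable {X Y X' Y' : SSet.{u}} {f g : X ⟶ Y} {f' g' : X' ⟶ Y'}

/-- The prism over a simplex. -/
noncomputable def prismSimp (H : SSet.Homotopy f g) (s : Simp X) : Ch Y :=
  -∑ k : Fin (s.1 + 1), ((-1 : ℤ) ^ (k : ℕ)) •
    Finsupp.single (⟨s.1 + 1, H.toSimplicialObjectHomotopy.h k s.2⟩ : Simp Y) 1

/-- The prism operator of a homotopy. -/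
noncomputable def prism (H : SSet.Homotopy f g) : Ch X →ₗ[ℤ] Ch Y :=
  Finsupp.linearCombination ℤ (prismSimp H)

theorem prism_single (H : SSet.Homotopy f g) (s : Simp X) :
    prism H (Finsupp.single s 1) = prismSimp H s := by simp [prism]

/-- The prism operator in a given degree. -/
noncomputable def prismDeg (H : SSet.Homotopy f g) (m : ℕ) :
    (X _⦋m⦌ →₀ ℤ) →ₗ[ℤ] (Y _⦋m + 1⦌ →₀ ℤ) :=
  -∑ k : Fin (m + 1), ((-1 : ℤ) ^ (k : ℕ)) •
    Finsupp.lmapDomain ℤ ℤ (H.toSimplicialObjectHomotopy.h k)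

theorem prism_chIncl (H : SSet.Homotopy f g) (m : ℕ) (z : X _⦋m⦌ →₀ ℤ) :
    prism H (chIncl X m z) = chIncl Y (m + 1) (prismDeg H m z) := by
  have : prism H ∘ₗ chIncl X m = chIncl Y (m + 1) ∘ₗ prismDeg H m := by
    apply Finsupp.lhom_ext'
    intro x
    refine LinearMap.ext_ring ?_
    change prism H (chIncl X m (Finsupp.single x 1)) =
      chIncl Y (m + 1) (prismDeg H m (Finsupp.single x 1))
    rw [chIncl_single, prism_single, prismDeg, LinearMap.neg_apply, map_neg, LinearMap.sum_apply,
      map_sum, prismSimp]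
    congr 1
    refine Finset.sum_congr rfl fun i _ => ?_
    rw [LinearMap.smul_apply, map_smul, Finsupp.lmapDomain_apply, Finsupp.mapDomain_single,
      chIncl_single]
  exact LinearMap.congr_fun this z

/-- The chain homotopy of the whiskered simplicial homotopy is this explicit signed sum; this also
accounts for the overall minus sign in the prism. -/
theorem hom_whiskerRight (H : SSet.Homotopy f g) (m : ℕ) :
    (SimplicialObject.Homotopy.ToChainHomotopy.hom
      (H.toSimplicialObjectHomotopy.whiskerRight freeZ) m (m + 1)).hom = prismDeg H m := by
  rw [SimplicialObject.Homotopy.ToChainHomotopy.hom_eq, ModuleCat.hom_neg, ModuleCat.hom_sum]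
  unfold prismDeg
  congr 1

theorem prism_bd (H : SSet.Homotopy f g) (z : Ch X) :
    bd (prism H z) + prism H (bd z) = chMap f z - chMap g z := by
  have : bd ∘ₗ prism H + prism H ∘ₗ bd = chMap f - chMap g := by
    refine Ch.hom_ext fun m x => ?_
    rw [LinearMap.add_apply, LinearMap.comp_apply, LinearMap.comp_apply, LinearMap.sub_apply]
    have hc := (H.toSimplicialObjectHomotopy.whiskerRight freeZ).toChainHomotopy.comm m
    rw [Homotopy.prevD_chainComplex] at hc
    cases m with
    | zero =>
      rw [Homotopy.dNext_zero_chainComplex, zero_add] at hc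
      have hc' : Finsupp.lmapDomain ℤ ℤ (f.app (op ⦋0⦌)) = altFace Y 0 ∘ₗ prismDeg H 0 +
          Finsupp.lmapDomain ℤ ℤ (g.app (op ⦋0⦌)) := by
        rw [← hom_whiskerRight]
        exact congrArg ModuleCat.Hom.hom hc
      have h := congrArg (chIncl Y (0)) (LinearMap.congr_fun hc' (Finsupp.single x 1))
      rw [LinearMap.add_apply, LinearMap.comp_apply, map_add, ← bd_chIncl, ← prism_chIncl,
        Finsupp.lmapDomain_apply, Finsupp.lmapDomain_apply,
        Finsupp.mapDomain_single, Finsupp.mapDomain_single, chIncl_single, chIncl_single,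
        chIncl_single] at h
      rw [bd_zero_simp, map_zero, add_zero, chMap_single, chMap_single, h, add_sub_cancel_right]
    | succ m =>
      rw [Homotopy.dNext_succ_chainComplex, AlgebraicTopology.alternatingFaceMapComplex_obj_d,
        AlgebraicTopology.alternatingFaceMapComplex_obj_d] at hc
      have hc' : Finsupp.lmapDomain ℤ ℤ (f.app (op ⦋m + 1⦌)) = prismDeg H m ∘ₗ altFace X m +
          altFace Y (m + 1) ∘ₗ prismDeg H (m + 1) +
          Finsupp.lmapDomain ℤ ℤ (g.app (op ⦋m + 1⦌)) := by
        rw [← hom_whiskerRight, ← hom_whiskerRight]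
        exact congrArg ModuleCat.Hom.hom hc
      have h := congrArg (chIncl Y (m + 1)) (LinearMap.congr_fun hc' (Finsupp.single x 1))
      rw [LinearMap.add_apply, LinearMap.add_apply, LinearMap.comp_apply, LinearMap.comp_apply, map_add, map_add, ← bd_chIncl, ← prism_chIncl,
        ← prism_chIncl, ← bd_chIncl, Finsupp.lmapDomain_apply, Finsupp.lmapDomain_apply,
        Finsupp.mapDomain_single, Finsupp.mapDomain_single, chIncl_single, chIncl_single,
        chIncl_single] at h
      rw [chMap_single, chMap_single, h, add_sub_cancel_right, add_comm]
  exact LinearMap.congr_fun this z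

/-- The prism over a simplex is evaluated on the product of its classifying map with `Δ[1]`, hence
is natural for maps that intertwine two homotopies. For the inclusion of a subspace, this keeps
prisms inside the subspace. -/
theorem chMap_prism (H : SSet.Homotopy f g) (H' : SSet.Homotopy f' g') (a : X ⟶ X') (b : Y ⟶ Y')
    (w : a ▷ Δ[1] ≫ H'.h = H.h ≫ b) (z : Ch X) : chMap b (prism H z) = prism H' (chMap a z) := by
  have : chMap b ∘ₗ prism H = prism H' ∘ₗ chMap a := by
    refine Ch.hom_ext fun m x => ?_
    rw [LinearMap.comp_apply, LinearMap.comp_apply, chMap_single, prism_single, prism_single,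
      prismSimp, prismSimp, map_neg, map_sum]
    congr 1
    refine Finset.sum_congr rfl fun i _ => ?_
    rw [map_zsmul, chMap_single]
    congr 3
    have e : SSet.yonedaEquiv.symm x ▷ Δ[1] ≫ H.h ≫ b =
        SSet.yonedaEquiv.symm (a.app _ x) ▷ Δ[1] ≫ H'.h := by
      rw [← w, ← comp_whiskerRight_assoc]
      congr 2
      exact (SSet.yonedaEquiv_symm_comp x a)
    exact ConcreteCategory.congr_hom (NatTrans.congr_app e _) _
  exact LinearMap.congr_fun this z

/-- The singular homotopy is the topological one composed with the lax monoidal structure map of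
`TopCat.toSSet`; the square therefore commutes by naturality of that map and the interchange law. -/
theorem toSSet_whiskerRight {T U T' U' : TopCat.{u}} {f g : T ⟶ U} {f' g' : T' ⟶ U'}
    (H : TopCat.Homotopy f g) (H' : TopCat.Homotopy f' g') (a : T ⟶ T') (b : U ⟶ U')
    (w : a ▷ _ ≫ H'.h = H.h ≫ b) :
    TopCat.toSSet.map a ▷ Δ[1] ≫ H'.toSSet.h = H.toSSet.h ≫ TopCat.toSSet.map b := by
  change TopCat.toSSet.map a ▷ Δ[1] ≫ _ ◁ SSet.stdSimplex.toSSetObjI ≫ μ TopCat.toSSet _ _ ≫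
    TopCat.toSSet.map H'.h = (_ ◁ SSet.stdSimplex.toSSetObjI ≫ μ TopCat.toSSet _ _ ≫
    TopCat.toSSet.map H.h) ≫ TopCat.toSSet.map b
  rw [Category.assoc, Category.assoc, ← Functor.map_comp, ← w, Functor.map_comp,
    ← whisker_exchange_assoc, μ_natural_left_assoc]

end Prism

/-! ### Homotopy equivalences of topological pairs. -/

section TopologicalPairs
variable {T U V : TopPair.{u}}

/-- Homotopic maps of topological pairs induce chain homotopic maps of relative chains. -/
theorem exists_prism {g₀ g₁ : T ⟶ U} (h : TopPair.Homotopic g₀ g₁) :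
    ∃ k : Ch (singPair T).X →ₗ[ℤ] Ch (singPair U).X,
      (∀ z ∈ subCh (singPair T).Y, k z ∈ subCh (singPair U).Y) ∧
      ∀ z, bd (k z) + k (bd z) = chMap (singMap g₀).map z - chMap (singMap g₁).map z := by
  obtain ⟨H⟩ := h
  refine ⟨prism H.fst.toSSet, ?_, prism_bd _⟩
  have hT : subCh (singPair T).Y = LinearMap.range (chMap (TopCat.toSSet.map T.hom)) :=
    subCh_range _
  have hU : subCh (singPair U).Y = LinearMap.range (chMap (TopCat.toSSet.map U.hom)) :=
    subCh_range _
  rw [hT, hU]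
  rintro _ ⟨z, rfl⟩
  -- A homotopy of pairs carries a homotopy of the subspaces, and its prism lifts the prism of the
  -- ambient one.
  refine ⟨prism H.snd.toSSet z, ?_⟩
  exact chMap_prism _ _ _ _ (toSSet_whiskerRight _ _ _ _ H.w) z

theorem singMap_id (T : TopPair.{u}) : singMap (𝟙 T) = 𝟙 (singPair T) :=
  SPair.Hom.ext (TopCat.toSSet.map_id _)

theorem singMap_comp (g : T ⟶ U) (h : U ⟶ V) : singMap (g ≫ h) = singMap g ≫ singMap h :=
  SPair.Hom.ext (TopCat.toSSet.map_comp _ _)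

theorem chMap_singMap_comp (g : T ⟶ U) (h : U ⟶ V) (z : Ch (singPair T).X) :
    chMap (singMap (g ≫ h)).map z = chMap (singMap h).map (chMap (singMap g).map z) := by
  rw [singMap_comp]
  exact LinearMap.congr_fun (chMap_comp _ _) z

theorem chMap_singMap_id (z : Ch (singPair T).X) : chMap (singMap (𝟙 T)).map z = z := by
  rw [singMap_id]
  exact LinearMap.congr_fun chMap_id z

/-- A homotopy equivalence of topological pairs induces a quasi-isomorphism. -/
theorem IsHomotopyEquiv.isQI {g : T ⟶ U} (hg : IsHomotopyEquiv g) : IsQI (singMap g) := by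
  obtain ⟨h, h₁, h₂⟩ := hg
  obtain ⟨k₁, hk₁, e₁⟩ := exists_prism h₁
  obtain ⟨k₂, hk₂, e₂⟩ := exists_prism h₂
  -- The prisms run from the composites to the identities, whereas the criterion asks for identity
  -- minus composite; hence the signs.
  refine QI.of_homotopy (k := chMap (singMap h).map) (h := -k₁) (h' := -k₂) (chMap_bd _)
    (chMap_mem _) (fun x hx => neg_mem (hk₁ x hx)) (fun x hx => neg_mem (hk₂ x hx)) ?_ ?_
  · intro x
    have := e₁ x
    rw [chMap_singMap_comp, chMap_singMap_id] at this
    rw [LinearMap.neg_apply, LinearMap.neg_apply, map_neg]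
    linear_combination (norm := abel) this
  · intro x
    have := e₂ x
    rw [chMap_singMap_comp, chMap_singMap_id] at this
    rw [LinearMap.neg_apply, LinearMap.neg_apply, map_neg]
    linear_combination (norm := abel) this

theorem IsHomotopyEquiv.of_iso (e : T ≅ U) : IsHomotopyEquiv e.hom :=
  ⟨e.inv, by rw [e.hom_inv_id]; exact TopPair.Homotopic.equivalence.refl _,
    by rw [e.inv_hom_id]; exact TopPair.Homotopic.equivalence.refl _⟩

end TopologicalPairs

end SpinPin

namespace SpinPin

/-! ### Subdivision of tuples -/

/-- The simplicial set whose `m`-simplices are all `(m + 1)`-tuples of elements of `V`. -/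
def tup (V : Type u) : SSet.{u} where
  obj k := Fin (k.unop.len + 1) → V
  map α := ↾fun w => w ∘ α.unop.toOrderHom

/-- The map of tuples induced by a function. -/
def tupMap {V W : Type u} (φ : V → W) : tup V ⟶ tup W where
  app _ := ↾fun w => φ ∘ w

section Tuples
variable {V W : Type u}

/-- The chain of a single tuple. -/
noncomputable def tupCh {m : ℕ} (w : Fin (m + 1) → V) : Ch (tup V) :=
  Finsupp.single (⟨m, w⟩ : Simp (tup V)) 1

theorem tup_hom_ext {M : Type*} [AddCommGroup M] {f g : Ch (tup V) →ₗ[ℤ] M}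
    (h : ∀ m (w : Fin (m + 1) → V), f (tupCh w) = g (tupCh w)) : f = g := Ch.hom_ext h

theorem bd_tupCh_zero (w : Fin 1 → V) : bd (tupCh w) = 0 := bd_zero_simp (X := tup V) w

theorem bd_tupCh_succ {m : ℕ} (w : Fin (m + 2) → V) :
    bd (tupCh w) = ∑ i : Fin (m + 2), ((-1 : ℤ) ^ (i : ℕ)) • tupCh (w ∘ i.succAbove) :=
  bd_succ_simp (X := tup V) w

theorem aug_tupCh {m : ℕ} (w : Fin (m + 1) → V) : aug (tupCh w) = if m = 0 then 1 else 0 :=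
  aug_single (X := tup V) w

theorem chMap_tupCh (φ : V → W) {m : ℕ} (w : Fin (m + 1) → V) :
    chMap (tupMap φ) (tupCh w) = tupCh (φ ∘ w) := chMap_single (tupMap φ) (x := w) 1

/-- The cone with apex `b`. -/
noncomputable def tupCone (b : V) : Ch (tup V) →ₗ[ℤ] Ch (tup V) :=
  Finsupp.lmapDomain ℤ ℤ (fun s => (⟨s.1 + 1, (Fin.cons b s.2 : Fin (s.1 + 2) → V)⟩ : Simp (tup V)))

theorem tupCone_tupCh (b : V) {m : ℕ} (w : Fin (m + 1) → V) :
    tupCone b (tupCh w) = tupCh (Fin.cons b w : Fin (m + 2) → V) := by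
  simp [tupCone, tupCh]

/-- The zeroth face of a cone is its base and the other faces are cones on the faces of the base.
For a single vertex the last face is the apex itself, and this is the augmentation term. -/
theorem bd_tupCone (b : V) (z : Ch (tup V)) :
    bd (tupCone b z) = z - tupCone b (bd z) - aug z • tupCh (fun _ : Fin 1 => b) := by
  have : bd ∘ₗ tupCone b = LinearMap.id - tupCone b ∘ₗ bd -
      (LinearMap.toSpanSingleton ℤ _ (tupCh (fun _ : Fin 1 => b))) ∘ₗ aug := by
    refine tup_hom_ext fun m w => ?_
    simp only [LinearMap.comp_apply, LinearMap.sub_apply, LinearMap.id_apply,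
      LinearMap.toSpanSingleton_apply]
    rw [tupCone_tupCh, bd_tupCh_succ, Fin.sum_univ_succ, aug_tupCh]
    have h0 : (Fin.cons b w : Fin (m + 2) → V) ∘ Fin.succAbove 0 = w := by
      funext i; simp
    cases m with
    | zero =>
      rw [bd_tupCh_zero, h0]
      simp [sub_eq_add_neg]
      congr 1
      funext i
      obtain rfl : i = 0 := Subsingleton.elim (α := Fin 1) i 0
      rfl
    | succ m =>
      have h1 : ∀ i : Fin (m + 2), (Fin.cons b w : Fin (m + 3) → V) ∘ Fin.succAbove i.succ =
          (Fin.cons b (w ∘ i.succAbove) : Fin (m + 2) → V) := by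
        intro i
        funext j
        refine Fin.cases ?_ (fun j => ?_) j <;> simp
      rw [h0, bd_tupCh_succ, map_sum]
      simp only [h1, map_smul, tupCone_tupCh, Fin.val_succ, pow_succ, mul_neg, mul_one, neg_smul,
        Finset.sum_neg_distrib]
      simp [sub_eq_add_neg]
  exact LinearMap.congr_fun this z

theorem aug_tupCone (b : V) (z : Ch (tup V)) : aug (tupCone b z) = 0 := by
  have : aug ∘ₗ tupCone b = 0 := by
    refine tup_hom_ext fun m w => ?_
    rw [LinearMap.comp_apply, tupCone_tupCh, aug_tupCh]
    simp
  exact LinearMap.congr_fun this z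

theorem chMap_tupCone (φ : V → W) (b : V) (z : Ch (tup V)) :
    chMap (tupMap φ) (tupCone b z) = tupCone (φ b) (chMap (tupMap φ) z) := by
  have : chMap (tupMap φ) ∘ₗ tupCone b = tupCone (φ b) ∘ₗ chMap (tupMap φ) := by
    refine tup_hom_ext fun m w => ?_
    rw [LinearMap.comp_apply, LinearMap.comp_apply, tupCone_tupCh, chMap_tupCh, chMap_tupCh,
      tupCone_tupCh]
    congr 1
    funext j
    refine Fin.cases ?_ (fun j => ?_) j <;> simp
  exact LinearMap.congr_fun this z

variable (β : ∀ m : ℕ, (Fin (m + 1) → V) → V) (γ : ∀ m : ℕ, (Fin (m + 1) → W) → W)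

/-- The subdivision of a tuple, with `β` as the barycenters. -/
noncomputable def sdTup (m : ℕ) : (Fin (m + 1) → V) → Ch (tup V) :=
  Nat.rec (fun w => tupCh w)
    (fun m sd w => tupCone (β (m + 1) w)
      (∑ i : Fin (m + 2), ((-1 : ℤ) ^ (i : ℕ)) • sd (w ∘ i.succAbove))) m

/-- The subdivision operator. -/
noncomputable def sd : Ch (tup V) →ₗ[ℤ] Ch (tup V) :=
  Finsupp.linearCombination ℤ (fun s => sdTup β s.1 s.2)

theorem sd_tupCh {m : ℕ} (w : Fin (m + 1) → V) : sd β (tupCh w) = sdTup β m w := by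
  simp [sd, tupCh]

theorem sd_tupCh_zero (w : Fin 1 → V) : sd β (tupCh w) = tupCh w := sd_tupCh β w

theorem sd_tupCh_succ {m : ℕ} (w : Fin (m + 2) → V) :
    sd β (tupCh w) = tupCone (β (m + 1) w) (sd β (bd (tupCh w))) := by
  rw [sd_tupCh, bd_tupCh_succ, map_sum]
  simp only [map_smul, sd_tupCh]
  rfl

theorem aug_sd (z : Ch (tup V)) : aug (sd β z) = aug z := by
  have : aug ∘ₗ sd β = aug := by
    refine tup_hom_ext fun m w => ?_
    rw [LinearMap.comp_apply]
    cases m with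
    | zero => rw [sd_tupCh_zero]
    | succ m => rw [sd_tupCh_succ, aug_tupCone, aug_tupCh]; simp
  exact LinearMap.congr_fun this z

/-- The boundary of a tuple is a combination of tuples of one dimension less, so agreement there may
be assumed. This fits operators defined by coning off their value on the boundary. -/
theorem bd_tupCh_induction {M : Type*} [AddCommGroup M] {f g : Ch (tup V) →ₗ[ℤ] M}
    (h₀ : ∀ w : Fin 1 → V, f (tupCh w) = g (tupCh w))
    (h₁ : ∀ m (w : Fin (m + 2) → V), f (bd (tupCh w)) = g (bd (tupCh w)) →
      f (tupCh w) = g (tupCh w)) : f = g := by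
  refine tup_hom_ext fun m => ?_
  induction m with
  | zero => exact h₀
  | succ m ih =>
    intro w
    refine h₁ m w ?_
    rw [bd_tupCh_succ, map_sum, map_sum]
    refine Finset.sum_congr rfl fun i _ => ?_
    rw [map_smul, map_smul, ih]

/-- In the cone formula for `sd w`, the base is `sd (bd w)`. Its boundary vanishes by induction and
`bd² = 0`, and its augmentation vanishes because it is that of a boundary. -/
theorem bd_sd (z : Ch (tup V)) : bd (sd β z) = sd β (bd z) := by
  have : bd ∘ₗ sd β = sd β ∘ₗ bd := by
    refine bd_tupCh_induction (fun w => ?_) fun m w ih => ?_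
    · simp [sd_tupCh_zero, bd_tupCh_zero]
    · simp only [LinearMap.comp_apply] at ih ⊢
      rw [sd_tupCh_succ, bd_tupCone, ih, bd_bd, map_zero, map_zero, aug_sd, aug_bd, zero_smul,
        sub_zero, sub_zero]
  exact LinearMap.congr_fun this z

/-- Subdivision uses nothing but the choice of barycenters, so any function compatible with them
commutes with it. -/
theorem chMap_sd (φ : V → W) (hφ : ∀ m w, φ (β m w) = γ m (φ ∘ w)) (z : Ch (tup V)) :
    chMap (tupMap φ) (sd β z) = sd γ (chMap (tupMap φ) z) := by
  have : chMap (tupMap φ) ∘ₗ sd β = sd γ ∘ₗ chMap (tupMap φ) := by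
    refine bd_tupCh_induction (fun w => ?_) fun m w ih => ?_
    · rw [LinearMap.comp_apply, LinearMap.comp_apply, sd_tupCh_zero, chMap_tupCh, sd_tupCh_zero]
    · simp only [LinearMap.comp_apply] at ih ⊢
      rw [sd_tupCh_succ, chMap_tupCone, ih, chMap_tupCh, sd_tupCh_succ, hφ, chMap_bd, chMap_tupCh]
  exact LinearMap.congr_fun this z

/-- The homotopy from the identity to the subdivision, on a tuple. -/
noncomputable def sdHtpyTup (m : ℕ) : (Fin (m + 1) → V) → Ch (tup V) :=
  Nat.rec (fun _ => 0)
    (fun m h w => tupCone (β (m + 1) w)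
      (tupCh w - ∑ i : Fin (m + 2), ((-1 : ℤ) ^ (i : ℕ)) • h (w ∘ i.succAbove))) m

/-- The homotopy from the identity to the subdivision. -/
noncomputable def sdHtpy : Ch (tup V) →ₗ[ℤ] Ch (tup V) :=
  Finsupp.linearCombination ℤ (fun s => sdHtpyTup β s.1 s.2)

theorem sdHtpy_tupCh {m : ℕ} (w : Fin (m + 1) → V) : sdHtpy β (tupCh w) = sdHtpyTup β m w := by
  simp [sdHtpy, tupCh]

theorem sdHtpy_tupCh_zero (w : Fin 1 → V) : sdHtpy β (tupCh w) = 0 := sdHtpy_tupCh β w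

theorem sdHtpy_tupCh_succ {m : ℕ} (w : Fin (m + 2) → V) :
    sdHtpy β (tupCh w) = tupCone (β (m + 1) w) (tupCh w - sdHtpy β (bd (tupCh w))) := by
  rw [sdHtpy_tupCh, bd_tupCh_succ, map_sum]
  simp only [map_smul, sdHtpy_tupCh]
  rfl

theorem aug_sdHtpy (z : Ch (tup V)) : aug (sdHtpy β z) = 0 := by
  have : aug ∘ₗ sdHtpy β = 0 := by
    refine tup_hom_ext fun m w => ?_
    rw [LinearMap.comp_apply]
    cases m with
    | zero => rw [sdHtpy_tupCh_zero, map_zero]; rfl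
    | succ m => rw [sdHtpy_tupCh_succ, aug_tupCone]; rfl
  exact LinearMap.congr_fun this z

/-- By induction the base `w - h (bd w)` of the cone has boundary `sd (bd w)`, and coning this off
from the barycenter is exactly `sd w`. -/
theorem bd_sdHtpy (z : Ch (tup V)) : bd (sdHtpy β z) + sdHtpy β (bd z) = z - sd β z := by
  have : bd ∘ₗ sdHtpy β + sdHtpy β ∘ₗ bd = LinearMap.id - sd β := by
    refine bd_tupCh_induction (fun w => ?_) fun m w ih => ?_
    · simp [sd_tupCh_zero, bd_tupCh_zero, sdHtpy_tupCh_zero]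
    · simp only [LinearMap.comp_apply, LinearMap.add_apply, LinearMap.sub_apply,
        LinearMap.id_apply] at ih ⊢
      rw [bd_bd, map_zero, add_zero] at ih
      rw [sdHtpy_tupCh_succ, bd_tupCone, map_sub bd, ih, sub_sub_cancel, ← sd_tupCh_succ,
        map_sub aug, aug_sdHtpy, aug_tupCh, if_neg m.succ_ne_zero, sub_zero, zero_smul, sub_zero]
      abel
  exact LinearMap.congr_fun this z

theorem chMap_sdHtpy (φ : V → W) (hφ : ∀ m w, φ (β m w) = γ m (φ ∘ w)) (z : Ch (tup V)) :
    chMap (tupMap φ) (sdHtpy β z) = sdHtpy γ (chMap (tupMap φ) z) := by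
  have : chMap (tupMap φ) ∘ₗ sdHtpy β = sdHtpy γ ∘ₗ chMap (tupMap φ) := by
    refine bd_tupCh_induction (fun w => ?_) fun m w ih => ?_
    · rw [LinearMap.comp_apply, LinearMap.comp_apply, sdHtpy_tupCh_zero, chMap_tupCh,
        sdHtpy_tupCh_zero, map_zero]
    · simp only [LinearMap.comp_apply] at ih ⊢
      rw [sdHtpy_tupCh_succ, chMap_tupCone, map_sub, ih, chMap_tupCh, sdHtpy_tupCh_succ, hφ,
        chMap_bd, chMap_tupCh]
  exact LinearMap.congr_fun this z

/-- An operator on chains of tuples maps a span of tuples to another span when it does so on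
generators. -/
theorem supported_induction {M : Type*} [AddCommGroup M] {S : Set (Simp (tup V))}
    (N : Submodule ℤ M) (f : Ch (tup V) →ₗ[ℤ] M)
    (h : ∀ m (w : Fin (m + 1) → V), (⟨m, w⟩ : Simp (tup V)) ∈ S → f (tupCh w) ∈ N) :
    ∀ z ∈ Finsupp.supported ℤ ℤ S, f z ∈ N := by
  intro z hz
  have : Finsupp.supported ℤ ℤ S ≤ N.comap f := by
    rw [Finsupp.supported_eq_span_single, Submodule.span_le]
    rintro _ ⟨⟨m, x⟩, hx, rfl⟩
    exact h m x hx
  exact this hz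

end Tuples

end SpinPin

namespace SpinPin

/-! ### Affine simplices -/

/-- The points of the topological simplex. -/
abbrev Pt (n : ℕ) : Type u := ULift.{u} (stdSimplex ℝ (Fin (n + 1)))

section Affine
variable {n m l : ℕ}

theorem map_apply (α : Fin (l + 1) → Fin (m + 1)) (t : stdSimplex ℝ (Fin (l + 1)))
    (j : Fin (m + 1)) : stdSimplex.map α t j = ∑ i with α i = j, t i := by
  rw [stdSimplex.map_coe, FunOnFinite.linearMap_apply_apply]

/-- The convex combination of points of a simplex. -/
noncomputable def comb (w : Fin (m + 1) → Pt.{u} n) (t : stdSimplex ℝ (Fin (m + 1))) :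
    stdSimplex ℝ (Fin (n + 1)) :=
  ⟨∑ i, t i • (w i).down.1, convex_stdSimplex ℝ _ |>.sum_mem (fun i _ => t.2.1 i) t.2.2
    fun i _ => (w i).down.2⟩

theorem comb_apply (w : Fin (m + 1) → Pt.{u} n) (t : stdSimplex ℝ (Fin (m + 1)))
    (j : Fin (n + 1)) : comb w t j = ∑ i, t i * (w i).down j := by
  change (∑ i, t i • (w i).down.1) j = _
  rw [Finset.sum_apply]
  rfl

theorem continuous_comb (w : Fin (m + 1) → Pt.{u} n) : Continuous (comb w) := by
  refine Continuous.subtype_mk ?_ _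
  refine continuous_finsetSum _ fun i _ => ?_
  exact Continuous.smul ((continuous_apply i).comp continuous_subtype_val) continuous_const

theorem comb_comp (w : Fin (m + 1) → Pt.{u} n) (v : Fin (l + 1) → Pt.{u} m)
    (t : stdSimplex ℝ (Fin (l + 1))) :
    comb (fun i => ULift.up (comb w (v i).down)) t = comb w (comb v t) := by
  refine stdSimplex.ext (funext fun j => ?_)
  rw [comb_apply, comb_apply]
  simp only [comb_apply, Finset.mul_sum, Finset.sum_mul]
  rw [Finset.sum_comm]
  refine Finset.sum_congr rfl fun i _ => Finset.sum_congr rfl fun k _ => ?_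
  ring

theorem comb_map (w : Fin (m + 1) → Pt.{u} n) (α : Fin (l + 1) → Fin (m + 1))
    (t : stdSimplex ℝ (Fin (l + 1))) : comb (w ∘ α) t = comb w (stdSimplex.map α t) := by
  refine stdSimplex.ext (funext fun j => ?_)
  rw [comb_apply, comb_apply]
  simp only [map_apply, Finset.sum_mul, Function.comp_apply]
  rw [Finset.sum_sigma']
  refine Finset.sum_bij' (fun i _ => ⟨α i, i⟩) (fun p _ => p.2) ?_ ?_ ?_ ?_ ?_ <;> aesop

/-- The tuple of the vertices of the topological simplex. -/
noncomputable def vertices (n : ℕ) : Fin (n + 1) → Pt.{u} n := fun i => ⟨stdSimplex.vertex i⟩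

theorem comb_vertices (t : stdSimplex ℝ (Fin (n + 1))) : comb (vertices.{u} n) t = t := by
  refine stdSimplex.ext (funext fun j => ?_)
  rw [comb_apply]
  simp [vertices, Pi.single_apply]

theorem comb_vertex (w : Fin (m + 1) → Pt.{u} n) (i : Fin (m + 1)) :
    comb w (stdSimplex.vertex i) = (w i).down := by
  refine stdSimplex.ext (funext fun j => ?_)
  rw [comb_apply]
  simp [Pi.single_apply]

/-- The barycenter of a tuple of points. -/
noncomputable def bary (n m : ℕ) (w : Fin (m + 1) → Pt.{u} n) : Pt.{u} n :=
  ⟨comb w stdSimplex.barycenter⟩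

/-- The affine map determined by a tuple. -/
noncomputable def affMap (w : Fin (m + 1) → Pt.{u} n) (p : Pt.{u} m) : Pt.{u} n := ⟨comb w p.down⟩

/-- Affine maps preserve barycenters; this is the hypothesis of `chMap_sd` and makes subdivision
natural. -/
theorem affMap_bary (w : Fin (m + 1) → Pt.{u} n) (l : ℕ) (v : Fin (l + 1) → Pt.{u} m) :
    affMap w (bary m l v) = bary n l (affMap w ∘ v) :=
  congrArg ULift.up (comb_comp w v _).symm

theorem affMap_vertices (w : Fin (m + 1) → Pt.{u} n) : affMap w ∘ vertices.{u} m = w :=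
  funext fun i => congrArg ULift.up (comb_vertex w i)

variable {T : TopCat.{u}}

/-- The singular simplex obtained from `s` by an affine reparametrization. -/
noncomputable def reparam (s : (TopCat.toSSet.obj T) _⦋n⦌) (w : Fin (m + 1) → Pt.{u} n) :
    (TopCat.toSSet.obj T) _⦋m⦌ :=
  (T.toSSetObjEquiv (op ⦋m⦌)).symm ((T.toSSetObjEquiv (op ⦋n⦌) s).comp ⟨comb w, continuous_comb w⟩)

theorem sing_ext {s t : (TopCat.toSSet.obj T) _⦋n⦌}
    (h : ∀ x, T.toSSetObjEquiv (op ⦋n⦌) s x = T.toSSetObjEquiv (op ⦋n⦌) t x) : s = t :=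
  (T.toSSetObjEquiv (op ⦋n⦌)).injective (ContinuousMap.ext h)

/-- The simplicial map from the tuples of points of a simplex that a singular simplex
determines. -/
noncomputable def singTup (s : (TopCat.toSSet.obj T) _⦋n⦌) : tup (Pt.{u} n) ⟶ TopCat.toSSet.obj T where
  app k := ↾fun w => reparam s (m := k.unop.len) w
  naturality k l α := by
    ext w
    refine sing_ext (n := l.unop.len) fun t => ?_
    exact congrArg (T.toSSetObjEquiv (op ⦋n⦌) s) (comb_map (m := k.unop.len) (l := l.unop.len) w α.unop.toOrderHom t)

theorem singTup_vertices (s : (TopCat.toSSet.obj T) _⦋n⦌) :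
    chMap (singTup s) (tupCh (vertices n)) = Finsupp.single ⟨n, s⟩ 1 := by
  refine (chMap_single (singTup s) (x := vertices n) 1).trans ?_
  congr 2
  refine sing_ext fun t => ?_
  exact congrArg (T.toSSetObjEquiv (op ⦋n⦌) s) (comb_vertices.{u} t)

theorem singTup_reparam (s : (TopCat.toSSet.obj T) _⦋n⦌) (w : Fin (m + 1) → Pt.{u} n) :
    singTup (reparam s w) = tupMap (affMap w) ≫ singTup s := by
  ext k v
  refine sing_ext (n := k.unop.len) fun t => ?_
  exact congrArg (T.toSSetObjEquiv (op ⦋n⦌) s) (comb_comp.{u, u} w v t).symm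

theorem singTup_tupCh (s : (TopCat.toSSet.obj T) _⦋n⦌) (w : Fin (m + 1) → Pt.{u} n) :
    chMap (singTup s) (tupCh w) = Finsupp.single ⟨m, reparam s w⟩ 1 := chMap_single _ _ _

/-- The subdivision of singular chains. -/
noncomputable def Sd (T : TopCat.{u}) : Ch (TopCat.toSSet.obj T) →ₗ[ℤ] Ch (TopCat.toSSet.obj T) :=
  Finsupp.linearCombination ℤ
    (fun s => chMap (singTup s.2) (sd (bary s.1) (tupCh (vertices s.1))))

/-- The homotopy from the identity to the subdivision of singular chains. -/
noncomputable def SdHtpy (T : TopCat.{u}) :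
    Ch (TopCat.toSSet.obj T) →ₗ[ℤ] Ch (TopCat.toSSet.obj T) :=
  Finsupp.linearCombination ℤ
    (fun s => chMap (singTup s.2) (sdHtpy (bary s.1) (tupCh (vertices s.1))))

/-- Subdividing a singular simplex that is an affine reparametrization of `s` is the same as
subdividing the tuple of its vertices inside the domain of `s`. Since every singular simplex is the
image of its vertex tuple, identities on tuples pass to singular chains. -/
theorem Sd_chMap (s : (TopCat.toSSet.obj T) _⦋n⦌) (z : Ch (tup (Pt.{u} n))) :
    Sd T (chMap (singTup s) z) = chMap (singTup s) (sd (bary n) z) := by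
  have : Sd T ∘ₗ chMap (singTup s) = chMap (singTup s) ∘ₗ sd (bary n) := by
    refine tup_hom_ext fun m w => ?_
    rw [LinearMap.comp_apply, LinearMap.comp_apply, singTup_tupCh, Sd,
      Finsupp.linearCombination_single, one_smul, singTup_reparam, chMap_comp,
      LinearMap.comp_apply, chMap_sd _ (bary n) _ (fun l v => affMap_bary w l v), chMap_tupCh,
      affMap_vertices]
  exact LinearMap.congr_fun this z

theorem SdHtpy_chMap (s : (TopCat.toSSet.obj T) _⦋n⦌) (z : Ch (tup (Pt.{u} n))) :
    SdHtpy T (chMap (singTup s) z) = chMap (singTup s) (sdHtpy (bary n) z) := by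
  have : SdHtpy T ∘ₗ chMap (singTup s) = chMap (singTup s) ∘ₗ sdHtpy (bary n) := by
    refine tup_hom_ext fun m w => ?_
    rw [LinearMap.comp_apply, LinearMap.comp_apply, singTup_tupCh, SdHtpy,
      Finsupp.linearCombination_single, one_smul, singTup_reparam, chMap_comp,
      LinearMap.comp_apply, chMap_sdHtpy _ (bary n) _ (fun l v => affMap_bary w l v), chMap_tupCh,
      affMap_vertices]
  exact LinearMap.congr_fun this z

theorem bd_Sd (z : Ch (TopCat.toSSet.obj T)) : bd (Sd T z) = Sd T (bd z) := by
  have : bd ∘ₗ Sd T = Sd T ∘ₗ bd := by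
    refine Ch.hom_ext fun m s => ?_
    rw [LinearMap.comp_apply, LinearMap.comp_apply, ← singTup_vertices, Sd_chMap, ← chMap_bd,
      bd_sd, ← chMap_bd, Sd_chMap]
  exact LinearMap.congr_fun this z

theorem bd_SdHtpy (z : Ch (TopCat.toSSet.obj T)) :
    bd (SdHtpy T z) + SdHtpy T (bd z) = z - Sd T z := by
  have : bd ∘ₗ SdHtpy T + SdHtpy T ∘ₗ bd = LinearMap.id - Sd T := by
    refine Ch.hom_ext fun m s => ?_
    rw [LinearMap.add_apply, LinearMap.sub_apply, LinearMap.comp_apply, LinearMap.comp_apply,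
      ← singTup_vertices, SdHtpy_chMap, Sd_chMap, ← chMap_bd, ← chMap_bd, SdHtpy_chMap, ← map_add,
      bd_sdHtpy, map_sub]
    rfl
  exact LinearMap.congr_fun this z

/-- The singular simplices whose image lies in a set. -/
def carried (A : Set T) : (TopCat.toSSet.obj T).Subcomplex where
  obj k := Set.ofPred fun s => ∀ t, T.toSSetObjEquiv k s t ∈ A
  map α _ hs t := hs (stdSimplex.map α.unop t)

theorem mem_carried {A : Set T} {s : (TopCat.toSSet.obj T) _⦋n⦌} :
    s ∈ (carried A).obj (op ⦋n⦌) ↔ ∀ t, T.toSSetObjEquiv (op ⦋n⦌) s t ∈ A := Iff.rfl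

theorem chMap_singTup_mem {A : Set T} {s : (TopCat.toSSet.obj T) _⦋n⦌}
    (hs : s ∈ (carried A).obj (op ⦋n⦌)) (z : Ch (tup (Pt.{u} n))) :
    chMap (singTup s) z ∈ subCh (carried A) := by
  refine supported_induction (S := Set.univ) (subCh (carried A)) (chMap (singTup s))
    (fun m w _ => ?_) z (by simp)
  rw [singTup_tupCh]
  exact single_mem_subCh (mem_carried.2 fun t => hs (comb w t)) 1

theorem Sd_mem {A : Set T} : ∀ z ∈ subCh (carried A), Sd T z ∈ subCh (carried A) := by
  refine subCh_induction _ _ fun m s hs => ?_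
  rw [← singTup_vertices, Sd_chMap]
  exact chMap_singTup_mem hs _

theorem SdHtpy_mem {A : Set T} : ∀ z ∈ subCh (carried A), SdHtpy T z ∈ subCh (carried A) := by
  refine subCh_induction _ _ fun m s hs => ?_
  rw [← singTup_vertices, SdHtpy_chMap]
  exact chMap_singTup_mem hs _

end Affine

end SpinPin

namespace SpinPin

/-! ### Small simplices -/

section Mesh
variable {n m : ℕ}

/-- Closed balls are convex. -/
theorem dist_comb_le (w : Fin (m + 1) → Pt.{u} n) (t : stdSimplex ℝ (Fin (m + 1)))
    {c : stdSimplex ℝ (Fin (n + 1))} {r : ℝ} (h : ∀ j, dist (w j).down c ≤ r) :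
    dist (comb w t) c ≤ r := by
  have := (convex_closedBall c.1 r).sum_mem (t := Finset.univ) (w := fun i => t i)
    (z := fun i => (w i).down.1) (fun i _ => t.2.1 i) t.2.2 fun i _ => h i
  exact this

/-- The barycenter minus the `j`-th point is the average of `m + 1` differences, one of which is
zero; this gives the contraction factor `m / (m + 1)`. -/
theorem dist_bary_le (w : Fin (m + 1) → Pt.{u} n) {ε : ℝ}
    (h : ∀ i j, dist (w i).down (w j).down ≤ ε) (j : Fin (m + 1)) :
    dist (bary n m w).down (w j).down ≤ m / (m + 1) * ε := by
  change dist (∑ i, (stdSimplex.barycenter (𝕜 := ℝ) i) • (w i).down.1) (w j).down.1 ≤ _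
  have e : (∑ i, (stdSimplex.barycenter (𝕜 := ℝ) i) • (w i).down.1) - (w j).down.1 =
      ∑ i, (m + 1 : ℝ)⁻¹ • ((w i).down.1 - (w j).down.1) := by
    simp only [smul_sub, Finset.sum_sub_distrib, Finset.sum_const, Finset.card_univ,
      Fintype.card_fin]
    congr 1
    · refine Finset.sum_congr rfl fun i _ => ?_
      have : stdSimplex.barycenter (𝕜 := ℝ) i = (Fintype.card (Fin (m + 1)) : ℝ)⁻¹ :=
        stdSimplex.barycenter_apply i
      rw [this, Fintype.card_fin]
      push_cast
      rfl
    · rw [← Nat.cast_smul_eq_nsmul ℝ, smul_smul]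
      push_cast
      rw [mul_inv_cancel₀ (by positivity), one_smul]
  rw [dist_eq_norm, e]
  refine (norm_sum_le _ _).trans ?_
  rw [← Finset.add_sum_erase _ _ (Finset.mem_univ j), sub_self, smul_zero, norm_zero, zero_add]
  refine (Finset.sum_le_card_nsmul _ _ ((m + 1 : ℝ)⁻¹ * ε) fun i _ => ?_).trans ?_
  · rw [norm_smul, Real.norm_of_nonneg (by positivity)]
    refine mul_le_mul_of_nonneg_left ?_ (by positivity)
    rw [← dist_eq_norm]
    exact h i j
  · rw [Finset.card_erase_of_mem (Finset.mem_univ j), Finset.card_univ, Fintype.card_fin,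
      Nat.add_sub_cancel, nsmul_eq_mul]
    apply le_of_eq
    ring

/-- Tuples of diameter at most `ε` that lie in all the balls containing `w`. -/
def fineIn (w : Fin (m + 1) → Pt.{u} n) (ε : ℝ) : Set (Simp (tup (Pt.{u} n))) :=
  Set.ofPred fun s => s.1 = m ∧ (∀ i j, dist (s.2 i).down (s.2 j).down ≤ ε) ∧
    ∀ c r, (∀ j, dist (w j).down c ≤ r) → ∀ i, dist (s.2 i).down c ≤ r

/-- The condition on balls in `fineIn` stands in for the convex hull. Applied to the ball around the
barycenter that contains `w`, it bounds the distance from the new apex to all vertices of the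
subdivided faces; the other distances are bounded by induction, as the factor grows with `m`. -/
theorem sd_mem_fineIn (w : Fin (m + 1) → Pt.{u} n) {ε : ℝ}
    (h : ∀ i j, dist (w i).down (w j).down ≤ ε) :
    sd (bary n) (tupCh w) ∈ Finsupp.supported ℤ ℤ (fineIn w (m / (m + 1) * ε)) := by
  have hε : 0 ≤ ε := dist_nonneg.trans (h 0 0)
  induction m with
  | zero =>
    rw [sd_tupCh_zero]
    refine Finsupp.single_mem_supported ℤ _ ⟨rfl, fun i j => ?_, fun c r hc i => hc i⟩
    obtain rfl : i = j := Subsingleton.elim (α := Fin 1) i j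
    simp
  | succ m ih =>
    rw [sd_tupCh_succ, bd_tupCh_succ, map_sum, map_sum]
    refine sum_mem fun i _ => ?_
    rw [map_smul, map_smul]
    refine Submodule.smul_mem _ _ ?_
    refine supported_induction _ _ ?_ _ (ih (w ∘ i.succAbove) (fun j k => h _ _))
    rintro k v ⟨rfl : k = m, hv₁, hv₂⟩
    rw [tupCone_tupCh]
    have hle : (k : ℝ) / (k + 1) * ε ≤ ((k + 1 : ℕ) : ℝ) / ((k + 1 : ℕ) + 1) * ε := by
      refine mul_le_mul_of_nonneg_right ?_ hε
      rw [div_le_div_iff₀ (by positivity) (by positivity)]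
      push_cast
      nlinarith
    have hb : ∀ j, dist (v j).down (bary n (k + 1) w).down ≤
        ((k + 1 : ℕ) : ℝ) / ((k + 1 : ℕ) + 1) * ε := fun j =>
      hv₂ _ _ (fun j => by rw [dist_comm]; exact dist_bary_le w h _) j
    refine Finsupp.single_mem_supported ℤ _ ⟨rfl, ?_, ?_⟩
    · have h0 : (0 : ℝ) ≤ ((k + 1 : ℕ) : ℝ) / ((k + 1 : ℕ) + 1) * ε := by positivity
      refine Fin.cases (Fin.cases ?_ fun j => ?_) (fun i => Fin.cases ?_ fun j => ?_)
      · simpa using h0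
      · rw [dist_comm]; exact hb j
      · exact hb i
      · exact (hv₁ i j).trans hle
    · intro c r hc
      refine Fin.cases ?_ fun j => ?_
      · exact dist_comb_le w _ hc
      · exact hv₂ c r (fun j => hc _) j

/-- Tuples of dimension at most `d` and of diameter at most `ε`. -/
def fine (n d : ℕ) (ε : ℝ) : Set (Simp (tup (Pt.{u} n))) :=
  Set.ofPred fun s => s.1 ≤ d ∧ ∀ i j, dist (s.2 i).down (s.2 j).down ≤ ε

/-- Subdivision preserves dimension, so the single factor `d / (d + 1)` serves all tuples of
dimension at most `d` and can be iterated. -/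
theorem sd_mem_fine {d : ℕ} {ε : ℝ} : ∀ z ∈ Finsupp.supported ℤ ℤ (fine.{u} n d ε),
    sd (bary n) z ∈ Finsupp.supported ℤ ℤ (fine.{u} n d (d / (d + 1) * ε)) := by
  refine supported_induction _ _ ?_
  rintro m w ⟨hm : m ≤ d, hw⟩
  refine Finsupp.supported_mono ?_ (sd_mem_fineIn w hw)
  rintro ⟨k, v⟩ ⟨rfl : k = m, hv, -⟩
  refine ⟨hm, fun i j => (hv i j).trans (mul_le_mul_of_nonneg_right ?_ (dist_nonneg.trans (hw 0 0)))⟩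
  rw [div_le_div_iff₀ (by positivity) (by positivity)]
  have : (k : ℝ) ≤ d := by exact_mod_cast hm
  nlinarith

theorem sd_pow_mem_fine {d : ℕ} {ε : ℝ} (k : ℕ) {z : Ch (tup (Pt.{u} n))}
    (hz : z ∈ Finsupp.supported ℤ ℤ (fine.{u} n d ε)) :
    (sd (bary n) ^ k) z ∈ Finsupp.supported ℤ ℤ (fine.{u} n d ((d / (d + 1)) ^ k * ε)) := by
  induction k with
  | zero => simpa using hz
  | succ k ih =>
    rw [pow_succ', pow_succ', mul_assoc]
    exact sd_mem_fine _ ih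

theorem vertices_mem_fine (n : ℕ) :
    tupCh (vertices.{u} n) ∈ Finsupp.supported ℤ ℤ (fine.{u} n n 2) := by
  refine Finsupp.single_mem_supported ℤ _ ⟨le_rfl, fun i j => ?_⟩
  -- Every point of the simplex is within `1` of the origin, whence the diameter bound `2`.
  have h : ∀ x : stdSimplex ℝ (Fin (n + 1)), dist x.1 0 ≤ 1 := fun x =>
    stdSimplex_subset_closedBall x.2
  refine (dist_triangle_right _ _ (0 : Fin (n + 1) → ℝ)).trans ?_
  have := add_le_add (h (vertices n i).down) (h (vertices n j).down)
  linarith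

variable {T : TopCat.{u}}

theorem Sd_pow_chMap (s : (TopCat.toSSet.obj T) _⦋n⦌) (k : ℕ) (z : Ch (tup (Pt.{u} n))) :
    (Sd T ^ k) (chMap (singTup s) z) = chMap (singTup s) ((sd (bary n) ^ k) z) := by
  induction k with
  | zero => rfl
  | succ k ih =>
    rw [pow_succ', pow_succ', Module.End.mul_apply, ih, Sd_chMap]
    rfl

theorem Sd_pow_mem {A : Set T} (k : ℕ) : ∀ z ∈ subCh (carried A), (Sd T ^ k) z ∈ subCh (carried A) := by
  induction k with
  | zero => exact fun z hz => hz
  | succ k ih =>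
    intro z hz
    rw [pow_succ', Module.End.mul_apply]
    exact Sd_mem _ (ih z hz)

theorem bd_Sd_pow (k : ℕ) (z : Ch (TopCat.toSSet.obj T)) :
    bd ((Sd T ^ k) z) = (Sd T ^ k) (bd z) := by
  induction k with
  | zero => rfl
  | succ k ih => rw [pow_succ', Module.End.mul_apply, bd_Sd, ih]; rfl

/-- The homotopies telescope: one step adds `SdHtpy T` applied to the `k`-fold subdivision. A single
`D` respects all subsets at once, as excision uses it for both members of the cover. -/
theorem exists_Sd_pow_htpy (T : TopCat.{u}) (k : ℕ) :
    ∃ D : Ch (TopCat.toSSet.obj T) →ₗ[ℤ] Ch (TopCat.toSSet.obj T),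
      (∀ A : Set T, ∀ z ∈ subCh (carried A), D z ∈ subCh (carried A)) ∧
      ∀ z, bd (D z) + D (bd z) = z - (Sd T ^ k) z := by
  induction k with
  | zero => exact ⟨0, fun A z _ => zero_mem _, fun z => by simp⟩
  | succ k ih =>
    obtain ⟨D, hD₁, hD₂⟩ := ih
    refine ⟨D + SdHtpy T ∘ₗ (Sd T ^ k), fun A z hz => ?_, fun z => ?_⟩
    · exact add_mem (hD₁ A z hz) (SdHtpy_mem _ (Sd_pow_mem k z hz))
    · have h := bd_SdHtpy ((Sd T ^ k) z)
      rw [bd_Sd_pow] at h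
      rw [pow_succ', Module.End.mul_apply]
      simp only [LinearMap.add_apply, LinearMap.comp_apply, map_add]
      linear_combination (norm := abel) hD₂ z + h

/-- Lebesgue's number lemma for the pulled-back cover of the compact simplex: once the pieces of the
subdivision have diameter below the Lebesgue number, each lies in one of the two sets. -/
theorem exists_Sd_pow_simplex {U V : Set T} (hU : IsOpen U) (hV : IsOpen V) (hUV : U ∪ V = Set.univ)
    (s : (TopCat.toSSet.obj T) _⦋n⦌) :
    ∃ k, (Sd T ^ k) (Finsupp.single ⟨n, s⟩ 1) ∈ subCh (carried U) ⊔ subCh (carried V) := by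
  let σ : C(stdSimplex ℝ (Fin (n + 1)), T) := T.toSSetObjEquiv (op ⦋n⦌) s
  obtain ⟨δ, hδ, hball⟩ := lebesgue_number_lemma_of_metric (s := Set.univ)
    (c := fun b : Bool => σ ⁻¹' (if b then U else V)) isCompact_univ
    (fun b => by
      cases b
      · exact hV.preimage σ.continuous
      · exact hU.preimage σ.continuous)
    (fun x _ => by
      rw [Set.mem_iUnion]
      rcases (hUV ▸ Set.mem_univ (σ x) : σ x ∈ U ∪ V) with h | h
      · exact ⟨true, h⟩
      · exact ⟨false, h⟩)
  have hlt : (n : ℝ) / (n + 1) < 1 := by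
    rw [div_lt_one (by positivity)]
    linarith
  -- The half compensates for the initial diameter bound `2`.
  obtain ⟨k, hk⟩ := exists_pow_lt_of_lt_one (show 0 < δ / 2 by positivity) hlt
  refine ⟨k, ?_⟩
  rw [← singTup_vertices, Sd_pow_chMap]
  refine supported_induction _ _ ?_ _ (sd_pow_mem_fine k (vertices_mem_fine n))
  rintro m w ⟨-, hw⟩
  rw [singTup_tupCh]
  obtain ⟨b, hb⟩ := hball (w 0).down trivial
  have hmem : ∀ t, comb w t ∈ σ ⁻¹' (if b then U else V) := by
    intro t
    refine hb ?_
    rw [Metric.mem_ball]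
    refine (dist_comb_le w t (fun j => hw j 0)).trans_lt ?_
    linarith
  cases b
  · exact Submodule.mem_sup_right (single_mem_subCh (mem_carried.2 hmem) 1)
  · exact Submodule.mem_sup_left (single_mem_subCh (mem_carried.2 hmem) 1)

/-- Iterated subdivision makes every chain small with respect to an open cover. -/
theorem exists_Sd_pow {U V : Set T} (hU : IsOpen U) (hV : IsOpen V) (hUV : U ∪ V = Set.univ)
    (z : Ch (TopCat.toSSet.obj T)) :
    ∃ k, (Sd T ^ k) z ∈ subCh (carried U) ⊔ subCh (carried V) := by
  have hst : ∀ j, ∀ z ∈ subCh (carried U) ⊔ subCh (carried V),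
      (Sd T ^ j) z ∈ subCh (carried U) ⊔ subCh (carried V) := by
    intro j z hz
    obtain ⟨a, ha, b, hb, rfl⟩ := Submodule.mem_sup.1 hz
    rw [map_add]
    exact Submodule.add_mem_sup (Sd_pow_mem j a ha) (Sd_pow_mem j b hb)
  -- Small chains stay small under further subdivision, so the maximum of two exponents works for a
  -- sum.
  have hmono : ∀ k l z, k ≤ l → (Sd T ^ k) z ∈ subCh (carried U) ⊔ subCh (carried V) →
      (Sd T ^ l) z ∈ subCh (carried U) ⊔ subCh (carried V) := by
    intro k l z hkl hz
    obtain ⟨j, rfl⟩ := Nat.exists_eq_add_of_le' hkl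
    rw [pow_add, Module.End.mul_apply]
    exact hst j _ hz
  induction z using Finsupp.induction_linear with
  | zero => exact ⟨0, by simp⟩
  | add x y hx hy =>
    obtain ⟨k, hk⟩ := hx
    obtain ⟨l, hl⟩ := hy
    refine ⟨max k l, ?_⟩
    rw [map_add]
    exact add_mem (hmono _ _ _ (le_max_left k l) hk) (hmono _ _ _ (le_max_right k l) hl)
  | single s a =>
    obtain ⟨n, s⟩ := s
    obtain ⟨k, hk⟩ := exists_Sd_pow_simplex hU hV hUV s
    refine ⟨k, ?_⟩
    rw [← mul_one a, ← smul_eq_mul, ← Finsupp.smul_single, map_smul]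
    exact Submodule.smul_mem _ _ hk

end Mesh

end SpinPin

namespace SpinPin

/-! ### Pairs of a space and a subset, and excision -/

section Subsets
variable {T T' : TopCat.{u}} {A : Set T} {A' : Set T'}

/-- The pair of a space and a subset. -/
abbrev setPair (A : Set T) : TopPair.{u} := TopPair.ofSubset (X := T) A

/-- A map of pairs of a space and a subset. -/
def setMap (f : C(T, T')) (h : Set.MapsTo f A A') : setPair A ⟶ setPair A' :=
  TopPair.ofHom (X := setPair A) (Y := setPair A') (TopCat.ofHom f)
    (TopCat.ofHom ⟨h.restrict, f.continuous.restrict h⟩) (by ext y; rfl)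

theorem setMap_homotopic {f g : C(T, T')} (hf : Set.MapsTo f A A') (hg : Set.MapsTo g A A')
    (F : f.Homotopy g) (hF : ∀ t x, x ∈ A → F (t, x) ∈ A') :
    TopPair.Homotopic (setMap f hf) (setMap g hg) :=
  ⟨{ fst := F
     snd :=
      { toFun := fun p => ⟨F (p.1, p.2.1), hF _ _ p.2.2⟩
        continuous_toFun := by fun_prop
        map_zero_left := fun x => Subtype.ext (F.map_zero_left x.1)
        map_one_left := fun x => Subtype.ext (F.map_one_left x.1) }
     w := by ext p; rfl }⟩

theorem singPair_setPair_Y (A : Set T) : (singPair (setPair A)).Y = carried A := by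
  ext k s
  constructor
  · rintro ⟨s, rfl⟩ t
    exact (TopCat.toSSetObjEquiv (TopCat.of A) k s t).2
  · intro hs
    refine ⟨(TopCat.toSSetObjEquiv (TopCat.of A) k).symm
      ⟨fun t => ⟨T.toSSetObjEquiv k s t, hs t⟩, by fun_prop⟩, ?_⟩
    exact (T.toSSetObjEquiv k).injective (ContinuousMap.ext fun t => rfl)

theorem chMap_mem_iff {X Y : SSet.{u}} (f : X ⟶ Y) (hf : ∀ m, Function.Injective (f.app (op ⦋m⦌)))
    {A : Y.Subcomplex} {B : X.Subcomplex} (h : ∀ m (x : X _⦋m⦌), f.app _ x ∈ A.obj _ ↔ x ∈ B.obj _)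
    (z : Ch X) : chMap f z ∈ subCh A ↔ z ∈ subCh B := by
  have hinj : Function.Injective (simpMap f) := by
    rintro ⟨m, x⟩ ⟨k, y⟩ h
    have h1 : m = k := congrArg Sigma.fst h
    subst h1
    exact congrArg (Sigma.mk m) (hf m (eq_of_heq (Sigma.mk.inj h).2))
  constructor
  · intro hz
    rw [subCh, Finsupp.mem_supported'] at hz ⊢
    rintro ⟨m, x⟩ hx
    rw [← Finsupp.mapDomain_apply hinj]
    exact hz _ fun h' => hx ((h m x).1 h')
  · refine subCh_induction _ _ (fun m x hx => ?_) z
    rw [chMap_single]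
    exact single_mem_subCh ((h m x).2 hx) 1

/-- Excision for an open cover by two sets. -/
theorem isQI_excision {U V : Set T} (hU : IsOpen U) (hV : IsOpen V) (hUV : U ∪ V = Set.univ) :
    IsQI (singMap (setMap (T := TopCat.of V) (A := Subtype.val ⁻¹' U) (A' := U)
      ⟨Subtype.val, continuous_subtype_val⟩ (fun _ h => h))) := by
  let i : TopCat.toSSet.obj (TopCat.of V) ⟶ TopCat.toSSet.obj T :=
    TopCat.toSSet.map (TopCat.ofHom ⟨Subtype.val, continuous_subtype_val⟩)
  have hi : ∀ m, Function.Injective (i.app (op ⦋m⦌)) := by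
    intro m s t h
    refine sing_ext fun x => Subtype.ext ?_
    exact congrArg (fun s => T.toSSetObjEquiv (op ⦋m⦌) s x) h
  have hV' : ∀ z, z ∈ subCh (carried V) ↔ ∃ y, chMap i y = z := by
    intro z
    have h : subCh (carried V) = LinearMap.range (chMap i) := by
      rw [← subCh_range, ← singPair_setPair_Y]
      rfl
    rw [h]
    exact Iff.rfl
  have hU' : ∀ y, chMap i y ∈ subCh (carried U) ↔
      y ∈ subCh (carried (T := TopCat.of V) (Subtype.val ⁻¹' U)) :=
    chMap_mem_iff i hi fun m x => Iff.rfl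
  unfold IsQI
  rw [singPair_setPair_Y, singPair_setPair_Y]
  change QI bd bd _ _ (chMap i)
  constructor
  · intro x z hx hxz
    obtain ⟨k, hk⟩ := exists_Sd_pow hU hV hUV z
    obtain ⟨D, hD₁, hD₂⟩ := exists_Sd_pow_htpy T k
    obtain ⟨a, ha, b, hb, hab⟩ := Submodule.mem_sup.1 hk
    have hxV : chMap i x ∈ subCh (carried V) := (hV' _).2 ⟨x, rfl⟩
    -- Writing the subdivided `z` as `a + b`, the difference of `i x` and the boundary of `b + D (i
    -- x)` is `D (∂ (i x)) + Sd^k (i x - ∂z) + ∂a`, and each term is carried by `U`.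
    obtain ⟨y, hy⟩ := (hV' (b + D (chMap i x))).1 (add_mem hb (hD₁ V _ hxV))
    refine ⟨y, (hU' _).1 ?_⟩
    rw [map_sub, chMap_bd, hy, map_add]
    have h1 := hD₂ (chMap i x)
    have h2 := hD₁ U _ ((hU' _).2 hx)
    rw [chMap_bd] at h2
    have h3 := Sd_pow_mem k _ hxz
    rw [map_sub, ← bd_Sd_pow, ← hab, map_add] at h3
    have h4 := add_mem (add_mem h2 h3) (bd_mem_subCh _ _ ha)
    convert h4 using 1
    linear_combination (norm := abel) -h1
  · intro z hz
    obtain ⟨k, hk⟩ := exists_Sd_pow hU hV hUV z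
    obtain ⟨D, hD₁, hD₂⟩ := exists_Sd_pow_htpy T k
    obtain ⟨a, ha, b, hb, hab⟩ := Submodule.mem_sup.1 hk
    obtain ⟨y, rfl⟩ := (hV' b).1 hb
    -- The part of the subdivided chain carried by `V` represents the class; `D` compares it with
    -- `z`, and the part carried by `U` is dropped.
    refine ⟨y, D z, (hU' _).1 ?_, ?_⟩
    · have h3 := sub_mem (Sd_pow_mem k _ hz) (bd_mem_subCh _ _ ha)
      rw [← bd_Sd_pow, ← hab, map_add, add_sub_cancel_left] at h3
      rwa [chMap_bd]
    · have h := add_mem ha (hD₁ U _ hz)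
      have e : z - chMap i y - bd (D z) = a + D (bd z) := by
        linear_combination (norm := abel) -hD₂ z - hab
      rw [e]
      exact h

end Subsets

end SpinPin

namespace SpinPin

/-! ### Points of the topological simplex -/

/-- The topological simplex. -/
abbrev Dx (m : ℕ) : Type := stdSimplex ℝ (Fin (m + 1))

section Simplex
variable {j k l m : ℕ}

/-- The map of topological simplices induced by a map in the simplex category. -/
noncomputable def dmap (α : ⦋k⦌ ⟶ ⦋m⦌) (t : Dx k) : Dx m :=
  stdSimplex.map (α.toOrderHom : Fin (k + 1) → Fin (m + 1)) t

theorem dmap_apply (α : ⦋k⦌ ⟶ ⦋m⦌) (t : Dx k) (i : Fin (m + 1)) :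
    dmap α t i = ∑ a with α.toOrderHom a = i, t a := map_apply _ t i

theorem continuous_dmap (α : ⦋k⦌ ⟶ ⦋m⦌) : Continuous (dmap α) := stdSimplex.continuous_map _

theorem dmap_comp (α : ⦋k⦌ ⟶ ⦋m⦌) (β : ⦋m⦌ ⟶ ⦋l⦌) (t : Dx k) :
    dmap (α ≫ β) t = dmap β (dmap α t) := by
  unfold dmap
  rw [stdSimplex.map_comp_apply]
  rfl

theorem dmap_id (t : Dx k) : dmap (𝟙 ⦋k⦌) t = t := stdSimplex.map_id_apply t

/-- All coordinates are positive. -/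
def IsInterior (t : Dx m) : Prop := ∀ i, 0 < t i

theorem IsInterior.dmap {α : ⦋k⦌ ⟶ ⦋m⦌} (hα : Epi α) {t : Dx k} (ht : IsInterior t) :
    IsInterior (dmap α t) := by
  intro i
  rw [SimplexCategory.epi_iff_surjective] at hα
  obtain ⟨a, ha⟩ := hα i
  rw [dmap_apply]
  exact Finset.sum_pos (fun a _ => ht a) ⟨a, by simpa using ha⟩

theorem dmap_mono_apply {α : ⦋k⦌ ⟶ ⦋m⦌} (hα : Mono α) (t : Dx k) (a : Fin (k + 1)) :
    dmap α t (α.toOrderHom a) = t a := by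
  rw [SimplexCategory.mono_iff_injective] at hα
  rw [dmap_apply, Finset.sum_eq_single a]
  · intro b hb hba
    exact (hba (hα (by simpa using hb))).elim
  · simp

theorem dmap_apply_eq_zero {α : ⦋k⦌ ⟶ ⦋m⦌} (t : Dx k) {i : Fin (m + 1)}
    (hi : ∀ a, α.toOrderHom a ≠ i) : dmap α t i = 0 := by
  rw [dmap_apply]
  exact Finset.sum_eq_zero fun a ha => (hi a (by simpa using ha)).elim

/-- The face is the one spanned by the vertices with nonzero coordinate. -/
theorem exists_interior (t : Dx m) : ∃ (j : ℕ) (α : ⦋j⦌ ⟶ ⦋m⦌) (u : Dx j),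
    Mono α ∧ IsInterior u ∧ dmap α u = t := by
  let S : Finset (Fin (m + 1)) := Finset.univ.filter fun i => t i ≠ 0
  have hS : S.Nonempty := by
    by_contra h
    rw [Finset.not_nonempty_iff_eq_empty] at h
    have h1 := t.2.2
    rw [Finset.sum_eq_zero] at h1
    · exact zero_ne_one h1
    · intro i _
      by_contra hi
      have : i ∈ S := Finset.mem_filter.2 ⟨Finset.mem_univ _, hi⟩
      simp [h] at this
  obtain ⟨j, hj⟩ : ∃ j, S.card = j + 1 := ⟨S.card - 1, by have := hS.card_pos; omega⟩
  let e := S.orderEmbOfFin hj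
  let α : ⦋j⦌ ⟶ ⦋m⦌ := SimplexCategory.mkHom e.toOrderHom
  have hα : Mono α := by
    rw [SimplexCategory.mono_iff_injective]
    exact e.injective
  have hmem : ∀ a, e a ∈ S := fun a => Finset.orderEmbOfFin_mem S hj a
  have hsum : ∑ a, t (e a) = 1 := by
    rw [← t.2.2]
    have h1 : ∑ i ∈ S, t i = ∑ i, t i := Finset.sum_filter_ne_zero _
    refine Eq.trans ?_ h1
    refine (Finset.sum_map Finset.univ e.toEmbedding (fun i => t i)).symm.trans ?_
    congr 1
    simp [e]
  refine ⟨j, α, ⟨fun a => t (e a), fun a => t.2.1 _, hsum⟩, hα, fun a => ?_, ?_⟩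
  · have h1 := hmem a
    have h2 : 0 ≤ t (e a) := t.2.1 (e a)
    simp only [S, Finset.mem_filter] at h1
    exact lt_of_le_of_ne h2 h1.2.symm
  · refine stdSimplex.ext (funext fun i => ?_)
    by_cases hi : i ∈ S
    · obtain ⟨a, rfl⟩ : ∃ a, e a = i := by
        have : i ∈ Set.range e := by rw [Finset.range_orderEmbOfFin]; exact hi
        exact this
      exact dmap_mono_apply hα _ a
    · rw [dmap_apply_eq_zero]
      · simp only [S, Finset.mem_filter, Finset.mem_univ, true_and, not_not] at hi
        exact hi.symm
      · intro a ha
        apply hi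
        rw [← ha]
        exact hmem a

/-- The support of the common image is the vertex set of the face in both presentations, and an
injective monotone map is determined by its range. -/
theorem dmap_injective_of_interior {j j' : ℕ} {α : ⦋j⦌ ⟶ ⦋m⦌} {α' : ⦋j'⦌ ⟶ ⦋m⦌} (hα : Mono α)
    (hα' : Mono α') {u : Dx j} {u' : Dx j'} (hu : IsInterior u) (hu' : IsInterior u')
    (h : dmap α u = dmap α' u') :
    ∃ e : j = j', α = eqToHom (by rw [e]) ≫ α' ∧ ∀ a, u a = u' (Fin.cast (by rw [e]) a) := by
  have key : ∀ {j : ℕ} {α : ⦋j⦌ ⟶ ⦋m⦌} (hα : Mono α) {u : Dx j} (hu : IsInterior u) i,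
      i ∈ Set.range α.toOrderHom ↔ dmap α u i ≠ 0 := by
    intro j α hα u hu i
    constructor
    · rintro ⟨a, rfl⟩
      rw [dmap_mono_apply hα]
      exact (hu a).ne'
    · intro h
      by_contra hi
      exact h (dmap_apply_eq_zero u fun a ha => hi ⟨a, ha⟩)
  have hr : Set.range α.toOrderHom = Set.range α'.toOrderHom := by
    ext i
    rw [key hα hu, key hα' hu', h]
  have hi := SimplexCategory.mono_iff_injective.1 hα
  have hi' := SimplexCategory.mono_iff_injective.1 hα'
  have hj : j = j' := by
    have h1 := Set.ncard_range_of_injective hi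
    have h2 := Set.ncard_range_of_injective hi'
    have h3 := congrArg Set.ncard hr
    rw [h1, h2] at h3
    simpa using h3
  subst hj
  have hαα : α = α' := by
    ext1
    apply OrderHom.ext
    have s1 : StrictMono α.toOrderHom := α.toOrderHom.monotone.strictMono_of_injective hi
    have s2 : StrictMono α'.toOrderHom := α'.toOrderHom.monotone.strictMono_of_injective hi'
    exact (StrictMono.range_inj s1 s2).1 hr
  subst hαα
  refine ⟨rfl, by simp, fun a => ?_⟩
  rw [← dmap_mono_apply hα u a, h, dmap_mono_apply hα']
  rfl

theorem exists_epi_mono (α : ⦋k⦌ ⟶ ⦋m⦌) :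
    ∃ (j : ℕ) (σ : ⦋k⦌ ⟶ ⦋j⦌) (i : ⦋j⦌ ⟶ ⦋m⦌), Epi σ ∧ Mono i ∧ σ ≫ i = α :=
  ⟨(Limits.image α).len, Limits.factorThruImage α, Limits.image.ι α, inferInstance, inferInstance,
    Limits.image.fac α⟩

end Simplex

/-! ### Points of the realization -/

section Realization
variable {X X' : SSet.{u}} {j k l m : ℕ}

/-- The point of the realization in the simplex `x` with barycentric coordinates `t`. -/
noncomputable def pt (x : X _⦋m⦌) (t : Dx m) : SSet.toTop.obj X :=
  TopCat.toSSetObjEquiv (SSet.toTop.obj X) (op ⦋m⦌) ((sSetTopAdj.unit.app X).app (op ⦋m⦌) x) t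

theorem continuous_pt (x : X _⦋m⦌) : Continuous (pt x) :=
  (TopCat.toSSetObjEquiv (SSet.toTop.obj X) (op ⦋m⦌)
    ((sSetTopAdj.unit.app X).app (op ⦋m⦌) x)).continuous

theorem pt_map (α : ⦋k⦌ ⟶ ⦋m⦌) (x : X _⦋m⦌) (t : Dx k) :
    pt (X.map α.op x) t = pt x (dmap α t) := by
  have h := ConcreteCategory.congr_hom ((sSetTopAdj.unit.app X).naturality α.op) x
  exact congrArg (fun s => TopCat.toSSetObjEquiv (SSet.toTop.obj X) (op ⦋k⦌) s t) h

theorem map_pt (f : X ⟶ X') (x : X _⦋m⦌) (t : Dx m) :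
    SSet.toTop.map f (pt x t) = pt (f.app _ x) t := by
  have h := ConcreteCategory.congr_hom (NatTrans.congr_app (sSetTopAdj.unit.naturality f) (op ⦋m⦌)) x
  exact congrArg (fun s => TopCat.toSSetObjEquiv (SSet.toTop.obj X') (op ⦋m⦌) s t) h.symm

variable {Z : TopCat.{u}}

/-- The simplicial map to a singular complex determined by compatible continuous maps. -/
noncomputable def toSingOf (φ : ∀ m, X _⦋m⦌ → C(Dx m, Z))
    (hφ : ∀ {k m} (α : ⦋k⦌ ⟶ ⦋m⦌) (x : X _⦋m⦌) t, φ k (X.map α.op x) t = φ m x (dmap α t)) :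
    X ⟶ TopCat.toSSet.obj Z where
  app k := ↾fun x => (Z.toSSetObjEquiv k).symm (φ k.unop.len x)
  naturality k l α := by
    ext x
    refine (Z.toSSetObjEquiv l).injective (ContinuousMap.ext fun t => ?_)
    exact hφ (k := l.unop.len) (m := k.unop.len) α.unop x t

/-- The continuous map on the realization determined by compatible continuous maps. -/
noncomputable def descMap (φ : ∀ m, X _⦋m⦌ → C(Dx m, Z))
    (hφ : ∀ {k m} (α : ⦋k⦌ ⟶ ⦋m⦌) (x : X _⦋m⦌) t, φ k (X.map α.op x) t = φ m x (dmap α t)) :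
    SSet.toTop.obj X ⟶ Z :=
  (sSetTopAdj.homEquiv X Z).symm (toSingOf φ hφ)

theorem toSSet_map_pt (f : SSet.toTop.obj X ⟶ Z) (x : X _⦋m⦌) (t : Dx m) :
    f (pt x t) = Z.toSSetObjEquiv (op ⦋m⦌) ((sSetTopAdj.homEquiv X Z f).app (op ⦋m⦌) x) t := by
  rw [Adjunction.homEquiv_unit]
  rfl

theorem descMap_pt (φ : ∀ m, X _⦋m⦌ → C(Dx m, Z))
    (hφ : ∀ {k m} (α : ⦋k⦌ ⟶ ⦋m⦌) (x : X _⦋m⦌) t, φ k (X.map α.op x) t = φ m x (dmap α t))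
    (x : X _⦋m⦌) (t : Dx m) : descMap φ hφ (pt x t) = φ m x t := by
  rw [toSSet_map_pt, descMap, Equiv.apply_symm_apply]
  rfl

theorem real_hom_ext {f g : SSet.toTop.obj X ⟶ Z}
    (h : ∀ m (x : X _⦋m⦌) t, f (pt x t) = g (pt x t)) : f = g := by
  apply (sSetTopAdj.homEquiv X Z).injective
  ext k x
  refine (Z.toSSetObjEquiv k).injective (ContinuousMap.ext fun t => ?_)
  have := h k.unop.len x t
  rw [toSSet_map_pt, toSSet_map_pt] at this
  exact this

/-- Into an indiscrete space every function is continuous. The predicate of being such a point and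
the constant `True` agree on all simplices, hence are equal by the universal property. -/
theorem exists_pt (p : SSet.toTop.obj X) : ∃ (m : ℕ) (x : X _⦋m⦌) (t : Dx m), pt x t = p := by
  let Z : TopCat.{u} := @TopCat.of (ULift.{u} Prop) ⊤
  let f : SSet.toTop.obj X ⟶ Z := @TopCat.ofHom _ _ _ ⊤
    (@ContinuousMap.mk _ _ _ ⊤
      (fun p => ULift.up (∃ (m : ℕ) (x : X _⦋m⦌) (t : Dx m), pt x t = p)) continuous_top)
  let g : SSet.toTop.obj X ⟶ Z := @TopCat.ofHom _ _ _ ⊤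
    (@ContinuousMap.mk _ _ _ ⊤ (fun _ => ULift.up True) continuous_top)
  have h : f = g := real_hom_ext fun m x t =>
    congrArg ULift.up (eq_true ⟨m, x, t, rfl⟩)
  have := congrArg ULift.down (ConcreteCategory.congr_hom h p)
  exact of_eq_true this

/-- Open sets are continuous maps to the Sierpiński space `Prop`, and those glue along the simplices
by the universal property. -/
theorem isOpen_real_iff {U : Set (SSet.toTop.obj X)} :
    IsOpen U ↔ ∀ m (x : X _⦋m⦌), IsOpen (pt x ⁻¹' U) := by
  constructor
  · exact fun h m x => h.preimage (continuous_pt x)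
  · intro h
    let f : SSet.toTop.obj X ⟶ TopCat.of (ULift.{u} Prop) := descMap
      (fun m x => ⟨fun t => ULift.up (pt x t ∈ U),
        continuous_uliftUp.comp (isOpen_iff_continuous_mem.1 (h m x))⟩)
      (fun α x t => congrArg (fun p => ULift.up (p ∈ U)) (pt_map α x t))
    have hf : ∀ p, f p = ULift.up (p ∈ U) := by
      intro p
      obtain ⟨m, x, t, rfl⟩ := exists_pt p
      exact descMap_pt _ _ x t
    rw [isOpen_iff_continuous_mem]
    have hc : Continuous fun p => (f p).down := continuous_uliftDown.comp f.hom.continuous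
    simpa only [hf] using hc

/-! ### Normal forms -/

/-- `(y, s)` is the presentation of the point `pt x t` by an interior point of a nondegenerate
simplex. -/
def IsNF (x : X _⦋m⦌) (t : Dx m) (y : X _⦋k⦌) (s : Dx k) : Prop :=
  y ∈ X.nonDegenerate k ∧ ∃ (j : ℕ) (α : ⦋j⦌ ⟶ ⦋m⦌) (β : ⦋j⦌ ⟶ ⦋k⦌) (u : Dx j), Mono α ∧ Epi β ∧
    IsInterior u ∧ dmap α u = t ∧ dmap β u = s ∧ X.map α.op x = X.map β.op y

theorem IsNF.interior {x : X _⦋m⦌} {t : Dx m} {y : X _⦋k⦌} {s : Dx k} (h : IsNF x t y s) :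
    IsInterior s := by
  obtain ⟨-, j, α, β, u, -, hβ, hu, -, rfl, -⟩ := h
  exact hu.dmap hβ

theorem IsNF.pt_eq {x : X _⦋m⦌} {t : Dx m} {y : X _⦋k⦌} {s : Dx k} (h : IsNF x t y s) :
    pt x t = pt y s := by
  obtain ⟨-, j, α, β, u, -, -, -, rfl, rfl, e⟩ := h
  rw [← pt_map, ← pt_map, e]

theorem isNF_self {y : X _⦋k⦌} {s : Dx k} (hy : y ∈ X.nonDegenerate k) (hs : IsInterior s) :
    IsNF y s y s :=
  ⟨hy, k, 𝟙 _, 𝟙 _, s, inferInstance, inferInstance, hs, dmap_id s, dmap_id s, rfl⟩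

theorem exists_isNF (x : X _⦋m⦌) (t : Dx m) : ∃ (k : ℕ) (y : X _⦋k⦌) (s : Dx k), IsNF x t y s := by
  obtain ⟨j, α, u, hα, hu, rfl⟩ := exists_interior t
  obtain ⟨k, β, hβ, y, hy⟩ := X.exists_nonDegenerate (X.map α.op x)
  exact ⟨k, y, dmap β u, y.2, j, α, β, u, hα, hβ, hu, rfl, rfl, hy⟩

/-- The face containing the point in its interior is unique, and by the Eilenberg-Zilber lemma that
face is a degeneracy of a unique nondegenerate simplex in a unique way. -/
theorem IsNF.unique {x : X _⦋m⦌} {t : Dx m} {y : X _⦋k⦌} {s : Dx k} {y' : X _⦋l⦌} {s' : Dx l}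
    (h : IsNF x t y s) (h' : IsNF x t y' s') :
    (⟨k, y, s⟩ : Σ k : ℕ, X _⦋k⦌ × Dx k) = ⟨l, y', s'⟩ := by
  obtain ⟨hy, j, α, β, u, hα, hβ, hu, rfl, rfl, e⟩ := h
  obtain ⟨hy', j', α', β', u', hα', hβ', hu', ht, rfl, e'⟩ := h'
  obtain ⟨rfl, h1, h2⟩ := dmap_injective_of_interior hα' hα hu' hu ht
  simp only [eqToHom_refl, Category.id_comp] at h1
  subst h1
  obtain rfl : u' = u := stdSimplex.ext (funext h2)
  obtain rfl := X.unique_nonDegenerate_dim _ β ⟨y, hy⟩ e β' ⟨y', hy'⟩ e'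
  have h3 := X.unique_nonDegenerate_simplex _ β ⟨y, hy⟩ e β' ⟨y', hy'⟩ e'
  have h4 := X.unique_nonDegenerate_map _ β ⟨y, hy⟩ e β' ⟨y', hy'⟩ e'
  have h5 : y = y' := congrArg Subtype.val h3
  rw [h4, h5]

/-- Normal forms respect the identifications that define the realization. The composite of the face
inclusion with `α` is factored as an epimorphism followed by a monomorphism, and Eilenberg-Zilber
uniqueness identifies the two nondegenerate simplices. -/
theorem IsNF.of_map (α : ⦋l⦌ ⟶ ⦋m⦌) {x : X _⦋m⦌} {t : Dx l} {y : X _⦋k⦌} {s : Dx k}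
    (h : IsNF (X.map α.op x) t y s) : IsNF x (dmap α t) y s := by
  obtain ⟨hy, j, i, π, u, hi, hπ, hu, rfl, rfl, e⟩ := h
  obtain ⟨j', σ, i', hσ, hi', hc⟩ := exists_epi_mono (i ≫ α)
  obtain ⟨k', π', hπ', y', e'⟩ := X.exists_nonDegenerate (X.map i'.op x)
  have h1 : X.map (i ≫ α).op x = X.map (σ ≫ π').op y' := by
    rw [← hc, op_comp, op_comp, Functor.map_comp, Functor.map_comp, ConcreteCategory.comp_apply,
      ConcreteCategory.comp_apply, e']
  have h2 : X.map (i ≫ α).op x = X.map π.op y := by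
    rw [← e, op_comp, Functor.map_comp, ConcreteCategory.comp_apply]
  have : Epi (σ ≫ π') := epi_comp _ _
  obtain rfl := X.unique_nonDegenerate_dim _ (σ ≫ π') y' h1 π ⟨y, hy⟩ h2
  have h3 := X.unique_nonDegenerate_simplex _ (σ ≫ π') y' h1 π ⟨y, hy⟩ h2
  have h4 := X.unique_nonDegenerate_map _ (σ ≫ π') y' h1 π ⟨y, hy⟩ h2
  subst h3
  refine ⟨hy, j', i', π', dmap σ u, hi', hπ', hu.dmap hσ, ?_, ?_, e'⟩
  · rw [← dmap_comp, ← dmap_comp, hc]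
  · rw [← dmap_comp, h4]

/-- A presentation of a point by a nondegenerate simplex. -/
theorem exists_nf_fun (X : SSet.{u}) : ∃ N : SSet.toTop.obj X → Σ k : ℕ, X _⦋k⦌ × Dx k,
    ∀ m (x : X _⦋m⦌) (t : Dx m), IsNF x t (N (pt x t)).2.1 (N (pt x t)).2.2 := by
  choose K Y S h using fun (p : Σ m : ℕ, X _⦋m⦌ × Dx m) => exists_isNF p.2.1 p.2.2
  -- With the indiscrete topology on the target no continuity is needed, so the normal form descends
  -- to a function on the realization.
  let Z : TopCat.{u} := @TopCat.of (Σ k : ℕ, X _⦋k⦌ × Dx k) ⊤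
  let N : SSet.toTop.obj X ⟶ Z := descMap (fun m x => @ContinuousMap.mk _ _ _ ⊤
      (fun t => (⟨K ⟨m, x, t⟩, Y ⟨m, x, t⟩, S ⟨m, x, t⟩⟩ : Σ k : ℕ, X _⦋k⦌ × Dx k)) continuous_top)
    (fun α x t => (IsNF.of_map α (h ⟨_, X.map α.op x, t⟩)).unique (h ⟨_, x, dmap α t⟩))
  refine ⟨N, fun m x t => ?_⟩
  have hN : N (pt x t) = (⟨K ⟨m, x, t⟩, Y ⟨m, x, t⟩, S ⟨m, x, t⟩⟩ : Σ k : ℕ, X _⦋k⦌ × Dx k) :=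
    descMap_pt _ _ x t
  rw [hN]
  exact h ⟨m, x, t⟩

theorem exists_nf (p : SSet.toTop.obj X) : ∃ (k : ℕ) (y : X _⦋k⦌) (s : Dx k),
    y ∈ X.nonDegenerate k ∧ IsInterior s ∧ pt y s = p := by
  obtain ⟨m, x, t, rfl⟩ := exists_pt p
  obtain ⟨k, y, s, h⟩ := exists_isNF x t
  exact ⟨k, y, s, h.1, h.interior, h.pt_eq.symm⟩

/-- The normal form is a function of the point alone, and an interior point of a nondegenerate
simplex is its own normal form. -/
theorem isNF_of_pt_eq {x : X _⦋m⦌} {t : Dx m} {y : X _⦋k⦌} {s : Dx k} (hy : y ∈ X.nonDegenerate k)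
    (hs : IsInterior s) (h : pt x t = pt y s) : IsNF x t y s := by
  obtain ⟨N, hN⟩ := exists_nf_fun X
  have h1 := hN m x t
  have h2 := hN k y s
  have h3 := h2.unique (isNF_self hy hs)
  rw [h] at h1
  generalize N (pt y s) = z at h1 h3
  obtain ⟨k', y', s'⟩ := z
  obtain rfl : k' = k := congrArg Sigma.fst h3
  have h4 := eq_of_heq (Sigma.mk.inj h3).2
  obtain ⟨rfl, rfl⟩ := Prod.mk.inj h4
  exact h1

end Realization

end SpinPin

namespace SpinPin

/-! ### Subcomplexes and compact subsets of the realization -/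

section Subcomplexes
variable {X : SSet.{u}} {j k l m : ℕ}

/-- Epimorphisms of the simplex category split, so a simplex is a face of each of its degeneracies.
-/
theorem mem_of_epi_map {Y : X.Subcomplex} {β : ⦋j⦌ ⟶ ⦋k⦌} (hβ : Epi β) {y : X _⦋k⦌}
    (h : X.map β.op y ∈ Y.obj (op ⦋j⦌)) : y ∈ Y.obj (op ⦋k⦌) := by
  have : IsSplitEpi β := isSplitEpi_of_epi β
  have h1 : X.map (section_ β).op (X.map β.op y) = y := by
    rw [← ConcreteCategory.comp_apply, ← Functor.map_comp, ← op_comp, IsSplitEpi.id]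
    exact ConcreteCategory.congr_hom (X.map_id _) y
  rw [← h1]
  exact Y.map _ h

theorem IsNF.mem {Y : X.Subcomplex} {x : X _⦋m⦌} {t : Dx m} {y : X _⦋k⦌} {s : Dx k}
    (h : IsNF x t y s) (hx : x ∈ Y.obj (op ⦋m⦌)) : y ∈ Y.obj (op ⦋k⦌) := by
  obtain ⟨-, j, α, β, u, -, hβ, -, -, -, e⟩ := h
  refine mem_of_epi_map hβ ?_
  rw [← e]
  exact Y.map _ hx

theorem map_ι_pt (Y : X.Subcomplex) (y : (Y : SSet.{u}) _⦋k⦌) (s : Dx k) :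
    SSet.toTop.map Y.ι (pt y s) = pt (y.1 : X _⦋k⦌) s := map_pt Y.ι y s

/-- A point of the realization of a subcomplex. -/
noncomputable def ptIn (Y : X.Subcomplex) (y : X _⦋k⦌) (hy : y ∈ Y.obj (op ⦋k⦌)) (s : Dx k) :
    SSet.toTop.obj (Y : SSet.{u}) := pt (X := (Y : SSet.{u})) ⟨y, hy⟩ s

theorem continuous_ptIn (Y : X.Subcomplex) (y : X _⦋k⦌) (hy : y ∈ Y.obj (op ⦋k⦌)) :
    Continuous (ptIn Y y hy) := continuous_pt _

theorem map_ι_ptIn (Y : X.Subcomplex) (y : X _⦋k⦌) (hy : y ∈ Y.obj (op ⦋k⦌)) (s : Dx k) :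
    SSet.toTop.map Y.ι (ptIn Y y hy s) = pt y s := map_ι_pt Y ⟨y, hy⟩ s

theorem pt_mem_range (Y : X.Subcomplex) {y : X _⦋k⦌} (hy : y ∈ Y.obj (op ⦋k⦌)) (s : Dx k) :
    pt y s ∈ Set.range (SSet.toTop.map Y.ι) := ⟨ptIn Y y hy s, map_ι_ptIn Y y hy s⟩

theorem pt_mem_range_iff (Y : X.Subcomplex) {y : X _⦋k⦌} {s : Dx k} (hy : y ∈ X.nonDegenerate k)
    (hs : IsInterior s) : pt y s ∈ Set.range (SSet.toTop.map Y.ι) ↔ y ∈ Y.obj (op ⦋k⦌) := by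
  refine ⟨?_, fun h => pt_mem_range Y h s⟩
  rintro ⟨q, hq⟩
  obtain ⟨m, z, t, rfl⟩ := exists_pt q
  rw [map_ι_pt] at hq
  exact (isNF_of_pt_eq hy hs hq).mem z.2

theorem pt_injective_of_interior {y : X _⦋k⦌} {s : Dx k} {y' : X _⦋l⦌} {s' : Dx l}
    (hy : y ∈ X.nonDegenerate k) (hs : IsInterior s) (hy' : y' ∈ X.nonDegenerate l)
    (hs' : IsInterior s') (h : pt y s = pt y' s') :
    (⟨k, y, s⟩ : Σ k : ℕ, X _⦋k⦌ × Dx k) = ⟨l, y', s'⟩ :=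
  (isNF_self hy hs).unique (isNF_of_pt_eq hy' hs' h)

/-- A nondegenerate simplex of the subcomplex remains nondegenerate in `X`, so normal forms are
preserved. -/
theorem toTop_ι_injective (Y : X.Subcomplex) : Function.Injective (SSet.toTop.map Y.ι) := by
  intro p q h
  obtain ⟨k, y, s, hy, hs, rfl⟩ := exists_nf p
  obtain ⟨l, z, t, hz, ht, rfl⟩ := exists_nf q
  rw [map_ι_pt, map_ι_pt] at h
  have h1 := pt_injective_of_interior ((Y.mem_nonDegenerate_iff y).1 hy) hs
    ((Y.mem_nonDegenerate_iff z).1 hz) ht h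
  obtain rfl : k = l := congrArg Sigma.fst h1
  obtain ⟨h2, rfl⟩ := Prod.mk.inj (eq_of_heq (Sigma.mk.inj h1).2)
  rw [Subtype.ext h2]

theorem isClosed_real_iff {C : Set (SSet.toTop.obj X)} :
    IsClosed C ↔ ∀ m (x : X _⦋m⦌), IsClosed (pt x ⁻¹' C) := by
  simp only [← isOpen_compl_iff, isOpen_real_iff, Set.preimage_compl]

theorem le_of_mono {α : ⦋j⦌ ⟶ ⦋m⦌} (hα : Mono α) : j < m + 1 :=
  Nat.lt_succ_of_le (SimplexCategory.len_le_of_mono α)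

/-- In each simplex `x`, the preimage of the image of `C` is a union over the finitely many faces of
`x` in `Y` of images of closed sets of compact simplices. -/
theorem isClosedMap_toTop_ι (Y : X.Subcomplex) : IsClosedMap (SSet.toTop.map Y.ι) := by
  intro C hC
  refine isClosed_real_iff.2 fun m x => ?_
  have e : pt x ⁻¹' (SSet.toTop.map Y.ι '' C) = ⋃ (j : Fin (m + 1)) (α : ⦋(j : ℕ)⦌ ⟶ ⦋m⦌)
      (h : X.map α.op x ∈ Y.obj _), dmap α '' (ptIn Y (X.map α.op x) h ⁻¹' C) := by
    ext t
    simp only [Set.mem_iUnion]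
    constructor
    · rintro ⟨q, hq, hqt⟩
      obtain ⟨k, y, s, hy, hs, rfl⟩ := exists_nf q
      have hqt' : pt x t = pt (y.1 : X _⦋k⦌) s := hqt.symm.trans (map_ι_pt Y y s)
      have hN := isNF_of_pt_eq ((Y.mem_nonDegenerate_iff y).1 hy) hs hqt'
      obtain ⟨-, j, α, β, u, hα, -, -, rfl, -, e⟩ := hN
      have h : X.map α.op x ∈ Y.obj _ := by rw [e]; exact Y.map _ y.2
      refine ⟨⟨j, le_of_mono hα⟩, α, h, u, ?_, rfl⟩
      have h1 : ptIn Y (X.map α.op x) h u = pt y s := by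
        apply toTop_ι_injective Y
        exact ((map_ι_ptIn Y _ h u).trans (pt_map α x u)).trans hqt.symm
      rw [Set.mem_preimage, h1]
      exact hq
    · rintro ⟨j, α, h, u, hu, rfl⟩
      exact ⟨_, hu, (map_ι_ptIn Y _ h u).trans (pt_map α x u)⟩
  rw [e]
  refine isClosed_iUnion_of_finite fun j => isClosed_iUnion_of_finite fun α =>
    isClosed_iUnion_of_finite fun h => ?_
  exact ((hC.preimage (continuous_ptIn Y _ h)).isCompact.image (continuous_dmap α)).isClosed

theorem isClosedEmbedding_toTop_ι (Y : X.Subcomplex) :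
    Topology.IsClosedEmbedding (SSet.toTop.map Y.ι) :=
  .of_continuous_injective_isClosedMap (SSet.toTop.map Y.ι).hom.continuous (toTop_ι_injective Y)
    (isClosedMap_toTop_ι Y)

/-- A simplex has finitely many faces, each a degeneracy of one nondegenerate simplex, so the
preimage in it is a finite union of compact images of fibers. This yields the closed discrete sets
needed to show that compact sets meet finitely many cells. -/
theorem isClosed_of_cellwise {D : Set (SSet.toTop.obj X)}
    (hD : ∀ k (y : X _⦋k⦌), y ∈ X.nonDegenerate k → ∀ s s' : Dx k, IsInterior s → IsInterior s' →
      pt y s ∈ D → pt y s' ∈ D → s = s') : IsClosed D := by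
  refine isClosed_real_iff.2 fun m x => ?_
  choose K β hβ Y hY using fun (z : Σ j : Fin (m + 1), (⦋(j : ℕ)⦌ ⟶ ⦋m⦌)) =>
    X.exists_nonDegenerate (X.map z.2.op x)
  have e : pt x ⁻¹' D = ⋃ z : Σ j : Fin (m + 1), (⦋(j : ℕ)⦌ ⟶ ⦋m⦌),
      dmap z.2 '' (dmap (β z) ⁻¹' (Set.ofPred fun s => IsInterior s ∧ pt (Y z).1 s ∈ D)) := by
    ext t
    simp only [Set.mem_iUnion]
    constructor
    · intro ht
      obtain ⟨j, α, u, hα, hu, rfl⟩ := exists_interior t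
      have hz := hY ⟨⟨j, le_of_mono hα⟩, α⟩
      refine ⟨⟨⟨j, le_of_mono hα⟩, α⟩, u, ⟨hu.dmap (hβ _), ?_⟩, rfl⟩
      rw [← pt_map, ← hz, pt_map]
      exact ht
    · rintro ⟨z, u, ⟨-, hu⟩, rfl⟩
      rw [← pt_map, ← hY z, pt_map] at hu
      exact hu
  rw [e]
  refine isClosed_iUnion_of_finite fun z => ?_
  have hs : (Set.ofPred fun s => IsInterior s ∧ pt (Y z).1 s ∈ D).Subsingleton :=
    fun s hs s' hs' => hD _ _ (Y z).2 s s' hs.1 hs'.1 hs.2 hs'.2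
  exact ((hs.isClosed.preimage (continuous_dmap _)).isCompact.image (continuous_dmap _)).isClosed

/-- A compact subset of the realization lies in the realization of a finite subcomplex. -/
theorem exists_finite_subcomplex {K : Set (SSet.toTop.obj X)} (hK : IsCompact K) :
    ∃ A : X.Subcomplex, A.toSSet.Finite ∧ K ⊆ Set.range (SSet.toTop.map A.ι) := by
  let N := {z : Σ k : ℕ, X.nonDegenerate k // ∃ s : Dx z.1, IsInterior s ∧ pt z.2.1 s ∈ K}
  choose s hs hsK using fun z : N => z.2
  let p : N → SSet.toTop.obj X := fun z => pt z.1.2.1 (s z)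
  have hinj : ∀ z z' : N, ∀ t t', IsInterior t → IsInterior t' →
      pt z.1.2.1 t = pt z'.1.2.1 t' → z = z' := by
    rintro ⟨⟨k, y, hy⟩, hz⟩ ⟨⟨l, y', hy'⟩, hz'⟩ t t' ht ht' h
    have h1 := pt_injective_of_interior hy ht hy' ht' h
    obtain rfl : k = l := congrArg Sigma.fst h1
    obtain ⟨rfl, -⟩ := Prod.mk.inj (eq_of_heq (Sigma.mk.inj h1).2)
    rfl
  -- One point of `K` is chosen in each cell that `K` meets. All subsets of this selection are
  -- closed, so it is a closed discrete subset of a compact set, hence finite.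
  have hcl : ∀ D : Set (SSet.toTop.obj X), D ⊆ Set.range p → IsClosed D := by
    intro D hD
    refine isClosed_of_cellwise fun k y hy t t' ht ht' h h' => ?_
    have key : ∀ t : Dx k, IsInterior t → pt y t ∈ D → ∀ z : N, p z = pt y t →
        (⟨k, y, t⟩ : Σ k : ℕ, X _⦋k⦌ × Dx k) = ⟨z.1.1, z.1.2.1, s z⟩ :=
      fun t ht _ z hz => pt_injective_of_interior hy ht z.1.2.2 (hs z) hz.symm
    obtain ⟨z, hz⟩ := hD h
    obtain ⟨z', hz'⟩ := hD h'
    have e := key t ht h z hz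
    have e' := key t' ht' h' z' hz'
    obtain rfl : z = z' := by
      obtain ⟨⟨l, w, hw⟩, _⟩ := z
      obtain ⟨⟨l', w', hw'⟩, _⟩ := z'
      obtain rfl : k = l := congrArg Sigma.fst e
      obtain rfl : k = l' := congrArg Sigma.fst e'
      obtain ⟨rfl, -⟩ := Prod.mk.inj (eq_of_heq (Sigma.mk.inj e).2)
      obtain ⟨rfl, -⟩ := Prod.mk.inj (eq_of_heq (Sigma.mk.inj e').2)
      rfl
    have e'' := e.trans e'.symm
    exact (Prod.mk.inj (eq_of_heq (Sigma.mk.inj e'').2)).2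
  have hfin : (Set.range p).Finite := by
    refine IsCompact.finite (hK.of_isClosed_subset (hcl _ subset_rfl) ?_) ⟨?_⟩
    · rintro _ ⟨z, rfl⟩
      exact hsK z
    · rw [discreteTopology_iff_forall_isClosed]
      intro E
      have : E = Subtype.val ⁻¹' (Subtype.val '' E : Set (SSet.toTop.obj X)) :=
        (Set.preimage_image_eq E Subtype.val_injective).symm
      rw [this]
      exact (hcl _ (by rintro _ ⟨x, -, rfl⟩; exact x.2)).preimage continuous_subtype_val
  have hN : Finite N := by
    have : Finite (Set.range p) := hfin
    exact Finite.of_injective (Set.rangeFactorization p) fun z z' h =>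
      hinj z z' _ _ (hs z) (hs z') (congrArg Subtype.val h)
  refine ⟨⨆ z : N, SSet.Subcomplex.ofSimplex z.1.2.1, ?_, ?_⟩
  · exact (SSet.finite_iSup_iff _).2 fun z => inferInstance
  · intro q hq
    obtain ⟨k, y, t, hy, ht, rfl⟩ := exists_nf q
    refine pt_mem_range _ ?_ t
    exact le_iSup (fun z : N => SSet.Subcomplex.ofSimplex z.1.2.1) ⟨⟨k, y, hy⟩, t, ht, hq⟩ _
      (SSet.Subcomplex.mem_ofSimplex_obj y)

end Subcomplexes

end SpinPin

namespace SpinPin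

/-! ### Pushing a collar of the boundary of the simplex into the boundary -/

section Push
variable {n : ℕ}

/-- The least barycentric coordinate. -/
noncomputable def mu (t : Dx n) : ℝ := Finset.univ.inf' Finset.univ_nonempty fun i => t i

/-- The width of the collar. -/
noncomputable def collar (n : ℕ) : ℝ := 1 / (2 * (n + 1))

theorem collar_pos (n : ℕ) : 0 < collar n := by unfold collar; positivity

theorem continuous_coord (i : Fin (n + 1)) : Continuous fun t : Dx n => t i :=
  (continuous_apply i).comp continuous_subtype_val

theorem continuous_mu : Continuous (mu (n := n)) :=
  Continuous.finset_inf'_apply _ fun i _ => continuous_coord i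

theorem mu_le (t : Dx n) (i : Fin (n + 1)) : mu t ≤ t i :=
  Finset.inf'_le (fun i => t i) (Finset.mem_univ i)

theorem mu_nonneg (t : Dx n) : 0 ≤ mu t := Finset.le_inf' _ _ fun i _ => t.2.1 i

theorem exists_eq_mu (t : Dx n) : ∃ i, t i = mu t := by
  obtain ⟨i, -, hi⟩ := Finset.exists_mem_eq_inf' Finset.univ_nonempty fun i => t i
  exact ⟨i, hi.symm⟩

theorem isInterior_iff (t : Dx n) : IsInterior t ↔ 0 < mu t := by
  constructor
  · intro h
    obtain ⟨i, hi⟩ := exists_eq_mu t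
    rw [← hi]
    exact h i
  · exact fun h i => h.trans_le (mu_le t i)

theorem mu_eq_zero {t : Dx n} (h : ¬ IsInterior t) : mu t = 0 :=
  le_antisymm (not_lt.1 fun h' => h ((isInterior_iff t).2 h')) (mu_nonneg t)

theorem mul_mu_le (t : Dx n) : ((n : ℝ) + 1) * mu t ≤ 1 := by
  have h1 : ∑ _i : Fin (n + 1), mu t ≤ ∑ i, t i := Finset.sum_le_sum fun i _ => mu_le t i
  have h2 : ∑ i, t i = 1 := t.2.2
  rw [h2] at h1
  simpa using h1

/-- The amount subtracted from all coordinates at time `τ`. -/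
noncomputable def shift (τ : unitInterval) (t : Dx n) : ℝ := τ * min (mu t) (collar n)

theorem shift_le (τ : unitInterval) (t : Dx n) : shift τ t ≤ min (mu t) (collar n) :=
  mul_le_of_le_one_left (le_min (mu_nonneg t) (collar_pos n).le) τ.2.2

/-- The collar has half the largest possible value of `mu`, which keeps the denominator at least
`1/2`. -/
theorem scale_pos (τ : unitInterval) (t : Dx n) : 0 < 1 - ((n : ℝ) + 1) * shift τ t := by
  have h : shift τ t ≤ collar n := (shift_le τ t).trans (min_le_right _ _)
  have h2 : ((n : ℝ) + 1) * collar n = 1 / 2 := by unfold collar; field_simp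
  nlinarith [mul_le_mul_of_nonneg_left h (by positivity : (0 : ℝ) ≤ (n : ℝ) + 1)]

/-- The radial push towards the boundary of the simplex. -/
noncomputable def radial (τ : unitInterval) (t : Dx n) : Dx n :=
  ⟨fun i => (t i - shift τ t) / (1 - ((n : ℝ) + 1) * shift τ t), fun i =>
    div_nonneg (sub_nonneg.2 (((shift_le τ t).trans (min_le_left _ _)).trans (mu_le t i)))
      (scale_pos τ t).le, by
    have h : ∑ i, t i = 1 := t.2.2
    rw [← Finset.sum_div, Finset.sum_sub_distrib, h, div_eq_one_iff_eq (scale_pos τ t).ne']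
    simp⟩

theorem radial_apply (τ : unitInterval) (t : Dx n) (i : Fin (n + 1)) :
    radial τ t i = (t i - shift τ t) / (1 - ((n : ℝ) + 1) * shift τ t) := rfl

theorem continuous_radial : Continuous fun p : unitInterval × Dx n => radial p.1 p.2 := by
  have hs : Continuous fun p : unitInterval × Dx n => shift p.1 p.2 := by
    unfold shift
    exact (continuous_subtype_val.comp continuous_fst).mul
      ((continuous_mu.comp continuous_snd).min continuous_const)
  refine Continuous.subtype_mk (continuous_pi fun i => ?_) _
  exact (((continuous_coord i).comp continuous_snd).sub hs).div
    (continuous_const.sub (continuous_const.mul hs)) fun p => (scale_pos p.1 p.2).ne'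

theorem radial_of_shift {τ : unitInterval} {t : Dx n} (h : shift τ t = 0) : radial τ t = t := by
  refine stdSimplex.ext (funext fun i => ?_)
  change radial τ t i = t i
  rw [radial_apply, h]
  simp

theorem radial_zero (t : Dx n) : radial 0 t = t := radial_of_shift (by simp [shift])

theorem radial_of_not_interior (τ : unitInterval) {t : Dx n} (h : ¬ IsInterior t) :
    radial τ t = t :=
  radial_of_shift (by rw [shift, mu_eq_zero h, min_eq_left (collar_pos n).le, mul_zero])

/-- Inside the collar the inequality reduces to `(n + 1) * mu t ≤ 1`: subtracting the shift
outweighs the rescaling, so the push never leaves the collar. -/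
theorem mu_radial_le (τ : unitInterval) {t : Dx n} (h : mu t < collar n) :
    mu (radial τ t) ≤ mu t := by
  obtain ⟨i, hi⟩ := exists_eq_mu t
  refine (mu_le _ i).trans ?_
  rw [radial_apply, hi, div_le_iff₀ (scale_pos τ t), shift, min_eq_left h.le]
  have h1 := mul_mu_le t
  have h2 := mul_nonneg τ.2.1 (mu_nonneg t)
  nlinarith

/-- At time one the full minimum is subtracted, so the smallest coordinate becomes zero. -/
theorem not_isInterior_radial_one {t : Dx n} (h : mu t < collar n) : ¬ IsInterior (radial 1 t) := by
  obtain ⟨i, hi⟩ := exists_eq_mu t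
  intro h'
  have := h' i
  rw [radial_apply, hi, shift, min_eq_left h.le] at this
  simp at this

theorem interior_of_half_lt {t : Dx n} (ht : collar n / 2 < mu t) : IsInterior t :=
  (isInterior_iff t).2 ((half_pos (collar_pos n)).trans ht)

end Push

/-! ### Attaching a cell -/

/-- `T` is obtained from `B` by attaching a cell with characteristic map `p`. -/
structure IsCell {n : ℕ} (T : TopCat.{u}) (B : Set T) (p : Dx n → T) : Prop where
  quot : Topology.IsQuotientMap (Sum.elim (Subtype.val : B → T) p)
  notMem : ∀ t, IsInterior t → p t ∉ B
  mem : ∀ t, ¬ IsInterior t → p t ∈ B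
  inj : ∀ t t', IsInterior t → IsInterior t' → p t = p t' → t = t'

namespace IsCell
variable {n : ℕ} {T : TopCat.{u}} {B : Set T} {p : Dx n → T}

theorem continuous (h : IsCell T B p) : Continuous p := h.quot.continuous.comp continuous_inr

theorem isOpen_iff (h : IsCell T B p) (U : Set T) :
    IsOpen U ↔ IsOpen (Subtype.val ⁻¹' U : Set B) ∧ IsOpen (p ⁻¹' U) := by
  rw [← h.quot.isOpen_preimage, isOpen_sum_iff]
  exact Iff.rfl

theorem exists_of_notMem (h : IsCell T B p) {q : T} (hq : q ∉ B) : ∃ t, IsInterior t ∧ p t = q := by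
  obtain ⟨a | t, rfl⟩ := h.quot.surjective q
  · exact (hq a.2).elim
  · exact ⟨t, by_contra fun ht => hq (h.mem t ht), rfl⟩

/-- The collar neighbourhood of `B`. -/
def outer (_ : IsCell T B p) : Set T := B ∪ p '' (Set.ofPred fun t => mu t < collar n)

/-- The interior part of the cell. -/
def inner (_ : IsCell T B p) : Set T := p '' (Set.ofPred fun t => collar n / 2 < mu t)

theorem inj_mem (h : IsCell T B p) {t t' : Dx n} (ht : IsInterior t) (e : p t' = p t) : t' = t := by
  by_cases ht' : IsInterior t'
  · exact h.inj _ _ ht' ht e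
  · exact (h.notMem t ht (e ▸ h.mem t' ht')).elim

theorem mem_outer_iff (h : IsCell T B p) (t : Dx n) : p t ∈ h.outer ↔ mu t < collar n := by
  constructor
  · rintro (h1 | ⟨t', ht', e⟩)
    · rw [mu_eq_zero fun ht => h.notMem t ht h1]
      exact collar_pos n
    · by_cases ht : IsInterior t
      · rw [← h.inj_mem ht e]
        exact ht'
      · rw [mu_eq_zero ht]
        exact collar_pos n
  · exact fun ht => Or.inr ⟨t, ht, rfl⟩

theorem mem_inner_iff (h : IsCell T B p) (t : Dx n) : p t ∈ h.inner ↔ collar n / 2 < mu t := by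
  constructor
  · rintro ⟨t', ht', e⟩
    rw [h.inj_mem (interior_of_half_lt ht') e.symm]
    exact ht'
  · exact fun ht => ⟨t, ht, rfl⟩

theorem inner_disjoint (h : IsCell T B p) {q : T} (hq : q ∈ h.inner) : q ∉ B := by
  obtain ⟨t, ht, rfl⟩ := hq
  exact h.notMem t (interior_of_half_lt ht)

theorem isOpen_outer (h : IsCell T B p) : IsOpen h.outer := by
  rw [h.isOpen_iff]
  constructor
  · convert isOpen_univ
    ext a
    exact iff_of_true (Or.inl a.2) trivial
  · have : p ⁻¹' h.outer = Set.ofPred fun t => mu t < collar n := by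
      ext t
      exact h.mem_outer_iff t
    rw [this]
    exact isOpen_lt continuous_mu continuous_const

theorem isOpen_inner (h : IsCell T B p) : IsOpen h.inner := by
  rw [h.isOpen_iff]
  constructor
  · convert isOpen_empty
    ext a
    exact iff_of_false (fun ha => h.inner_disjoint ha a.2) id
  · have : p ⁻¹' h.inner = Set.ofPred fun t => collar n / 2 < mu t := by
      ext t
      exact h.mem_inner_iff t
    rw [this]
    exact isOpen_lt continuous_const continuous_mu

theorem outer_union_inner (h : IsCell T B p) : h.outer ∪ h.inner = Set.univ := by
  refine Set.eq_univ_of_forall fun q => ?_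
  by_cases hq : q ∈ B
  · exact Or.inl (Or.inl hq)
  · obtain ⟨t, -, rfl⟩ := h.exists_of_notMem hq
    rcases lt_or_ge (mu t) (collar n) with ht | ht
    · exact Or.inl ((h.mem_outer_iff t).2 ht)
    · exact Or.inr ((h.mem_inner_iff t).2 ((half_lt_self (collar_pos n)).trans_le ht))

/-- The radial push fixes the boundary of the simplex, so it glues with the identity of `B`. -/
theorem exists_push (h : IsCell T B p) : ∃ F : unitInterval × T → T, Continuous F ∧ (∀ τ, ∀ q ∈ B, F (τ, q) = q) ∧
    ∀ τ t, F (τ, p t) = p (radial τ t) := by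
  classical
  choose r hr hpr using fun (q : {q : T // q ∉ B}) => h.exists_of_notMem q.2
  let F : unitInterval × T → T := fun z =>
    if hz : z.2 ∈ B then z.2 else p (radial z.1 (r ⟨z.2, hz⟩))
  have hB : ∀ τ, ∀ q ∈ B, F (τ, q) = q := fun τ q hq => dif_pos hq
  have hp : ∀ τ t, F (τ, p t) = p (radial τ t) := by
    intro τ t
    by_cases ht : IsInterior t
    · have h1 : r ⟨p t, h.notMem t ht⟩ = t := h.inj_mem ht (hpr ⟨p t, h.notMem t ht⟩)
      change dite _ _ _ = _
      rw [dif_neg (h.notMem t ht), h1]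
    · rw [hB τ _ (h.mem t ht), radial_of_not_interior τ ht]
  -- The product of a quotient map with the locally compact unit interval is again a quotient map.
  refine ⟨F, h.quot.continuous_lift_prod_right ?_, hB, hp⟩
  have h2 : Continuous fun z : (B ⊕ Dx n) × unitInterval =>
      F (z.2, Sum.elim (Subtype.val : B → T) p z.1) := by
    have h3 : Continuous fun z : (B × unitInterval) ⊕ (Dx n × unitInterval) =>
        Sum.elim (fun w : B × unitInterval => (w.1 : T)) (fun w => p (radial w.2 w.1)) z :=
      Continuous.sumElim (continuous_subtype_val.comp continuous_fst)
        (h.continuous.comp (continuous_radial.comp continuous_swap))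
    convert h3.comp (Homeomorph.sumProdDistrib (X := B) (Y := Dx n) (Z := unitInterval)).continuous
      using 1
    funext ⟨a, τ⟩
    rcases a with a | t
    · exact hB τ _ a.2
    · exact hp τ t
  exact h2.comp continuous_swap

/-- At time one the push carries the collar neighbourhood into `B`; meanwhile it keeps this
neighbourhood in itself and `B` fixed, so it gives a homotopy inverse of pairs. -/
theorem isHomotopyEquiv_outer (h : IsCell T B p) :
    IsHomotopyEquiv (setMap (A := B) (A' := h.outer) (ContinuousMap.id T) fun _ hq => Or.inl hq) := by
  obtain ⟨F, hF, hFB, hFp⟩ := h.exists_push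
  have h1 : ∀ q ∈ h.outer, F (1, q) ∈ B := by
    rintro q (hq | ⟨t, ht, rfl⟩)
    · rwa [hFB 1 q hq]
    · rw [hFp]
      exact h.mem _ (not_isInterior_radial_one ht)
  have hout : ∀ τ, ∀ q ∈ h.outer, F (τ, q) ∈ h.outer := by
    rintro τ q (hq | ⟨t, ht, rfl⟩)
    · rw [hFB τ q hq]
      exact Or.inl hq
    · rw [hFp]
      exact (h.mem_outer_iff _).2 ((mu_radial_le τ ht).trans_lt ht)
  have h0 : ∀ q, F (0, q) = q := by
    intro q
    obtain ⟨a | t, rfl⟩ := h.quot.surjective q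
    · exact hFB 0 _ a.2
    · exact (hFp 0 t).trans (congrArg p (radial_zero t))
  let g : C(T, T) := ⟨fun q => F (1, q), hF.comp (by fun_prop)⟩
  let H : (ContinuousMap.id T).Homotopy g :=
    { toFun := F
      continuous_toFun := hF
      map_zero_left := h0
      map_one_left := fun q => rfl }
  refine ⟨setMap g h1, ?_, ?_⟩
  · refine TopPair.Homotopic.equivalence.symm ?_
    exact setMap_homotopic (A := B) (A' := B) (f := ContinuousMap.id T) (g := g)
      (fun _ hq => hq) (fun q hq => h1 q (Or.inl hq)) H
      (fun τ q hq => by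
        change F (τ, q) ∈ B
        rwa [hFB τ q hq])
  · refine TopPair.Homotopic.equivalence.symm ?_
    exact setMap_homotopic (A := h.outer) (A' := h.outer) (f := ContinuousMap.id T) (g := g)
      (fun _ hq => hq) (fun q hq => Or.inl (h1 q hq)) H hout

end IsCell

/-! ### Comparing two cell attachments. -/

section Comparison
variable {n : ℕ} {T T' : TopCat.{u}} {B : Set T} {B' : Set T'} {p : Dx n → T} {p' : Dx n → T'}

/-- Relative homeomorphisms of cell attachments are quasi-isomorphisms. -/
theorem IsCell.isQI (h : IsCell T B p) (h' : IsCell T' B' p') (g : C(T, T'))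
    (hg : Set.MapsTo g B B') (hgp : ∀ t, g (p t) = p' t) : IsQI (singMap (setMap g hg)) := by
  have hout : Set.MapsTo g h.outer h'.outer := by
    rintro q (hq | ⟨t, ht, rfl⟩)
    · exact Or.inl (hg hq)
    · rw [hgp]
      exact (h'.mem_outer_iff t).2 ht
  have hin : Set.MapsTo g h.inner h'.inner := by
    rintro q ⟨t, ht, rfl⟩
    rw [hgp]
    exact (h'.mem_inner_iff t).2 ht
  -- On the inner part an open set and its image have the same preimage in the simplex, and the
  -- image misses `B'`. This makes the bijection of inner parts a homeomorphism.
  have hopen : ∀ O ⊆ h.inner, IsOpen O → IsOpen (g '' O) := by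
    intro O hO hOo
    have hO' : g '' O ⊆ h'.inner := by
      rintro _ ⟨q, hq, rfl⟩
      exact hin (hO hq)
    rw [h'.isOpen_iff]
    constructor
    · convert isOpen_empty
      ext a
      exact iff_of_false (fun ha => h'.inner_disjoint (hO' ha) a.2) id
    · convert hOo.preimage h.continuous using 1
      ext t
      constructor
      · rintro ⟨q, hq, e⟩
        obtain ⟨t', ht', rfl⟩ := hO hq
        rw [hgp] at e
        rw [← h'.inj_mem (interior_of_half_lt ht') e.symm] at hq
        exact hq
      · intro ht
        exact ⟨p t, ht, hgp t⟩
  let gi : h.inner → h'.inner := hin.restrict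
  have hgi : Function.Bijective gi := by
    constructor
    · rintro ⟨_, t, ht, rfl⟩ ⟨_, t', ht', rfl⟩ e
      have e1 : g (p t) = g (p t') := congrArg Subtype.val e
      rw [hgp, hgp] at e1
      have := h'.inj_mem (interior_of_half_lt ht') e1
      subst this
      rfl
    · rintro ⟨_, t, ht, rfl⟩
      exact ⟨⟨p t, t, ht, rfl⟩, Subtype.ext (hgp t)⟩
  have hgic : Continuous gi := g.continuous.restrict hin
  have hgio : IsOpenMap gi := by
    intro O hO
    have h1 : IsOpen (Subtype.val '' O : Set T) := h.isOpen_inner.isOpenMap_subtype_val O hO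
    have h2 := hopen _ (by rintro _ ⟨x, -, rfl⟩; exact x.2) h1
    have h3 := h2.preimage (continuous_subtype_val (p := fun q => q ∈ h'.inner))
    convert h3 using 1
    ext x
    constructor
    · rintro ⟨y, hy, rfl⟩
      exact ⟨y, ⟨y, hy, rfl⟩, rfl⟩
    · rintro ⟨_, ⟨y, hy, rfl⟩, e⟩
      exact ⟨y, hy, Subtype.ext e⟩
  let e : h.inner ≃ₜ h'.inner :=
    (Equiv.ofBijective gi hgi).toHomeomorphOfContinuousOpen hgic hgio
  have hpre : ∀ x : h.inner, (x : T) ∈ h.outer ↔ (e x : T') ∈ h'.outer := by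
    rintro ⟨_, t, ht, rfl⟩
    rw [h.mem_outer_iff]
    change _ ↔ g (p t) ∈ _
    rw [hgp, h'.mem_outer_iff]
  let W : TopCat.{u} := TopCat.of h.inner
  let W' : TopCat.{u} := TopCat.of h'.inner
  let A : Set W := Subtype.val ⁻¹' h.outer
  let A' : Set W' := Subtype.val ⁻¹' h'.outer
  have m1 : Set.MapsTo (⟨gi, hgic⟩ : C(W, W')) A A' := fun x hx => (hpre x).1 hx
  have m2 : Set.MapsTo (⟨e.symm, e.symm.continuous⟩ : C(W', W)) A' A := fun x hx =>
    (hpre _).2 (by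
      change (e (e.symm x) : T') ∈ _
      rw [e.apply_symm_apply]
      exact hx)
  let E : setPair A ≅ setPair A' :=
    { hom := setMap ⟨gi, hgic⟩ m1
      inv := setMap ⟨e.symm, e.symm.continuous⟩ m2
      hom_inv_id := by
        ext x
        · exact Subtype.ext (e.symm_apply_apply x.1)
        · exact e.symm_apply_apply x
      inv_hom_id := by
        ext x
        · exact Subtype.ext (e.apply_symm_apply x.1)
        · exact e.apply_symm_apply x }
  -- Two-out-of-three twice: excision compares the inner parts with the spaces modulo their collar
  -- neighbourhoods, and the push compares those with the spaces modulo `B` and `B'`.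
  have q1 : IsQI (singMap E.hom) := (IsHomotopyEquiv.of_iso E).isQI
  have q2 := isQI_excision h.isOpen_outer h.isOpen_inner h.outer_union_inner
  have q3 := isQI_excision h'.isOpen_outer h'.isOpen_inner h'.outer_union_inner
  have q4 := q1.comp q3
  have q5 : IsQI (singMap (setMap g hout)) := by
    refine IsQI.of_comp_left q2 ?_
    rw [← singMap_comp] at q4 ⊢
    exact q4
  have q6 := h.isHomotopyEquiv_outer.isQI
  have q7 := h'.isHomotopyEquiv_outer.isQI
  have q8 := q6.comp q5
  refine IsQI.of_comp_right q7 ?_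
  rw [← singMap_comp] at q8 ⊢
  exact q8

end Comparison

end SpinPin

namespace SpinPin

/-! ### Standard simplices -/

/-- The chains contract to a point. -/
def Coned (X : SSet.{u}) : Prop :=
  ∃ (h : Ch X →ₗ[ℤ] Ch X) (b : Ch X), bd b = 0 ∧ aug b = 1 ∧
    ∀ z, bd (h z) = z - h (bd z) - aug z • b

/-- The homotopy inverse sends a chain to its augmentation times `b`. Composing with `f` gives
multiples of `f b` instead of `b'`; since `h' (f b)` bounds their difference, the homotopy is
corrected by that term. -/
theorem Coned.isQI {X X' : SSet.{u}} (hX : Coned X) (hX' : Coned X') (f : X ⟶ X') :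
    IsQI (absMap f) := by
  obtain ⟨h, b, hb, hb1, e⟩ := hX
  obtain ⟨h', b', hb', hb1', e'⟩ := hX'
  rw [isQI_absMap_iff]
  have hfb : bd (chMap f b) = 0 := by rw [← chMap_bd, hb, map_zero]
  refine QI.of_homotopy (k := (LinearMap.toSpanSingleton ℤ _ b) ∘ₗ aug) (h := h)
    (h' := h' - (LinearMap.toSpanSingleton ℤ _ (h' (chMap f b))) ∘ₗ aug) ?_ ?_ ?_ ?_ ?_ ?_
  · intro x
    simp [aug_bd, hb]
  · rintro x hx
    rw [(Submodule.mem_bot ℤ).1 hx, map_zero]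
    exact zero_mem _
  · rintro x hx
    rw [(Submodule.mem_bot ℤ).1 hx, map_zero]
    exact zero_mem _
  · rintro x hx
    rw [(Submodule.mem_bot ℤ).1 hx, map_zero]
    exact zero_mem _
  · intro x
    simp only [LinearMap.comp_apply, LinearMap.toSpanSingleton_apply, aug_chMap, e]
    abel
  · intro x
    simp only [LinearMap.comp_apply, LinearMap.toSpanSingleton_apply, LinearMap.sub_apply, map_sub,
      map_smul, e', hfb, map_zero, aug_bd, aug_chMap, hb1]
    simp only [one_smul, sub_zero, smul_sub]
    abel

/-- The vertices of a simplex of the standard simplex. -/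
def vertexMap (n : ℕ) : (Δ[n] : SSet.{u}) ⟶ tup (ULift.{u} (Fin (n + 1))) where
  app k := ↾fun x => fun j => ULift.up (SSet.stdSimplex.asOrderHom x j)

theorem vertexMap_injective (n m : ℕ) :
    Function.Injective ((vertexMap.{u} n).app (op ⦋m⦌)) := by
  intro x y h
  refine SSet.stdSimplex.ext _ _ fun i => ?_
  exact congrArg ULift.down (congrFun h i)

/-- Prepending the vertex `0` to a simplex of the standard simplex. -/
def consZero {n m : ℕ} (x : (Δ[n] : SSet.{u}) _⦋m⦌) : (Δ[n] : SSet.{u}) _⦋m + 1⦌ :=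
  SSet.stdSimplex.objMk (n := ⦋n⦌) (m := op ⦋m + 1⦌)
    ⟨(Fin.cons 0 (fun i => x i) : Fin (m + 2) → Fin (n + 1)), by
      intro i j hij
      refine Fin.cases (fun _ => ?_) (fun i hij => ?_) i hij
      · exact Fin.zero_le _
      · obtain ⟨j, rfl⟩ := Fin.exists_succ_eq.2
          (fun h0 : j = 0 => absurd (h0 ▸ hij) (by simp))
        simp only [Fin.cons_succ]
        exact SSet.stdSimplex.monotone_apply x (Fin.succ_le_succ_iff.1 hij)⟩

/-- Prepending the least vertex keeps a string weakly increasing. The cone formula is inherited from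
tuples, into which the chains embed. -/
theorem coned_stdSimplex (n : ℕ) : Coned (Δ[n] : SSet.{u}) := by
  let c := chMap (vertexMap.{u} n)
  have hc : Function.Injective c := chMap_injective _ (vertexMap_injective n)
  let h : Ch (Δ[n] : SSet.{u}) →ₗ[ℤ] Ch (Δ[n] : SSet.{u}) :=
    Finsupp.lmapDomain ℤ ℤ fun s => ⟨s.1 + 1, consZero s.2⟩
  let v : (Δ[n] : SSet.{u}) _⦋0⦌ := SSet.stdSimplex.objMk (n := ⦋n⦌) (m := op ⦋0⦌) ⟨fun _ => 0,
    fun _ _ _ => le_rfl⟩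
  have hh : ∀ z, c (h z) = tupCone (ULift.up 0) (c z) := by
    have : c ∘ₗ h = tupCone (ULift.up 0) ∘ₗ c := by
      refine Ch.hom_ext fun m x => ?_
      have e1 : h (Finsupp.single ⟨m, x⟩ 1) =
          Finsupp.single (⟨m + 1, consZero x⟩ : Simp (Δ[n] : SSet.{u})) 1 := by simp [h]
      have e2 : c (Finsupp.single ⟨m, x⟩ 1) = tupCh fun i : Fin (m + 1) => ULift.up (x i) :=
        chMap_single _ _ _
      have e3 : c (Finsupp.single ⟨m + 1, consZero x⟩ 1) =
          tupCh fun i : Fin (m + 2) => ULift.up (consZero x i) := chMap_single _ _ _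
      rw [LinearMap.comp_apply, LinearMap.comp_apply, e1, e2, e3, tupCone_tupCh]
      congr 1
      funext i
      refine Fin.cases rfl (fun i => rfl) i
    exact LinearMap.congr_fun this
  have hv : c (Finsupp.single ⟨0, v⟩ 1) = tupCh fun _ : Fin 1 => ULift.up (0 : Fin (n + 1)) :=
    chMap_single _ _ _
  refine ⟨h, Finsupp.single ⟨0, v⟩ 1, bd_zero_simp v, by rw [aug_single]; rfl, fun z => ?_⟩
  apply hc
  rw [map_sub, map_sub, map_smul, hv, hh, chMap_bd, hh, bd_tupCone, ← chMap_bd, aug_chMap]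

/-! ### Absolute singular complexes -/

theorem subCh_singPair_empty (T : TopCat.{u}) :
    subCh (singPair (setPair (∅ : Set T))).Y = ⊥ := by
  rw [singPair_setPair_Y, ← subCh_bot]
  congr 1
  ext k s
  refine iff_of_false (fun h => ?_) fun h => h.elim
  exact h (Classical.arbitrary (stdSimplex ℝ (Fin (k.unop.len + 1))))

theorem isQI_toSSet_map {T T' : TopCat.{u}} (f : C(T, T')) (g : C(T', T))
    (h₁ : (g.comp f).Homotopic (ContinuousMap.id T))
    (h₂ : (f.comp g).Homotopic (ContinuousMap.id T')) :
    IsQI (absMap (TopCat.toSSet.map (TopCat.ofHom f))) := by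
  obtain ⟨F⟩ := h₁
  obtain ⟨F'⟩ := h₂
  have h : IsHomotopyEquiv (setMap (A := (∅ : Set T)) (A' := (∅ : Set T')) f
      (fun _ hx => hx.elim)) := by
    refine ⟨setMap g (fun _ hx => hx.elim), ?_, ?_⟩
    · exact setMap_homotopic (A := (∅ : Set T)) (A' := (∅ : Set T)) (fun _ hx => hx.elim)
        (fun _ hx => hx.elim) F (fun _ _ hx => hx.elim)
    · exact setMap_homotopic (A := (∅ : Set T')) (A' := (∅ : Set T')) (fun _ hx => hx.elim)
        (fun _ hx => hx.elim) F' (fun _ _ hx => hx.elim)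
  have h' := h.isQI
  unfold IsQI at h'
  rw [subCh_singPair_empty, subCh_singPair_empty] at h'
  rw [isQI_absMap_iff]
  exact h'

theorem isQI_of_bijective {X X' : SSet.{u}} (f : X ⟶ X')
    (hf : ∀ m, Function.Bijective (f.app (op ⦋m⦌))) : IsQI (absMap f) :=
  IsQI.of_bijective_compl _ (fun _ _ h => h.elim) (fun m _ _ _ _ h => (hf m).1 h)
    fun m z _ => (hf m).2 z

/-- The canonical map to the singular complex of the realization is a quasi-isomorphism. -/
def Good (X : SSet.{u}) : Prop := IsQI (absMap (sSetTopAdj.unit.app X))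

/-- Two-out-of-three in the naturality square of the unit. -/
theorem good_iff {X X' : SSet.{u}} (f : X ⟶ X') (hf : IsQI (absMap f))
    (hf' : IsQI (absMap (TopCat.toSSet.map (SSet.toTop.map f)))) : Good X ↔ Good X' := by
  have e : absMap f ≫ absMap (sSetTopAdj.unit.app X') =
      absMap (sSetTopAdj.unit.app X) ≫ absMap (TopCat.toSSet.map (SSet.toTop.map f)) := by
    have := sSetTopAdj.unit.naturality f
    exact congrArg absMap this
  constructor
  · intro h
    refine IsQI.of_comp_left hf ?_
    rw [e]
    exact IsQI.comp h hf'
  · intro h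
    refine IsQI.of_comp_right hf' ?_
    rw [← e]
    exact IsQI.comp hf h

instance subsingleton_real_zero : Subsingleton (SSet.toTop.obj (Δ[0] : SSet.{u})) := by
  have : Subsingleton (stdSimplex ℝ (Fin (0 + 1))) := inferInstance
  exact (SimplexCategory.toTopHomeo.{u} ⦋0⦌).toEquiv.injective.subsingleton

/-- Both simplicial sets have exactly one simplex in each dimension. -/
theorem good_zero : Good (Δ[0] : SSet.{u}) := by
  refine isQI_of_bijective _ fun m => ⟨?_, ?_⟩
  · intro x y _
    exact SSet.stdSimplex.ext _ _ fun i => Subsingleton.elim (α := Fin 1) _ _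
  · intro s
    refine ⟨SSet.stdSimplex.objMk (n := ⦋0⦌) (m := op ⦋m⦌) ⟨fun _ => 0, fun _ _ _ => le_rfl⟩, ?_⟩
    exact sing_ext fun t => Subsingleton.elim _ _

/-- Comparison with `Δ[0]`: the chains of `Δ[n]` are coned, and its realization is contractible by
convexity. -/
theorem good_stdSimplex (n : ℕ) : Good (Δ[n] : SSet.{u}) := by
  let q : (Δ[n] : SSet.{u}) ⟶ Δ[0] := SSet.stdSimplex.map (SimplexCategory.const ⦋n⦌ ⦋0⦌ 0)
  let i : (Δ[0] : SSet.{u}) ⟶ Δ[n] := SSet.stdSimplex.map (SimplexCategory.const ⦋0⦌ ⦋n⦌ 0)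
  refine (good_iff q ((coned_stdSimplex n).isQI (coned_stdSimplex 0) q) ?_).2 good_zero
  have hne : (stdSimplex ℝ (Fin (n + 1))).Nonempty :=
    ⟨_, (Classical.arbitrary (stdSimplex ℝ (Fin (n + 1)))).2⟩
  have : ContractibleSpace (stdSimplex ℝ (Fin (n + 1))) :=
    (convex_stdSimplex ℝ (Fin (n + 1))).contractibleSpace hne
  have hc : ContractibleSpace (SSet.toTop.obj (Δ[n] : SSet.{u})) :=
    (SimplexCategory.toTopHomeo.{u} ⦋n⦌).contractibleSpace
  refine isQI_toSSet_map (SSet.toTop.map q).hom (SSet.toTop.map i).hom ?_ ?_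
  · obtain ⟨p, hp⟩ := id_nullhomotopic (SSet.toTop.obj (Δ[n] : SSet.{u}))
    let φ : C(SSet.toTop.obj (Δ[n] : SSet.{u}), SSet.toTop.obj (Δ[n] : SSet.{u})) :=
      (SSet.toTop.map i).hom.comp (SSet.toTop.map q).hom
    have h1 : φ.Homotopic (ContinuousMap.const _ p) := hp.comp (ContinuousMap.Homotopic.refl φ)
    exact h1.trans hp.symm
  · have e : (SSet.toTop.map q).hom.comp (SSet.toTop.map i).hom = ContinuousMap.id _ :=
      ContinuousMap.ext fun x => Subsingleton.elim _ _
    rw [e]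

end SpinPin

namespace SpinPin

/-! ### Attaching a nondegenerate simplex -/

section Attach
variable {X : SSet.{u}} {n : ℕ}

/-- `X` is obtained from the subcomplex `Y` by attaching the nondegenerate simplex `y`. -/
structure IsAttach (Y : X.Subcomplex) (y : X _⦋n⦌) : Prop where
  nonDegenerate : y ∈ X.nonDegenerate n
  notMem : y ∉ Y.obj (op ⦋n⦌)
  cover : ∀ {m : ℕ} (x : X _⦋m⦌), x ∉ Y.obj (op ⦋m⦌) → ∃ σ : ⦋m⦌ ⟶ ⦋n⦌, Epi σ ∧ X.map σ.op y = x
  face : ∀ {m : ℕ} (α : ⦋m⦌ ⟶ ⦋n⦌), ¬ Epi α → X.map α.op y ∈ Y.obj (op ⦋m⦌)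

/-- Each simplex lies in `Y` or is a degeneracy of `y`, so openness can be tested on `Y` and on `y`.
Separation of cell and subcomplex is uniqueness of normal forms. -/
theorem IsAttach.isCell {Y : X.Subcomplex} {y : X _⦋n⦌} (h : IsAttach Y y) :
    IsCell (SSet.toTop.obj X) (Set.range (SSet.toTop.map Y.ι)) (pt y) where
  quot := by
    rw [Topology.isQuotientMap_iff, Topology.isCoinducing_iff, and_comm]
    refine ⟨fun q => ?_, fun U => ⟨fun hU => ?_, fun hU => ?_⟩⟩
    · obtain ⟨m, x, t, rfl⟩ := exists_pt q
      by_cases hx : x ∈ Y.obj (op ⦋m⦌)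
      · exact ⟨Sum.inl ⟨pt x t, pt_mem_range Y hx t⟩, rfl⟩
      · obtain ⟨σ, -, rfl⟩ := h.cover x hx
        exact ⟨Sum.inr (dmap σ t), (pt_map σ y t).symm⟩
    · rw [isOpen_sum_iff] at hU
      refine isOpen_real_iff.2 fun m x => ?_
      by_cases hx : x ∈ Y.obj (op ⦋m⦌)
      · exact hU.1.preimage (f := fun t => (⟨pt x t, pt_mem_range Y hx t⟩ :
          Set.range (SSet.toTop.map Y.ι))) ((continuous_pt x).subtype_mk _)
      · obtain ⟨σ, -, rfl⟩ := h.cover x hx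
        have e : pt (X.map σ.op y) ⁻¹' U = dmap σ ⁻¹' (pt y ⁻¹' U) := by
          ext t
          rw [Set.mem_preimage, pt_map]
          rfl
        rw [e]
        exact hU.2.preimage (continuous_dmap σ)
    · exact hU.preimage (Continuous.sumElim continuous_subtype_val (continuous_pt y))
  notMem t ht := fun h' => h.notMem ((pt_mem_range_iff Y h.nonDegenerate ht).1 h')
  mem t ht := by
    obtain ⟨j, α, u, hα, hu, rfl⟩ := exists_interior t
    rw [← pt_map]
    exact pt_mem_range Y (h.face α fun hα' => ht (hu.dmap hα')) u
  inj t t' ht ht' e := by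
    have h1 := pt_injective_of_interior h.nonDegenerate ht h.nonDegenerate ht' e
    exact (Prod.mk.inj (eq_of_heq (Sigma.mk.inj h1).2)).2

theorem mem_boundary_iff {m : ℕ} (α : ⦋m⦌ ⟶ ⦋n⦌) :
    (SSet.stdSimplex.objEquiv.{u}.symm α : (Δ[n] : SSet.{u}) _⦋m⦌) ∈ (SSet.boundary n).obj (op ⦋m⦌) ↔
      ¬ Epi α := by
  rw [SimplexCategory.epi_iff_surjective]
  exact Iff.rfl

/-- The nondegenerate top simplex of the standard simplex. -/
def topSimplex (n : ℕ) : (Δ[n] : SSet.{u}) _⦋n⦌ := SSet.stdSimplex.objEquiv.symm (𝟙 ⦋n⦌)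

theorem map_topSimplex {m : ℕ} (α : ⦋m⦌ ⟶ ⦋n⦌) :
    (Δ[n] : SSet.{u}).map α.op (topSimplex n) = SSet.stdSimplex.objEquiv.symm α := by
  rw [topSimplex, SSet.stdSimplex.map_objEquiv_symm]
  simp

theorem isAttach_stdSimplex (n : ℕ) : IsAttach (SSet.boundary.{u} n) (topSimplex n) where
  nonDegenerate := by
    rw [SSet.mem_nonDegenerate_iff_notMem_degenerate, SSet.mem_degenerate_iff]
    rintro ⟨m, hm, f, hf, x, hx⟩
    obtain ⟨g, rfl⟩ := SSet.stdSimplex.objEquiv.symm.surjective x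
    rw [SSet.stdSimplex.map_objEquiv_symm] at hx
    have h1 := SSet.stdSimplex.objEquiv.symm.injective hx
    have : Mono f := by
      have h2 : Mono (f ≫ g) := by
        change f ≫ g = 𝟙 _ at h1
        rw [h1]
        infer_instance
      exact mono_of_mono f g
    have := SimplexCategory.len_le_of_mono f
    simp at this
    omega
  notMem h := (mem_boundary_iff (𝟙 ⦋n⦌)).1 h inferInstance
  cover {m} x hx := by
    obtain ⟨g, rfl⟩ := SSet.stdSimplex.objEquiv.symm.surjective x
    exact ⟨g, not_not.1 fun h => hx ((mem_boundary_iff g).2 h), map_topSimplex g⟩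
  face α hα := by
    rw [map_topSimplex]
    exact (mem_boundary_iff α).2 hα

/-- The characteristic map of an attached simplex. -/
def IsAttach.charMap {Y : X.Subcomplex} {y : X _⦋n⦌} (h : IsAttach Y y) :
    (⟨Δ[n], SSet.boundary n⟩ : SPair.{u}) ⟶ ⟨X, Y⟩ :=
  SPair.Hom.mk (SSet.yonedaEquiv.symm y) (by
    intro k s hs
    obtain ⟨α, rfl⟩ := SSet.stdSimplex.objEquiv.symm.surjective s
    rw [SSet.yonedaEquiv_symm_app_objEquiv_symm]
    exact h.face (m := k.unop.len) α ((mem_boundary_iff (m := k.unop.len) α).1 hs))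

theorem IsAttach.charMap_app {Y : X.Subcomplex} {y : X _⦋n⦌} (h : IsAttach Y y) {m : ℕ}
    (α : ⦋m⦌ ⟶ ⦋n⦌) : h.charMap.map.app (op ⦋m⦌) (SSet.stdSimplex.objEquiv.symm α) =
      X.map α.op y := SSet.yonedaEquiv_symm_app_objEquiv_symm y α

/-- Outside `Y` the simplices are the degeneracies of `y`, each in a unique way, and these match the
surjections onto `⦋n⦌`. -/
theorem IsAttach.isQI_charMap {Y : X.Subcomplex} {y : X _⦋n⦌} (h : IsAttach Y y) :
    IsQI h.charMap := by
  refine IsQI.of_bijective_compl _ ?_ ?_ ?_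
  · intro m x hx
    obtain ⟨α, rfl⟩ := SSet.stdSimplex.objEquiv.symm.surjective x
    erw [h.charMap_app] at hx
    exact (mem_boundary_iff α).2 fun hα => h.notMem (mem_of_epi_map hα hx)
  · intro m x x' hx hx' e
    obtain ⟨α, rfl⟩ := SSet.stdSimplex.objEquiv.symm.surjective x
    obtain ⟨β, rfl⟩ := SSet.stdSimplex.objEquiv.symm.surjective x'
    erw [h.charMap_app, h.charMap_app] at e
    have hα : Epi α := not_not.1 fun hα => hx ((mem_boundary_iff α).2 hα)
    have : α = β := X.unique_nonDegenerate_map _ α ⟨y, h.nonDegenerate⟩ rfl β ⟨y, h.nonDegenerate⟩ e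
    rw [this]
  · intro m z hz
    obtain ⟨σ, -, rfl⟩ := h.cover z hz
    exact ⟨SSet.stdSimplex.objEquiv.symm σ, h.charMap_app σ⟩

theorem unitPair_naturality {P Q : SPair.{u}} (f : P ⟶ Q) :
    f ≫ unitPair Q = unitPair P ≫ singMap (realMap f) :=
  SPair.Hom.ext (sSetTopAdj.unit.naturality f.map)

theorem IsAttach.isQI_realMap {Y : X.Subcomplex} {y : X _⦋n⦌} (h : IsAttach Y y) :
    IsQI (singMap (realMap h.charMap)) := by
  refine IsCell.isQI (isAttach_stdSimplex n).isCell h.isCell (SSet.toTop.map h.charMap.map).hom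
    (fun q hq => realMap_aux h.charMap ⟨q, hq⟩) fun t => ?_
  refine (map_pt _ _ t).trans ?_
  have := h.charMap_app (𝟙 ⦋n⦌)
  have e : h.charMap.map.app (op ⦋n⦌) (topSimplex n) = y := by
    refine this.trans ?_
    rw [op_id, X.map_id]
    rfl
  exact congrArg (fun z => pt z t) e

theorem IsAttach.isQI_unitPair {Y : X.Subcomplex} {y : X _⦋n⦌} (h : IsAttach Y y)
    (hn : IsQI (unitPair (⟨Δ[n], SSet.boundary n⟩ : SPair.{u}))) :
    IsQI (unitPair (⟨X, Y⟩ : SPair.{u})) := by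
  refine IsQI.of_comp_left h.isQI_charMap ?_
  rw [unitPair_naturality]
  exact hn.comp h.isQI_realMap

/-- The subcomplex of the simplices that do not have `y` as a face. -/
def avoid (y : X _⦋n⦌) : X.Subcomplex where
  obj k := Set.ofPred fun x => ∀ f : ⦋n⦌ ⟶ k.unop, X.map f.op x ≠ y
  map {k l} α x hx f := by
    have := hx (f ≫ α.unop)
    rwa [op_comp, Functor.map_comp, ConcreteCategory.comp_apply] at this

/-- A nondegenerate simplex with `y` as a face has dimension at least `n`; the dimension bound
forces equality, and then it is `y` itself. -/
theorem isAttach_avoid [X.HasDimensionLT (n + 1)] {y : X _⦋n⦌} (hy : y ∈ X.nonDegenerate n) :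
    IsAttach (avoid y) y where
  nonDegenerate := hy
  notMem h := h (𝟙 ⦋n⦌) (ConcreteCategory.congr_hom (X.map_id _) y)
  cover {m} x hx := by
    obtain ⟨f, hf⟩ : ∃ f : ⦋n⦌ ⟶ ⦋m⦌, X.map f.op x = y := by
      by_contra h
      exact hx fun f hf => h ⟨f, hf⟩
    obtain ⟨k, β, hβ, z, rfl⟩ := X.exists_nonDegenerate x
    have h1 : X.map (f ≫ β).op z.1 = y := by
      rw [op_comp, Functor.map_comp, ConcreteCategory.comp_apply]
      exact hf
    have h2 : Mono (f ≫ β) := X.mono_of_nonDegenerate ⟨y, hy⟩ _ _ h1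
    have h3 : n < k + 1 := le_of_mono h2
    have h4 : k < n + 1 := X.dim_lt_of_nonDegenerate z (n + 1)
    obtain rfl : n = k := by omega
    rw [SimplexCategory.eq_id_of_mono (f ≫ β)] at h1
    have h5 : z.1 = y := by
      rw [op_id, X.map_id] at h1
      exact h1
    exact ⟨β, hβ, by rw [h5]⟩
  face {m} α hα f hf := by
    have h1 : X.map (f ≫ α).op y = y := by
      rw [op_comp, Functor.map_comp, ConcreteCategory.comp_apply]
      exact hf
    have h2 : Mono (f ≫ α) := X.mono_of_nonDegenerate ⟨y, hy⟩ _ _ h1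
    have h3 := SimplexCategory.eq_id_of_mono (f ≫ α)
    have h4 : Epi (f ≫ α) := by rw [h3]; infer_instance
    exact hα (epi_of_epi f α)

end Attach

/-! ### The unit of the realization adjunction -/

section Unit
variable {X : SSet.{u}}

/-- The realization of a subcomplex is embedded, so a singular simplex with image in it lifts
continuously. -/
theorem range_toSSet_ι (Y : X.Subcomplex) :
    SSet.Subcomplex.range (TopCat.toSSet.map (SSet.toTop.map Y.ι)) =
      carried (Set.range (SSet.toTop.map Y.ι)) := by
  ext k s
  constructor
  · rintro ⟨s, rfl⟩ t
    exact ⟨_, rfl⟩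
  · intro hs
    let e := (isClosedEmbedding_toTop_ι Y).isEmbedding.toHomeomorph
    refine ⟨(TopCat.toSSetObjEquiv _ k).symm
      ⟨fun t => e.symm ⟨TopCat.toSSetObjEquiv _ k s t, hs t⟩, by fun_prop⟩, ?_⟩
    refine (TopCat.toSSetObjEquiv _ k).injective (ContinuousMap.ext fun t => ?_)
    exact congrArg Subtype.val (e.apply_symm_apply ⟨TopCat.toSSetObjEquiv _ k s t, hs t⟩)

theorem toSSet_ι_injective (Y : X.Subcomplex) (m : ℕ) :
    Function.Injective ((TopCat.toSSet.map (SSet.toTop.map Y.ι)).app (op ⦋m⦌)) := by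
  intro s s' h
  refine sing_ext fun t => toTop_ι_injective Y ?_
  exact congrArg (fun s => TopCat.toSSetObjEquiv _ (op ⦋m⦌) s t) h

theorem singPair_realPair_Y (P : SPair.{u}) : (singPair (realPair P)).Y =
    SSet.Subcomplex.range (TopCat.toSSet.map (SSet.toTop.map P.Y.ι)) :=
  (singPair_setPair_Y _).trans (range_toSSet_ι P.Y).symm

theorem isQI_absMap_comp {X₁ X₂ X₃ : SSet.{u}} {f : X₁ ⟶ X₂} {g : X₂ ⟶ X₃} (hf : IsQI (absMap f))
    (hg : IsQI (absMap g)) : IsQI (absMap (f ≫ g)) := by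
  have e : absMap (f ≫ g) = absMap f ≫ absMap g := rfl
  rw [e]
  exact hf.comp hg

/-- A lift to a subcomplex of the unit of the adjunction. -/
theorem isQI_lift_unit (Y : X.Subcomplex)
    (B : (TopCat.toSSet.obj (SSet.toTop.obj X)).Subcomplex)
    (hB : B = SSet.Subcomplex.range (TopCat.toSSet.map (SSet.toTop.map Y.ι)))
    (r : (Y : SSet.{u}) ⟶ (B : SSet.{u})) (hr : r ≫ B.ι = Y.ι ≫ sSetTopAdj.unit.app X)
    (h : Good (Y : SSet.{u})) : IsQI (absMap r) := by
  let b : TopCat.toSSet.obj (SSet.toTop.obj (Y : SSet.{u})) ⟶ (B : SSet.{u}) :=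
    SSet.Subcomplex.lift (TopCat.toSSet.map (SSet.toTop.map Y.ι)) hB.ge
  have hb : IsQI (absMap b) := by
    refine isQI_of_bijective b fun m => ⟨fun s s' e => ?_, fun s => ?_⟩
    · exact toSSet_ι_injective Y m (congrArg Subtype.val e)
    · obtain ⟨s', hs'⟩ : s.1 ∈ (SSet.Subcomplex.range
        (TopCat.toSSet.map (SSet.toTop.map Y.ι))).obj (op ⦋m⦌) := hB ▸ s.2
      exact ⟨s', Subtype.ext hs'⟩
  have e : r = sSetTopAdj.unit.app (Y : SSet.{u}) ≫ b := by
    rw [← cancel_mono B.ι, hr]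
    exact sSetTopAdj.unit.naturality Y.ι
  rw [e]
  exact isQI_absMap_comp h hb

theorem isQI_restrict_unitPair (P : SPair.{u}) (h : Good (P.Y : SSet.{u})) :
    IsQI (absMap (SPair.Hom.restrict (unitPair P))) :=
  isQI_lift_unit P.Y _ (singPair_realPair_Y P) (SPair.Hom.restrict (unitPair P)) rfl h

theorem isQI_unitPair_of_good (P : SPair.{u}) (hY : Good (P.Y : SSet.{u})) (hX : Good P.X) :
    IsQI (unitPair P) := IsQI.of_abs _ (isQI_restrict_unitPair P hY) hX

theorem good_of_isQI_unitPair (P : SPair.{u}) (hY : Good (P.Y : SSet.{u}))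
    (h : IsQI (unitPair P)) : Good P.X := IsQI.abs _ (isQI_restrict_unitPair P hY) h

/-- Outer induction on dimension, inner induction on the number of top nondegenerate simplices. The
boundary of `Δ[n]` falls under the outer hypothesis, which settles the model pair; removing one top
simplex falls under the inner one. -/
theorem good_of_hasDimensionLT (n : ℕ) : ∀ (X : SSet.{u}) [X.Finite] [X.HasDimensionLT n], Good X := by
  induction n with
  | zero =>
    intro X _ _
    have hX : ∀ m, IsEmpty (X _⦋m⦌) := by
      refine fun m => ⟨fun x => ?_⟩
      obtain ⟨k, -, -, y, -⟩ := X.exists_nonDegenerate x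
      exact absurd (X.dim_lt_of_nonDegenerate y 0) (by omega)
    refine isQI_of_bijective _ fun m => ⟨fun x => (hX m).elim x, fun s => ?_⟩
    obtain ⟨k, x, -⟩ := exists_pt (X := X) (TopCat.toSSetObjEquiv _ (op ⦋m⦌) s
      (Classical.arbitrary (stdSimplex ℝ (Fin (m + 1)))))
    exact (hX k).elim x
  | succ n ih =>
    have hn : IsQI (unitPair (⟨Δ[n], SSet.boundary n⟩ : SPair.{u})) :=
      isQI_unitPair_of_good _ (ih (SSet.boundary.{u} n).toSSet) (good_stdSimplex n)
    suffices H : ∀ (c : ℕ) (X : SSet.{u}) [X.Finite] [X.HasDimensionLT (n + 1)],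
        (X.nonDegenerate n).ncard = c → Good X from fun X _ _ => H _ X rfl
    intro c
    induction c using Nat.strong_induction_on with
    | _ c IH =>
      intro X _ _ hc
      rcases (X.nonDegenerate n).eq_empty_or_nonempty with h0 | ⟨y, hy⟩
      · have : X.HasDimensionLT n := by
          refine (SSet.hasDimensionLT_iff X n).2 fun k hk => ?_
          rcases hk.eq_or_lt with rfl | hk
          · exact Set.compl_empty_iff.1 h0
          · exact X.degenerate_eq_univ_of_hasDimensionLT (n + 1) k hk
        exact ih X
      · have hA := isAttach_avoid hy
        have hfin : (X.nonDegenerate n).Finite := Set.toFinite _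
        have hlt : ((avoid y).toSSet.nonDegenerate n).ncard < c := by
          have e := Set.ncard_image_of_injective ((avoid y).toSSet.nonDegenerate n)
            (f := (avoid y).ι.app (op ⦋n⦌)) Subtype.val_injective
          rw [← hc, ← e]
          refine Set.ncard_lt_ncard ⟨?_, fun h => ?_⟩ hfin
          · rintro _ ⟨x, hx, rfl⟩
            exact ((avoid y).mem_nonDegenerate_iff x).1 hx
          · obtain ⟨x, -, hx⟩ := h hy
            have hx' : x.1 ∈ (avoid y).obj (op ⦋n⦌) := x.2
            rw [show x.1 = y from hx] at hx'
            exact hA.notMem hx'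
        have hY := IH _ hlt (avoid y).toSSet rfl
        exact good_of_isQI_unitPair ⟨X, avoid y⟩ hY (hA.isQI_unitPair hn)

end Unit

end SpinPin

namespace SpinPin

/-! ### Passage to arbitrary simplicial sets -/

section General
variable {X : SSet.{u}}

theorem good_of_finite (X : SSet.{u}) [X.Finite] : Good X := by
  obtain ⟨d, _⟩ := X.hasDimensionLT_of_finite
  exact good_of_hasDimensionLT d X

theorem mem_subCh_of_support {A : X.Subcomplex} {z : Ch X}
    (h : ∀ s ∈ z.support, s.2 ∈ A.obj (op ⦋s.1⦌)) : z ∈ subCh A := h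

theorem subCh_mono {A B : X.Subcomplex} (h : A ≤ B) : subCh A ≤ subCh B :=
  Finsupp.supported_mono fun _ hs => h _ hs

theorem exists_finite_subCh (z : Ch X) : ∃ A : X.Subcomplex, A.toSSet.Finite ∧ z ∈ subCh A := by
  refine ⟨⨆ s : z.support, SSet.Subcomplex.ofSimplex s.1.2, ?_, mem_subCh_of_support fun s hs => ?_⟩
  · exact (SSet.finite_iSup_iff _).2 fun _ => inferInstance
  · exact le_iSup (fun s : z.support => SSet.Subcomplex.ofSimplex s.1.2) ⟨s, hs⟩ _
      (SSet.Subcomplex.mem_ofSimplex_obj s.2)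

/-- The images of the finitely many singular simplices in a chain form a compact set. -/
theorem exists_finite_sing (z : Ch (TopCat.toSSet.obj (SSet.toTop.obj X))) :
    ∃ A : X.Subcomplex, A.toSSet.Finite ∧ z ∈ subCh (carried (Set.range (SSet.toTop.map A.ι))) := by
  let K : Set (SSet.toTop.obj X) := ⋃ s : z.support,
    Set.range (TopCat.toSSetObjEquiv (SSet.toTop.obj X) (op ⦋s.1.1⦌) s.1.2)
  have hK : IsCompact K := isCompact_iUnion fun s => isCompact_range
    (TopCat.toSSetObjEquiv (SSet.toTop.obj X) (op ⦋s.1.1⦌) s.1.2).continuous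
  obtain ⟨A, hA, hKA⟩ := exists_finite_subcomplex hK
  refine ⟨A, hA, mem_subCh_of_support fun s hs t => hKA ?_⟩
  exact Set.mem_iUnion.2 ⟨⟨s, hs⟩, t, rfl⟩

theorem carried_mono {T : TopCat.{u}} {A B : Set T} (h : A ⊆ B) : carried A ≤ carried B :=
  fun _ _ hs t => h (hs t)

theorem range_ι_mono {A B : X.Subcomplex} (h : A ≤ B) :
    Set.range (SSet.toTop.map A.ι) ⊆ Set.range (SSet.toTop.map B.ι) := by
  rintro _ ⟨q, rfl⟩
  obtain ⟨m, x, t, rfl⟩ := exists_pt q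
  rw [map_ι_pt]
  exact pt_mem_range B (h _ x.2) t

theorem exists_lift_sing {A : X.Subcomplex} {z : Ch (TopCat.toSSet.obj (SSet.toTop.obj X))}
    (hz : z ∈ subCh (carried (Set.range (SSet.toTop.map A.ι)))) :
    ∃ w, chMap (TopCat.toSSet.map (SSet.toTop.map A.ι)) w = z := by
  rw [← range_toSSet_ι, subCh_range] at hz
  exact hz

theorem exists_lift_ι {A : X.Subcomplex} {z : Ch X} (hz : z ∈ subCh A) :
    ∃ w, chMap A.ι w = z := by
  have e : subCh A = LinearMap.range (chMap A.ι) := subCh_eq_range (P := absPair X) A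
  rw [e] at hz
  exact hz

theorem chMap_unit_ι (A : X.Subcomplex) (w : Ch (A : SSet.{u})) :
    chMap (sSetTopAdj.unit.app X) (chMap A.ι w) =
      chMap (TopCat.toSSet.map (SSet.toTop.map A.ι)) (chMap (sSetTopAdj.unit.app (A : SSet.{u})) w) := by
  rw [← LinearMap.comp_apply, ← LinearMap.comp_apply, ← chMap_comp, ← chMap_comp]
  exact congrArg (fun f => chMap f w) (sSetTopAdj.unit.naturality A.ι)

/-- A cycle and the chain that bounds it involve only a finite subcomplex, where the finite case
applies. Injectivity of inclusions on chains lets the equations be checked there. -/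
theorem good (X : SSet.{u}) : Good X := by
  have hG : ∀ A : X.Subcomplex, A.toSSet.Finite →
      QI bd bd ⊥ ⊥ (chMap (sSetTopAdj.unit.app (A : SSet.{u}))) :=
    fun A hA => (isQI_absMap_iff _).1 (good_of_finite A.toSSet)
  have hinj : ∀ A : X.Subcomplex, Function.Injective (chMap (TopCat.toSSet.map (SSet.toTop.map A.ι))) :=
    fun A => chMap_injective _ (toSSet_ι_injective A)
  refine (isQI_absMap_iff _).2 ⟨fun x x' hx hx' => ?_, fun x' hx' => ?_⟩
  · rw [Submodule.mem_bot] at hx hx'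
    obtain ⟨A₁, hA₁, h₁⟩ := exists_finite_subCh x
    obtain ⟨A₂, hA₂, h₂⟩ := exists_finite_sing x'
    let B : Bool → X.Subcomplex := fun b => match b with
      | true => A₁
      | false => A₂
    have hA : (⨆ b, B b).toSSet.Finite := (SSet.finite_iSup_iff B).2 fun b => by
      cases b
      · exact hA₂
      · exact hA₁
    obtain ⟨w, rfl⟩ := exists_lift_ι (subCh_mono (le_iSup B true) h₁)
    obtain ⟨w', rfl⟩ := exists_lift_sing
      (subCh_mono (carried_mono (range_ι_mono (le_iSup B false))) h₂)
    rw [← chMap_bd] at hx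
    rw [chMap_unit_ι, ← chMap_bd, ← map_sub] at hx'
    obtain ⟨y, hy⟩ := (hG _ hA).inj w w'
      (by rw [Submodule.mem_bot]; exact chMap_ι_injective _ (hx.trans (map_zero _).symm))
      (by rw [Submodule.mem_bot]; exact hinj _ (hx'.trans (map_zero _).symm))
    refine ⟨chMap (⨆ b, B b).ι y, ?_⟩
    rw [← chMap_bd, ← map_sub, (Submodule.mem_bot ℤ).1 hy, map_zero]
    exact zero_mem _
  · rw [Submodule.mem_bot] at hx'
    obtain ⟨A, hA, h⟩ := exists_finite_sing x'
    obtain ⟨w', rfl⟩ := exists_lift_sing h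
    rw [← chMap_bd] at hx'
    obtain ⟨x, y', h₁, h₂⟩ := (hG A hA).surj w'
      (by rw [Submodule.mem_bot]; exact hinj _ (hx'.trans (map_zero _).symm))
    refine ⟨chMap A.ι x, chMap (TopCat.toSSet.map (SSet.toTop.map A.ι)) y', ?_, ?_⟩
    · rw [← chMap_bd, (Submodule.mem_bot ℤ).1 h₁, map_zero]
      exact zero_mem _
    · rw [chMap_unit_ι, ← chMap_bd, ← map_sub, ← map_sub, (Submodule.mem_bot ℤ).1 h₂, map_zero]
      exact zero_mem _

/-- The canonical map to the singular complex of the realization is a quasi-isomorphism. -/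
theorem isQI_unitPair (P : SPair.{u}) : IsQI (unitPair P) := isQI_unitPair_of_good P (good _) (good _)

end General

/-! ### Consequences for the groups of a simplicial pair -/

section Consequences
variable {T U : TopPair.{u}}

theorem isQI_toSing (K : SimplicialStructure T) : IsQI K.toSing :=
  (isQI_unitPair K.K).comp (IsHomotopyEquiv.of_iso K.iso).isQI

theorem isQI_of_realMap {P Q : SPair.{u}} (f : P ⟶ Q) (h : IsHomotopyEquiv (realMap f)) :
    IsQI f := by
  refine IsQI.of_comp_right (isQI_unitPair Q) ?_
  rw [unitPair_naturality]
  exact (isQI_unitPair P).comp h.isQI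

theorem toSing_naturality (K : SimplicialStructure T) (L : SimplicialStructure U) (f : K.K ⟶ L.K) :
    f ≫ L.toSing = K.toSing ≫ singMap (K.underlying L f) := by
  unfold SimplicialStructure.toSing SimplicialStructure.underlying
  rw [Category.assoc, ← singMap_comp, K.iso.hom_inv_id_assoc, singMap_comp,
    ← Category.assoc (unitPair K.K), ← unitPair_naturality, Category.assoc]

/-- The projection of the cylinder. -/
noncomputable def cylinderProj (T : TopPair.{u}) : cylinder T ⟶ T :=
  TopPair.ofHom (X := cylinder T) (Y := T)
    (TopCat.ofHom ⟨Prod.snd, continuous_snd⟩) (TopCat.ofHom ⟨Prod.snd, continuous_snd⟩)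
    (by ext y; rfl)

theorem cylinderIncl_proj (T : TopPair.{u}) (t : unitInterval) :
    cylinderIncl T t ≫ cylinderProj T = 𝟙 T := by
  ext x <;> rfl

theorem isHomotopyEquiv_cylinderProj (T : TopPair.{u}) : IsHomotopyEquiv (cylinderProj T) := by
  refine ⟨cylinderIncl T 0, ⟨?_⟩, ?_⟩
  · exact
      { fst :=
          { toFun := fun p => ((p.1 * p.2.1, p.2.2) : unitInterval × T.right)
            continuous_toFun := by fun_prop
            map_zero_left := fun q => Prod.ext (zero_mul (q : unitInterval × T.right).1) rfl
            map_one_left := fun q => Prod.ext (one_mul (q : unitInterval × T.right).1) rfl }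
        snd :=
          { toFun := fun p => ((p.1 * p.2.1, p.2.2) : unitInterval × T.left)
            continuous_toFun := by fun_prop
            map_zero_left := fun q => Prod.ext (zero_mul (q : unitInterval × T.left).1) rfl
            map_one_left := fun q => Prod.ext (one_mul (q : unitInterval × T.left).1) rfl }
        w := by ext p; rfl }
  · rw [cylinderIncl_proj]
    exact TopPair.Homotopic.equivalence.refl _

theorem isQI_cylinderIncl (T : TopPair.{u}) (t : unitInterval) :
    IsQI (singMap (cylinderIncl T t)) := by
  refine IsQI.of_comp_right (isHomotopyEquiv_cylinderProj T).isQI ?_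
  rw [← singMap_comp, cylinderIncl_proj]
  exact (IsHomotopyEquiv.of_iso (Iso.refl T)).isQI

theorem exists_cylinder_map {g₀ g₁ : T ⟶ U} (h : TopPair.Homotopic g₀ g₁) :
    ∃ F : cylinder T ⟶ U, cylinderIncl T 0 ≫ F = g₀ ∧ cylinderIncl T 1 ≫ F = g₁ := by
  obtain ⟨h⟩ := h
  let a : C(unitInterval × T.left, U.left) := h.snd.toContinuousMap
  let b : C(unitInterval × T.right, U.right) := h.fst.toContinuousMap
  refine ⟨TopPair.ofHom (X := cylinder T) (Y := U) (TopCat.ofHom b) (TopCat.ofHom a) ?_, ?_, ?_⟩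
  · ext p
    exact (TopPair.Homotopy.w_apply' h p.2 p.1).symm
  · ext x
    · exact h.snd.map_zero_left x
    · exact h.fst.map_zero_left x
  · ext x
    · exact h.snd.map_one_left x
    · exact h.fst.map_one_left x

variable (v : Flavor) (n : ℤ)

theorem IsQI.bijective_G {P Q : SPair.{u}} {f : P ⟶ Q} (hf : IsQI f) :
    Function.Bijective (G.map v.incl n f) :=
  G.map_bijective v.incl f (fun k => hf.bijective _ k) (fun k => hf.bijective _ k)

/-- Both ends are sections of the projection, and every class on the cylinder is pulled back along
it. Only bijectivity on `G` is used, no homotopy formula for its nonlinear cochains. -/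
theorem G_singMap_cylinderIncl (T : TopPair.{u}) :
    G.map v.incl n (singMap (cylinderIncl T 0)) = G.map v.incl n (singMap (cylinderIncl T 1)) := by
  refine AddMonoidHom.ext fun x => ?_
  obtain ⟨y, rfl⟩ := ((isHomotopyEquiv_cylinderProj T).isQI.bijective_G v n).2 x
  rw [← AddMonoidHom.comp_apply, ← AddMonoidHom.comp_apply, ← G.map_comp, ← G.map_comp,
    ← singMap_comp, ← singMap_comp, cylinderIncl_proj, cylinderIncl_proj]

theorem G_singMap_eq {g₀ g₁ : T ⟶ U} (h : TopPair.Homotopic g₀ g₁) :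
    G.map v.incl n (singMap g₀) = G.map v.incl n (singMap g₁) := by
  obtain ⟨F, rfl, rfl⟩ := exists_cylinder_map h
  rw [singMap_comp, singMap_comp, G.map_comp, G.map_comp, G_singMap_cylinderIncl]

/-- The identification of the groups of a simplicial structure with those of the singular
complex. -/
noncomputable def singEquiv (K : SimplicialStructure T) :
    G v.incl n (singPair T) ≃+ G v.incl n K.K :=
  AddEquiv.ofBijective (G.map v.incl n K.toSing) ((isQI_toSing K).bijective_G v n)

theorem singEquiv_naturality (K : SimplicialStructure T) (L : SimplicialStructure U)
    (f : K.K ⟶ L.K) (x : G v.incl n (singPair U)) :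
    G.map v.incl n f (singEquiv v n L x) =
      singEquiv v n K (G.map v.incl n (singMap (K.underlying L f)) x) := by
  change G.map v.incl n f (G.map v.incl n L.toSing x) =
    G.map v.incl n K.toSing (G.map v.incl n (singMap (K.underlying L f)) x)
  rw [← AddMonoidHom.comp_apply, ← AddMonoidHom.comp_apply, ← G.map_comp, ← G.map_comp,
    toSing_naturality]

theorem singEquiv_symm_map (K : SimplicialStructure T) (L : SimplicialStructure U)
    (f : K.K ⟶ L.K) (x : G v.incl n (singPair U)) :
    (singEquiv v n K).symm (G.map v.incl n f (singEquiv v n L x)) =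
      G.map v.incl n (singMap (K.underlying L f)) x := by
  rw [singEquiv_naturality, AddEquiv.symm_apply_apply]

theorem isQI_of_underlying (K : SimplicialStructure T) (L : SimplicialStructure U)
    (f : K.K ⟶ L.K) (h : IsQI (singMap (K.underlying L f))) : IsQI f := by
  refine IsQI.of_comp_right (isQI_toSing L) ?_
  rw [toSing_naturality]
  exact (isQI_toSing K).comp h

end Consequences

end SpinPin

/-! ### Assembly of the theorem. -/

open SpinPin

theorem mainTheorem9 (v : Flavor) (n : ℤ) :
    -- the short exact sequence
    (∀ P : SPair.{u},
      Function.Injective (ofQH v.incl n P) ∧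
      Function.Exact (ofQH v.incl n P) (toSH v.incl n P) ∧
      Function.Surjective (toSH v.incl n P)) ∧
    -- contravariant functoriality of the groups and of the exact sequence
    (∀ P : SPair.{u}, G.map v.incl n (𝟙 P) = AddMonoidHom.id (G v.incl n P)) ∧
    (∀ {P Q R : SPair.{u}} (f : P ⟶ Q) (g : Q ⟶ R),
      G.map v.incl n (f ≫ g) = (G.map v.incl n f).comp (G.map v.incl n g)) ∧
    (∀ {P Q : SPair.{u}} (f : P ⟶ Q),
      (G.map v.incl n f).comp (ofQH v.incl n Q) = (ofQH v.incl n P).comp (QH.map v.incl n f) ∧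
      (toSH v.incl n P).comp (G.map v.incl n f) = (SH.map v.incl n f).comp (toSH v.incl n Q)) ∧
    -- cohomology isomorphisms and homotopy equivalences induce isomorphisms
    (∀ {P Q : SPair.{u}} (f : P ⟶ Q),
      (∀ k : ℤ, Function.Bijective (H.map (ZMod 2) k f)) →
      (∀ k : ℤ, Function.Bijective (H.map UnitAddCircle k f)) →
      Function.Bijective (G.map v.incl n f)) ∧
    (∀ {P Q : SPair.{u}} (f : P ⟶ Q), IsHomotopyEquiv (realMap f) →
      Function.Bijective (G.map v.incl n f)) ∧
    -- homotopic maps of topological pairs agree on the groups of the singular complexes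
    (∀ {T U : TopPair.{u}} (g₀ g₁ : T ⟶ U), TopPair.Homotopic g₀ g₁ →
      G.map v.incl n (singMap g₀) = G.map v.incl n (singMap g₁)) ∧
    -- the canonical map to the singular complex identifies the groups of all simplicial structures
    ∃ Φ : ∀ {T : TopPair.{u}} (K : SimplicialStructure T),
        G v.incl n (singPair T) ≃+ G v.incl n K.K,
      (∀ {T : TopPair.{u}} (K : SimplicialStructure T),
        (Φ K).toAddMonoidHom = G.map v.incl n K.toSing) ∧
      -- compatibly with simplicial maps
      (∀ {T U : TopPair.{u}} (K : SimplicialStructure T) (L : SimplicialStructure U)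
        (f : K.K ⟶ L.K) (x : G v.incl n (singPair U)),
        G.map v.incl n f (Φ L x) = Φ K (G.map v.incl n (singMap (K.underlying L f)) x)) ∧
      -- topologically homotopic simplicial maps coincide under the identifications
      (∀ {T U : TopPair.{u}} (K₀ K₁ : SimplicialStructure T) (L₀ L₁ : SimplicialStructure U)
        (f₀ : K₀.K ⟶ L₀.K) (f₁ : K₁.K ⟶ L₁.K),
        TopPair.Homotopic (K₀.underlying L₀ f₀) (K₁.underlying L₁ f₁) →
        ∀ x : G v.incl n (singPair U),
          (Φ K₀).symm (G.map v.incl n f₀ (Φ L₀ x)) = (Φ K₁).symm (G.map v.incl n f₁ (Φ L₁ x))) ∧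
      -- a simplicial structure on the cylinder induces the same identification of its two ends
      (∀ {T : TopPair.{u}} (K₀ K₁ : SimplicialStructure T) (L : SimplicialStructure (cylinder T))
        (i₀ : K₀.K ⟶ L.K) (i₁ : K₁.K ⟶ L.K),
        K₀.underlying L i₀ = cylinderIncl T 0 → K₁.underlying L i₁ = cylinderIncl T 1 →
        Function.Bijective (G.map v.incl n i₀) ∧ Function.Bijective (G.map v.incl n i₁) ∧
        ∀ y : G v.incl n L.K,
          (Φ K₀).symm (G.map v.incl n i₀ y) = (Φ K₁).symm (G.map v.incl n i₁ y)) := by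
  refine ⟨fun P => ⟨ofQH_injective v.incl n P, exact_ofQH_toSH v.incl n P,
      toSH_surjective v.incl n P⟩, fun P => G.map_id v.incl n P, fun f g => G.map_comp v.incl n f g,
    fun f => ⟨G.map_comp_ofQH v.incl n f, toSH_comp_map v.incl n f⟩, ?_, ?_, ?_,
    fun K => singEquiv v n K, fun K => rfl, fun K L f x => singEquiv_naturality v n K L f x, ?_, ?_⟩
  · intro P Q f h₁ h₂
    -- In the pin case the coefficients `A` are `ℤ/2`, so the mod 2 hypothesis serves twice.
    cases v
    · exact G.map_bijective _ f h₁ h₂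
    · exact G.map_bijective _ f h₁ h₁
  · exact fun f h => (isQI_of_realMap f h).bijective_G v n
  · exact fun g₀ g₁ h => G_singMap_eq v n h
  · intro T U K₀ K₁ L₀ L₁ f₀ f₁ h x
    rw [singEquiv_symm_map, singEquiv_symm_map, G_singMap_eq v n h]
  · intro T K₀ K₁ L i₀ i₁ h₀ h₁
    refine ⟨(isQI_of_underlying K₀ L i₀ ?_).bijective_G v n,
      (isQI_of_underlying K₁ L i₁ ?_).bijective_G v n, fun y => ?_⟩
    · rw [h₀]
      exact isQI_cylinderIncl T 0
    · rw [h₁]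
      exact isQI_cylinderIncl T 1
    -- Every class of `L` comes from the singular complex of the cylinder, where the two ends
    -- already agree.
    · obtain ⟨x, rfl⟩ := (singEquiv v n L).surjective y
      rw [singEquiv_symm_map, singEquiv_symm_map, h₀, h₁, G_singMap_cylinderIncl]
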